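/- **Setting.** Let $f:[0,1]^3\to[0,1]$ be measurable with $f(x,y,t)=f(y,x,t)$ and $\max f=1$, and let $\beta,L_1>0$, $\ell=\lfloor\beta\rfloor$. Assume: 1. for all $x,y\in[0,1]$ the function $t\mapsto f(x,y,t)$ is $\ell$ times differentiable on $[0,1]$ and $|\partial_t^{\ell}f(x,y,t)-\partial_t^{\ell}f(x,y,t')|\le L_1|t-t'|^{\beta-\ell}$ for all $t,t'\in[0,1]$; 2. there are $\delta>0$ and a partition $0=x_0<\dots<x_J=1$ with $x_{k+1}-x_k>\delta$ such that, for every $t\in[0,1]$, $f(\cdot,\cdot,t)$ is Lipschitz with constant $L_2$ in each of its first two arguments on every block $[x_k,x_{k+1})\times[x_l,x_{l+1})$. For $\rho\in(0,1)$ let $\xi_1,\dots,\xi_n$ be i.i.d. uniform on $[0,1]$ and $P^{(t)}_{ij}=\rho f(\xi_i,\xi_j,t)$, $1\le i,j\le n$. At times $t_1,\dots,t_m\in[0,1]$ one observes symmetric matrices $A^{(t_k)}\in\{0,1\}^{n\times n}$ whose entries with $i\le j$ are, given $\xi_1,\dots,\xi_n$, independent (over $i\le j$ and $k$) with $A^{(t_k)}_{ij}\sim\mathrm{Bernoulli}(P^{(t_k)}_{ij})$.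 **Estimator.** Let $K:\mathbb R\to\mathbb R$ be bounded and vanish outside $[-1,1]$, and let $U(u)=(1,u,\dots,u^\ell)^\top$. For a bandwidth $h$ put $$B_{mt}(h)=\frac1{mh}\sum_{k=1}^m U\!\left(\tfrac{t_k-t}{h}\right)U\!\left(\tfrac{t_k-t}{h}\right)^{\!\top}K\!\left(\tfrac{t_k-t}{h}\right),\qquad w_k(t;h)=\frac1{mh}U(0)^\top B_{mt}(h)^{-1}U\!\left(\tfrac{t_k-t}{h}\right)K\!\left(\tfrac{t_k-t}{h}\right).$$ * Stage 1: $\tilde P^{(t)}=\sum_k w_k(t;h_1)A^{(t_k)}$. * Stage 2: let $\tilde d_t(i,i')=\sqrt{\max_{l\ne i,i'}|\langle\tilde P^{(t)}_{i\cdot}-\tilde P^{(t)}_{i'\cdot},\tilde P^{(t)}_{l\cdot}\rangle|/n}$ and let $q_{i,t}(h_2)$ be the $h_2$-quantile of $\{\tilde d_t(i,k)\}_{k=1}^n$. Put $\mathcal N_i^{(t)}=\{i':\tilde d_t(i,i')\le q_{i,t}(h_2)\}$ if $h_2>1/n$, and $\mathcal N_i^{(t)}=\{i\}$ if $h_2\le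 1/n$. Then $\hat P^{(t)}_{ij}=|\mathcal N^{(t)}_i|^{-1}\sum_{i'\in\mathcal N^{(t)}_i}\tilde P^{(t)}_{i'j}$ for all $1\le i,j\le n$. * Stage 3: $\bar P^{(t)}=\sum_k w_k(t;h_3)\hat P^{(t_k)}$. For constants $a_0,\lambda_0>0$ assume that $\frac1m\#\{k:t_k\in I\}\le a_0\max(|I|,1/m)$ for every interval $I\subseteq[0,1]$, and that the smallest eigenvalue of $B_{mt}(h)$ is at least $\lambda_0$ for all $t\in[0,1]$, for both bandwidths used, $h=h_1$ and $h=h_3$. **Bandwidths.** Fix constants $0<b_1\le b_2$ and $c_1,c_2>0$. Suppose $\rho\ge\sqrt{\log(nm)/(nm)}$. * Regime 1: $n\rho\ge c_1\sqrt{n\,m^{\beta/(\beta+1)}\log(nm)}$. Here $h_1$ and $h_2$ lie between $b_1$ times and $b_2$ times $\bigl(\frac{\log nm}{\rho^2nm}\bigr)^{1/(2\beta+1)}$ and $\rho^{1/(2\beta+1)}\bigl(\frac{\log nm}{nm}\bigr)^{\beta/(2\beta+1)}$ respectively, and $h_3=\rho^{-2/(2\beta+1)}\bigl(\frac{\log nm}{nm}\bigr)^{1/(2\beta+1)}$.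 * Regime 2: $n\rho\le c_2\sqrt{n\,m^{\beta/(\beta+1)}\log(nm)}$. Here $h_1$ lies between $b_1$ times and $b_2$ times $\bigl(\frac{\log nm}{\rho m}\bigr)^{1/(2\beta+1)}$, $b_1/n\le h_2\le 1/n$, and $h_3=\rho^{-2/(2\beta+1)}\bigl(\frac{\log nm}{m}\bigr)^{2/(2\beta+1)}$. **Theorem.** There are constants $C,\tilde C,\gamma>0$ and $N_0$, depending only on $f$ (with $\beta,L_1,L_2$), $K$, $\lambda_0,a_0$ and $b_1,b_2,c_1,c_2$, such that for all $n,m\ge N_0$ and all $\rho$, $t_1,\dots,t_m$, $h_1,h_2$ as above, with probability at least $1-2(nm)^{-(\tilde C+\gamma)}$, $$\sup_{t\in[0,1]}\frac1n\|\bar P^{(t)}-P^{(t)}\|_{2,\infty}^2\le\begin{cases}C\rho^{\frac{2\beta+2}{2\beta+1}}\bigl(\frac{\log nm}{nm}\bigr)^{\frac{\beta}{2\beta+1}}&\text{in Regime 1},\\[4pt] C\rho^{\frac{2\beta+2}{2\beta+1}}\bigl(\frac{\log nm}{m}\bigr)^{\frac{2\beta}{2\beta+1}}&\text{in Regime 2},\end{cases}$$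 where $\|B\|_{2,\infty}$ is the maximal Euclidean norm of a row of $B$. -/

import Mathlib

open MeasureTheory ProbabilityTheory Set
open scoped Matrix unitInterval

noncomputable section

namespace TVGraphon

/-! ### The model -/

/-- A time-varying graphon: a measurable function `f : [0,1]³ → [0,1]`, symmetric in its first
two arguments, with maximum `1`. Only the values of `f` on the unit cube are used. -/
structure IsGraphon (f : ℝ → ℝ → ℝ → ℝ) : Prop where
  measurable : Measurable fun p : I × I × I => f p.1 p.2.1 p.2.2
  symm : ∀ x ∈ Icc (0 : ℝ) 1, ∀ y ∈ Icc (0 : ℝ) 1, ∀ s ∈ Icc (0 : ℝ) 1, f x y s = f y x s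
  mem_unit : ∀ x ∈ Icc (0 : ℝ) 1, ∀ y ∈ Icc (0 : ℝ) 1, ∀ s ∈ Icc (0 : ℝ) 1,
    f x y s ∈ Icc (0 : ℝ) 1
  max_eq_one : ∃ x ∈ Icc (0 : ℝ) 1, ∃ y ∈ Icc (0 : ℝ) 1, ∃ s ∈ Icc (0 : ℝ) 1, f x y s = 1

/-- The Hölder class `ℍ^β(L)` on `[0,1]`: with `ℓ = ⌊β⌋`, the function is `ℓ` times
differentiable on `[0,1]` and its `ℓ`-th derivative is `(β - ℓ)`-Hölder with constant `L`. -/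
def HolderClass (β L : ℝ) (g : ℝ → ℝ) : Prop :=
  (∀ j < ⌊β⌋₊, DifferentiableOn ℝ (iteratedDerivWithin j g (Icc 0 1)) (Icc 0 1)) ∧
  ∀ s ∈ Icc (0 : ℝ) 1, ∀ s' ∈ Icc (0 : ℝ) 1,
    |iteratedDerivWithin ⌊β⌋₊ g (Icc 0 1) s - iteratedDerivWithin ⌊β⌋₊ g (Icc 0 1) s'|
      ≤ L * |s - s'| ^ (β - ⌊β⌋₊)

/-- Hölder smooth graphon: every time section belongs to `ℍ^β(L)`. -/
def HolderGraphon (β L : ℝ) (f : ℝ → ℝ → ℝ → ℝ) : Prop :=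
  ∀ x ∈ Icc (0 : ℝ) 1, ∀ y ∈ Icc (0 : ℝ) 1, HolderClass β L (f x y)

/-- Piecewise Lipschitz graphon with constant `L` in the first two arguments, on the blocks of
some partition `0 = x₀ < ⋯ < x_J = 1` whose cells are longer than some `δ > 0`. -/
def PiecewiseLipschitz (L : ℝ) (f : ℝ → ℝ → ℝ → ℝ) : Prop :=
  ∃ δ : ℝ, 0 < δ ∧ ∃ J : ℕ, 1 ≤ J ∧ ∃ x : ℕ → ℝ, x 0 = 0 ∧ x J = 1 ∧
    (∀ k < J, δ < x (k + 1) - x k) ∧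
    ∀ k < J, ∀ l < J, ∀ s ∈ Icc (0 : ℝ) 1,
      ∀ u ∈ Ico (x k) (x (k + 1)), ∀ u₁ ∈ Ico (x k) (x (k + 1)), ∀ u₂ ∈ Ico (x k) (x (k + 1)),
      ∀ v ∈ Ico (x l) (x (l + 1)), ∀ v₁ ∈ Ico (x l) (x (l + 1)), ∀ v₂ ∈ Ico (x l) (x (l + 1)),
        |f u₁ v s - f u₂ v s| ≤ L * |u₁ - u₂| ∧ |f u v₁ s - f u v₂ s| ≤ L * |v₁ - v₂|

/-- The edge probability matrix `P^{(s)}`, with `P_{ij}^{(s)} = ρ f(ξ_i, ξ_j, s)`, for the latent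
positions `x`. -/
def probMatrix {n : ℕ} (f : ℝ → ℝ → ℝ → ℝ) (ρ : ℝ) (x : Fin n → I) (s : ℝ) :
    Matrix (Fin n) (Fin n) ℝ :=
  Matrix.of fun i j => ρ * f (x i) (x j) s

/-- The sparse time-varying graphon model observed at times `t 0, …, t (m-1)`: the latent
positions `ξ i` are independent and uniform on `[0,1]`; the adjacency matrices `A k` (observed
at time `t k`) are symmetric with entries in `{0,1}`; and, given the latent positions, the entries
`A k i j` with `i ≤ j` are independent over all `(k, i, j)`, the law of `A k i j` being
Bernoulli with parameter `P_{ij}^{(t k)}`. -/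
structure IsGraphonSample {Ω : Type*} [MeasurableSpace Ω] (μ : Measure Ω) {n m : ℕ}
    (f : ℝ → ℝ → ℝ → ℝ) (ρ : ℝ) (t : Fin m → ℝ)
    (ξ : Fin n → Ω → I) (A : Fin m → Ω → Matrix (Fin n) (Fin n) ℝ) : Prop where
  measurable_latent : ∀ i, Measurable (ξ i)
  indep_latent : iIndepFun ξ μ
  uniform_latent : ∀ i, μ.map (ξ i) = volume
  measurable_adj : ∀ k i j, Measurable fun ω => A k ω i j
  zero_one : ∀ k ω i j, A k ω i j = 0 ∨ A k ω i j = 1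
  symm : ∀ k ω i j, A k ω i j = A k ω j i
  cond_law : ∀ a : Fin m → Fin n → Fin n → Bool,
    μ⟦{ω | ∀ k i j, i ≤ j → A k ω i j = if a k i j then 1 else 0} |
        MeasurableSpace.comap (fun ω i => ξ i ω) inferInstance⟧
      =ᵐ[μ] fun ω => ∏ k, ∏ i, ∏ j ∈ Finset.Ici i,
        if a k i j then probMatrix f ρ (fun i => ξ i ω) (t k) i j
        else 1 - probMatrix f ρ (fun i => ξ i ω) (t k) i j

/-! ### Local polynomial weights and their regularity conditions -/

/-- `U(u) = (1, u, …, u^ℓ)`. -/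
def polyVec (ℓ : ℕ) (u : ℝ) : Fin (ℓ + 1) → ℝ := fun p => u ^ (p : ℕ)

/-- The local polynomial design matrix `B_{ms}` at time `s` with bandwidth `h`. -/
def designMatrix {m : ℕ} (ℓ : ℕ) (K : ℝ → ℝ) (t : Fin m → ℝ) (h s : ℝ) :
    Matrix (Fin (ℓ + 1)) (Fin (ℓ + 1)) ℝ :=
  (1 / ((m : ℝ) * h)) • ∑ k, K ((t k - s) / h) •
    Matrix.vecMulVec (polyVec ℓ ((t k - s) / h)) (polyVec ℓ ((t k - s) / h))

theorem designMatrix_isHermitian {m : ℕ} (ℓ : ℕ) (K : ℝ → ℝ) (t : Fin m → ℝ) (h s : ℝ) :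
    (designMatrix ℓ K t h s).IsHermitian := by
  ext i j
  simp only [designMatrix, Matrix.conjTranspose_apply, Matrix.smul_apply, Matrix.sum_apply,
    Matrix.vecMulVec_apply, star_trivial]
  congr 1
  exact Finset.sum_congr rfl fun k _ => by rw [mul_comm (polyVec ℓ _ j)]

/-- The smallest eigenvalue of the design matrix. -/
def lambdaMin {m : ℕ} (ℓ : ℕ) (K : ℝ → ℝ) (t : Fin m → ℝ) (h s : ℝ) : ℝ :=
  ⨅ i, (designMatrix_isHermitian ℓ K t h s).eigenvalues i

/-- The equivalent kernel weight `w_k(s; h)` of local polynomial regression of degree `ℓ`. -/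
def weight {m : ℕ} (ℓ : ℕ) (K : ℝ → ℝ) (t : Fin m → ℝ) (h s : ℝ) (k : Fin m) : ℝ :=
  (1 / ((m : ℝ) * h)) *
    (polyVec ℓ 0 ⬝ᵥ ((designMatrix ℓ K t h s)⁻¹ *ᵥ polyVec ℓ ((t k - s) / h))) *
    K ((t k - s) / h)

/-- The eigenvalue condition for the smoother with bandwidth `h`. -/
def EigenvalueCondition {m : ℕ} (ℓ : ℕ) (K : ℝ → ℝ) (t : Fin m → ℝ) (lam h : ℝ) : Prop :=
  ∀ s ∈ Icc (0 : ℝ) 1, lam ≤ lambdaMin ℓ K t h s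

/-- The design points are not overly concentrated on small intervals. (Replacing an interval by
its closure does not change its length, so closed intervals suffice.) -/
def DesignCondition {m : ℕ} (t : Fin m → ℝ) (a₀ : ℝ) : Prop :=
  ∀ a b : ℝ, 0 ≤ a → a ≤ b → b ≤ 1 →
    (1 / (m : ℝ)) * ({k | t k ∈ Icc a b} : Set (Fin m)).ncard ≤ a₀ * max (b - a) (1 / (m : ℝ))

/-- The kernel is supported in `[-1,1]` and bounded. -/
def KernelCondition (K : ℝ → ℝ) : Prop :=
  (∀ u, 1 < |u| → K u = 0) ∧ ∃ Kmax : ℝ, ∀ u, |K u| ≤ Kmax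

/-! ### The estimators -/

/-- First stage: `P̃^{(s)}`, temporal local polynomial smoothing with bandwidth `h₁` of the
observed adjacency matrices `A`. -/
def stageOne {n m : ℕ} (ℓ : ℕ) (K : ℝ → ℝ) (t : Fin m → ℝ) (h₁ : ℝ)
    (A : Fin m → Matrix (Fin n) (Fin n) ℝ) (s : ℝ) : Matrix (Fin n) (Fin n) ℝ :=
  ∑ k, weight ℓ K t h₁ s k • A k

/-- The empirical distance between two nodes computed from a matrix `Q`. -/
def nodeDist {n : ℕ} (Q : Matrix (Fin n) (Fin n) ℝ) (i j : Fin n) : ℝ :=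
  Real.sqrt ((⨆ l : {l : Fin n // l ≠ i ∧ l ≠ j}, |(Q i - Q j) ⬝ᵥ Q l|) / n)

/-- The `h`-quantile of the distances from node `i`: the least `q` such that at least a fraction
`h` of the nodes are within distance `q` of `i`. -/
def distQuantile {n : ℕ} (Q : Matrix (Fin n) (Fin n) ℝ) (h : ℝ) (i : Fin n) : ℝ :=
  sInf {q : ℝ | h * n ≤ (({k | nodeDist Q i k ≤ q} : Set (Fin n)).ncard : ℝ)}

open scoped Classical in
/-- The neighbourhood of node `i` at quantile level `h`: the nodes whose distance to `i` is at most
the `h`-quantile. At levels `h ≤ 1/n`, where the quantile is attained by `i` itself, the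
neighbourhood is the singleton `{i}` (exact ties at distance `0` are not admitted). -/
def nbhd {n : ℕ} (Q : Matrix (Fin n) (Fin n) ℝ) (h : ℝ) (i : Fin n) : Finset (Fin n) :=
  if h * n ≤ 1 then {i}
  else Finset.univ.filter fun j => nodeDist Q i j ≤ distQuantile Q h i

/-- Neighbourhood smoothing of a matrix `Q` at quantile level `h`. -/
def nbhdSmooth {n : ℕ} (Q : Matrix (Fin n) (Fin n) ℝ) (h : ℝ) : Matrix (Fin n) (Fin n) ℝ :=
  Matrix.of fun i j => (1 / ((nbhd Q h i).card : ℝ)) * ∑ i' ∈ nbhd Q h i, Q i' j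

/-- Second stage: `P̂^{(s)}`. -/
def stageTwo {n m : ℕ} (ℓ : ℕ) (K : ℝ → ℝ) (t : Fin m → ℝ) (h₁ h₂ : ℝ)
    (A : Fin m → Matrix (Fin n) (Fin n) ℝ) (s : ℝ) : Matrix (Fin n) (Fin n) ℝ :=
  nbhdSmooth (stageOne ℓ K t h₁ A s) h₂

/-- Third stage: `P̄^{(s)} = ∑ₖ w_k(s; h₃) P̂^{(t_k)}`. -/
def stageThree {n m : ℕ} (ℓ : ℕ) (K : ℝ → ℝ) (t : Fin m → ℝ) (h₁ h₂ h₃ : ℝ)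
    (A : Fin m → Matrix (Fin n) (Fin n) ℝ) (s : ℝ) : Matrix (Fin n) (Fin n) ℝ :=
  ∑ k, weight ℓ K t h₃ s k • stageTwo ℓ K t h₁ h₂ A (t k)

/-- The norm `‖B‖_{2,∞}`: the maximal Euclidean norm of a row. -/
def twoInftyNorm {n : ℕ} (B : Matrix (Fin n) (Fin n) ℝ) : ℝ :=
  ⨆ i, Real.sqrt (∑ j, B i j ^ 2)

/-- The event that `sup_{s ∈ [0,1]} (1/n) ‖P̄^{(s)} - P^{(s)}‖²_{2,∞} ≤ r`. -/
def uniformErrorLE {Ω : Type*} {n m : ℕ} (f : ℝ → ℝ → ℝ → ℝ) (ρ : ℝ) (ℓ : ℕ) (K : ℝ → ℝ)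
    (t : Fin m → ℝ) (h₁ h₂ h₃ : ℝ) (ξ : Fin n → Ω → I)
    (A : Fin m → Ω → Matrix (Fin n) (Fin n) ℝ) (r : ℝ) : Set Ω :=
  {ω | ∀ s ∈ Icc (0 : ℝ) 1,
    (1 / (n : ℝ)) * twoInftyNorm (stageThree ℓ K t h₁ h₂ h₃ (fun k => A k ω) s
      - probMatrix f ρ (fun i => ξ i ω) s) ^ 2 ≤ r}

/-! ### Bandwidths, rates and the regime boundary -/

/-- `log(nm)`. -/
def logNM (n m : ℕ) : ℝ := Real.log ((n : ℝ) * m)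

/-- The regime boundary `√(n m^{β/(β+1)} log(nm))`, to be compared with `n ρ`. -/
def boundary (β : ℝ) (n m : ℕ) : ℝ :=
  Real.sqrt (n * (m : ℝ) ^ (β / (β + 1)) * logNM n m)

/-- First regime: `(log(nm) / (ρ² n m))^{1/(2β+1)}`. -/
def h1Dense (β ρ : ℝ) (n m : ℕ) : ℝ := (logNM n m / (ρ ^ 2 * n * m)) ^ (1 / (2 * β + 1))

/-- First regime: `ρ^{1/(2β+1)} (log(nm) / (nm))^{β/(2β+1)}`. -/
def h2Dense (β ρ : ℝ) (n m : ℕ) : ℝ :=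
  ρ ^ (1 / (2 * β + 1)) * (logNM n m / (n * m)) ^ (β / (2 * β + 1))

/-- First regime: `ρ^{-2/(2β+1)} (log(nm) / (nm))^{1/(2β+1)}`. -/
def h3Dense (β ρ : ℝ) (n m : ℕ) : ℝ :=
  ρ ^ (-2 / (2 * β + 1)) * (logNM n m / (n * m)) ^ (1 / (2 * β + 1))

/-- First regime: `ρ^{(2β+2)/(2β+1)} (log(nm) / (nm))^{β/(2β+1)}`. -/
def rateDense (β ρ : ℝ) (n m : ℕ) : ℝ :=
  ρ ^ ((2 * β + 2) / (2 * β + 1)) * (logNM n m / (n * m)) ^ (β / (2 * β + 1))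

/-- Second regime: `(log(nm) / (ρ m))^{1/(2β+1)}`. -/
def h1Sparse (β ρ : ℝ) (n m : ℕ) : ℝ := (logNM n m / (ρ * m)) ^ (1 / (2 * β + 1))

/-- Second regime: `ρ^{-2/(2β+1)} (log(nm) / m)^{2/(2β+1)}`. -/
def h3Sparse (β ρ : ℝ) (n m : ℕ) : ℝ :=
  ρ ^ (-2 / (2 * β + 1)) * (logNM n m / m) ^ (2 / (2 * β + 1))

/-- Second regime: `ρ^{(2β+2)/(2β+1)} (log(nm) / m)^{2β/(2β+1)}`. -/
def rateSparse (β ρ : ℝ) (n m : ℕ) : ℝ :=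
  ρ ^ ((2 * β + 2) / (2 * β + 1)) * (logNM n m / m) ^ (2 * β / (2 * β + 1))

end TVGraphon

end

namespace TVGraphon

/-! ### The design matrix and the local polynomial weights -/

/-! Write `stageOne` as M + Z, with M its mean given the latent positions and Z the noise. Local
polynomial weights reproduce polynomials of degree at most ℓ and have bounded ℓ¹ norm
(`exists_weightBounds`). Hence M differs from P entrywise by O(ρ y), where y = h^β and h is the
reference size of h₁. Given the positions, the entries of Z over unordered pairs are independent
weighted Bernoulli sums with variance O(ρ/(mh)). `IsGraphonSample.measureReal_le` turns the
conditional law into this product law.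

The ℓ¹ bound also shows that stage three costs only a constant factor and a bias, at every s
(`stageThree_error_le`). So the supremum over s reduces to row errors of stage two at the m
observation times, and a union bound suffices.

In Regime 2 stage two does nothing. A Bernstein bound on each entry gives errors O(ρ y), that is,
the rate ρ² y².

In Regime 1 let R = nρ²y, the target for the squared row error. The neighbourhoods depend on the
noise, so averages over them cannot be treated as sums of independent terms. Instead all products
M_l·Z_i, all Z_i·Z_l with i ≠ l and all squared norms of Z_i are controlled at once
(`IsGraphonSample.measureReal_noise_products`): the products are O(R) and the squared norms O(R h₂
n). On that event the argument is deterministic (`sum_sq_nbhdSmooth_sub_le`). Inner products of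
distinct rows of M + Z estimate those of P within O(R). Nodes in a common cell of a grid of mesh of
order y are close, and each cell holds at least h₂n nodes, so the distance quantile is small.
Conversely a small distance forces the squared norm of P_i - P_i' to be O(R), since that is a
difference of two inner products. Averaging at least h₂n rows brings the diagonal noise down to
O(R). The regime boundary enters as m h^(β+1) = O(1), which is what makes log(nm) = O(R). -/

theorem quadForm_lower_of_le_eigenvalues {d : Type*} [Fintype d] [DecidableEq d]
    {B : Matrix d d ℝ} (hB : B.IsHermitian) {lam : ℝ} (h : ∀ i, lam ≤ hB.eigenvalues i)
    (v : d → ℝ) : lam * (v ⬝ᵥ v) ≤ v ⬝ᵥ (B *ᵥ v) := by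
  have key : (B - lam • (1 : Matrix d d ℝ)).PosSemidef := by
    have : B - lam • (1 : Matrix d d ℝ) = Unitary.conjStarAlgAut ℝ _ hB.eigenvectorUnitary
        (Matrix.diagonal fun i => hB.eigenvalues i - lam) := by
      have h1 : (Matrix.diagonal fun i => hB.eigenvalues i - lam)
          = Matrix.diagonal (RCLike.ofReal ∘ hB.eigenvalues) - lam • (1 : Matrix d d ℝ) := by
        ext i j
        by_cases hij : i = j <;> simp [hij]
      rw [h1, map_sub, map_smul, map_one, ← hB.spectral_theorem]
    rw [this, Unitary.conjStarAlgAut_apply]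
    rw [Matrix.IsUnit.posSemidef_star_right_conjugate_iff Unitary.isUnit_coe,
      Matrix.posSemidef_diagonal_iff]
    intro i
    linarith [h i]
  have := key.dotProduct_mulVec_nonneg v
  simp only [star_trivial, Matrix.sub_mulVec, Matrix.smul_mulVec, Matrix.one_mulVec,
    dotProduct_sub, dotProduct_smul, smul_eq_mul] at this
  linarith

theorem lambdaMin_le_eigenvalues {m ℓ : ℕ} {K : ℝ → ℝ} {t : Fin m → ℝ} {h s lam : ℝ}
    (hl : lam ≤ lambdaMin ℓ K t h s) (i : Fin (ℓ + 1)) :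
    lam ≤ (designMatrix_isHermitian ℓ K t h s).eigenvalues i :=
  hl.trans (ciInf_le (Finite.bddBelow_range _) i)

/-- For y = B⁻¹v, coercivity gives lam‖y‖² ≤ y·v ≤ ‖y‖₁ ≤ √(ℓ+1)‖y‖, hence ‖y‖ ≤ √(ℓ+1)/lam. The
stated constant gives away the square root. -/
theorem abs_inv_mulVec_zero_le {ℓ : ℕ} {B : Matrix (Fin (ℓ + 1)) (Fin (ℓ + 1)) ℝ} {lam : ℝ}
    (hlam : 0 < lam) (hdet : IsUnit B.det) (hB : ∀ v, lam * (v ⬝ᵥ v) ≤ v ⬝ᵥ (B *ᵥ v))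
    (v : Fin (ℓ + 1) → ℝ) (hv : ∀ i, |v i| ≤ 1) : |(B⁻¹ *ᵥ v) 0| ≤ (ℓ + 1) / lam := by
  set y := B⁻¹ *ᵥ v with hy
  have hBy : B *ᵥ y = v := by
    rw [hy, Matrix.mulVec_mulVec, Matrix.mul_nonsing_inv _ hdet, Matrix.one_mulVec]
  have h1 := hB y
  rw [hBy] at h1
  have hyy : y ⬝ᵥ y = ∑ i, y i ^ 2 := by
    simp [dotProduct, sq]
  have hyv : y ⬝ᵥ v ≤ ∑ i, |y i| := Finset.sum_le_sum fun i _ => by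
    calc y i * v i ≤ |y i * v i| := le_abs_self _
      _ = |y i| * |v i| := abs_mul _ _
      _ ≤ |y i| * 1 := by gcongr; exact hv i
      _ = |y i| := mul_one _
  have hcs : (∑ i, |y i|) ^ 2 ≤ (ℓ + 1) * ∑ i, y i ^ 2 := by
    have := sq_sum_le_card_mul_sum_sq (s := Finset.univ) (f := fun i => |y i|)
    simpa using this
  have h0 : y 0 ^ 2 ≤ ∑ i, y i ^ 2 :=
    Finset.single_le_sum (f := fun i => y i ^ 2) (fun i _ => sq_nonneg _) (Finset.mem_univ 0)
  set S := ∑ i, y i ^ 2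
  set T := ∑ i, |y i|
  have hS : 0 ≤ S := Finset.sum_nonneg fun i _ => sq_nonneg _
  have hT : 0 ≤ T := Finset.sum_nonneg fun i _ => abs_nonneg _
  rw [hyy] at h1
  have h2 : lam * S ≤ T := h1.trans hyv
  have h3 : lam ^ 2 * S ≤ ℓ + 1 := by
    rcases hS.eq_or_lt with h | h
    · rw [← h]; simp; positivity
    · have : (lam * S) ^ 2 ≤ (ℓ + 1) * S := (pow_le_pow_left₀ (by positivity) h2 2).trans hcs
      have : (lam ^ 2 * S) * S ≤ (ℓ + 1) * S := by linarith [this]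
      exact le_of_mul_le_mul_right this h
  rw [le_div_iff₀ hlam]
  apply abs_le_of_sq_le_sq' _ (by positivity) |>.2
  rw [mul_pow, sq_abs]
  have hl0 : (0 : ℝ) ≤ ℓ := Nat.cast_nonneg _
  nlinarith [mul_le_mul_of_nonneg_left h0 (sq_nonneg lam)]

theorem isUnit_det_designMatrix {m ℓ : ℕ} {K : ℝ → ℝ} {t : Fin m → ℝ} {h s lam : ℝ}
    (hlam : 0 < lam) (hl : lam ≤ lambdaMin ℓ K t h s) : IsUnit (designMatrix ℓ K t h s).det := by
  rw [(designMatrix_isHermitian ℓ K t h s).det_eq_prod_eigenvalues, isUnit_iff_ne_zero]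
  refine Finset.prod_ne_zero_iff.2 fun i _ => ?_
  have := lambdaMin_le_eigenvalues hl i
  simp only [RCLike.ofReal_real_eq_id, id_eq]
  linarith

theorem polyVec_zero_dotProduct (ℓ : ℕ) (v : Fin (ℓ + 1) → ℝ) : polyVec ℓ 0 ⬝ᵥ v = v 0 := by
  rw [dotProduct, Finset.sum_eq_single 0]
  · simp [polyVec]
  · intro i _ hi
    have : (i : ℕ) ≠ 0 := fun h => hi (Fin.ext h)
    simp [polyVec, zero_pow this]
  · simp

theorem abs_polyVec_le_one {ℓ : ℕ} {u : ℝ} (hu : |u| ≤ 1) (i : Fin (ℓ + 1)) :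
    |polyVec ℓ u i| ≤ 1 := by
  rw [polyVec, abs_pow]
  exact pow_le_one₀ (abs_nonneg _) hu

theorem weight_eq {m ℓ : ℕ} (K : ℝ → ℝ) (t : Fin m → ℝ) (h s : ℝ) (k : Fin m) :
    weight ℓ K t h s k = (1 / ((m : ℝ) * h)) *
      ((designMatrix ℓ K t h s)⁻¹ *ᵥ polyVec ℓ ((t k - s) / h)) 0 * K ((t k - s) / h) := by
  rw [weight, polyVec_zero_dotProduct]

theorem weight_eq_zero {m ℓ : ℕ} {K : ℝ → ℝ} (hK : ∀ u, 1 < |u| → K u = 0) {t : Fin m → ℝ}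
    {h s : ℝ} (hh : 0 < h) {k : Fin m} (hk : h < |t k - s|) : weight ℓ K t h s k = 0 := by
  rw [weight, hK, mul_zero]
  rw [abs_div, abs_of_pos hh, lt_div_iff₀ hh]
  linarith

theorem abs_weight_le {m ℓ : ℕ} {K : ℝ → ℝ} (hK : ∀ u, 1 < |u| → K u = 0) {Kmax : ℝ}
    (hKmax : ∀ u, |K u| ≤ Kmax) {t : Fin m → ℝ} {h s lam : ℝ} (hh : 0 < h) (hlam : 0 < lam)
    (hl : lam ≤ lambdaMin ℓ K t h s) (k : Fin m) :
    |weight ℓ K t h s k| ≤ ((ℓ + 1) / lam * Kmax) / (m * h) := by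
  have hK0 : 0 ≤ Kmax := (abs_nonneg _).trans (hKmax 0)
  by_cases hk : h < |t k - s|
  · rw [weight_eq_zero hK hh hk, abs_zero]; positivity
  · have hu : |(t k - s) / h| ≤ 1 := by
      rw [abs_div, abs_of_pos hh, div_le_one hh]; linarith
    have h1 := abs_inv_mulVec_zero_le hlam (isUnit_det_designMatrix hlam hl)
      (quadForm_lower_of_le_eigenvalues _ (lambdaMin_le_eigenvalues hl))
      (polyVec ℓ ((t k - s) / h)) (abs_polyVec_le_one hu)
    rw [weight_eq, abs_mul, abs_mul, abs_of_nonneg (by positivity : 0 ≤ 1 / ((m : ℝ) * h)),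
      mul_assoc]
    refine le_of_le_of_eq ?_ (one_div_mul_eq_div ((m : ℝ) * h) _)
    exact mul_le_mul_of_nonneg_left (mul_le_mul h1 (hKmax _) (abs_nonneg _) (by positivity))
      (by positivity)

/-- The sum is the (0, p) entry of B⁻¹B. This removes all Taylor terms of positive order from the
bias. -/
theorem sum_weight_mul_pow {m ℓ : ℕ} {K : ℝ → ℝ} {t : Fin m → ℝ} {h s lam : ℝ}
    (hlam : 0 < lam) (hl : lam ≤ lambdaMin ℓ K t h s) {p : ℕ} (hp : p ≤ ℓ) :
    ∑ k, weight ℓ K t h s k * ((t k - s) / h) ^ p = if p = 0 then 1 else 0 := by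
  have hinv := Matrix.nonsing_inv_mul _ (isUnit_det_designMatrix hlam hl)
  have h2 := congrFun (congrFun hinv 0) (⟨p, by omega⟩ : Fin (ℓ + 1))
  have h3 : (1 : Matrix (Fin (ℓ + 1)) (Fin (ℓ + 1)) ℝ) 0 ⟨p, by omega⟩
      = if p = 0 then 1 else 0 := by
    rw [Matrix.one_apply]
    congr 1
    simp [Fin.ext_iff, eq_comm]
  rw [← h3, ← h2, Matrix.mul_apply]
  conv_rhs =>
    enter [2, j, 2]
    rw [designMatrix]
  simp only [Matrix.smul_apply, Matrix.sum_apply, Matrix.vecMulVec_apply, smul_eq_mul,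
    Finset.mul_sum]
  rw [Finset.sum_comm]
  refine Finset.sum_congr rfl fun k _ => ?_
  rw [weight_eq, Matrix.mulVec, dotProduct]
  simp only [Finset.mul_sum, Finset.sum_mul]
  refine Finset.sum_congr rfl fun j _ => ?_
  simp only [polyVec]
  ring

theorem exists_abs_sub_le_of_lambdaMin_pos {m ℓ : ℕ} {K : ℝ → ℝ} (hK : ∀ u, 1 < |u| → K u = 0)
    {t : Fin m → ℝ} {h s lam : ℝ} (hh : 0 < h) (hlam : 0 < lam)
    (hl : lam ≤ lambdaMin ℓ K t h s) : ∃ k, |t k - s| ≤ h := by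
  by_contra! hcon
  have h1 := sum_weight_mul_pow (K := K) (t := t) hlam hl (Nat.zero_le ℓ)
  simp [weight_eq_zero hK hh (hcon _)] at h1

/-- Without a design point within `h` of `s` all weights at `s` would vanish, yet they sum to one.
So m intervals of length 2h cover [0,1]. It makes 2h dominate 1/m in `DesignCondition`. -/
theorem one_le_two_mul_bandwidth {m ℓ : ℕ} {K : ℝ → ℝ} (hK : ∀ u, 1 < |u| → K u = 0)
    {t : Fin m → ℝ} {h lam : ℝ} (hh : 0 < h) (hlam : 0 < lam)
    (hE : EigenvalueCondition ℓ K t lam h) : 1 ≤ 2 * ((m : ℝ) * h) := by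
  have hsub : Icc (0 : ℝ) 1 ⊆ ⋃ k : Fin m, Icc (t k - h) (t k + h) := by
    intro s hs
    obtain ⟨k, hk⟩ := exists_abs_sub_le_of_lambdaMin_pos hK hh hlam (hE s hs)
    rw [abs_le] at hk
    exact mem_iUnion.2 ⟨k, by constructor <;> linarith⟩
  have h1 := (measure_mono hsub).trans (measure_iUnion_fintype_le (volume : Measure ℝ) _)
  simp only [Real.volume_Icc, sub_zero] at h1
  rw [← ENNReal.ofReal_sum_of_nonneg (fun k _ => by linarith)] at h1
  have h2 := (ENNReal.ofReal_le_ofReal_iff (by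
    exact Finset.sum_nonneg fun k _ => by linarith)).1 h1
  simp only [add_sub_sub_cancel, Finset.sum_const, Finset.card_univ, Fintype.card_fin,
    nsmul_eq_mul] at h2
  linarith

/-- The (0,0) entry of the design matrix lies between `lam` and Kmax/h. In the sparse regime the
formula for the bandwidth does not bound it by itself. -/
theorem bandwidth_le {m ℓ : ℕ} {K : ℝ → ℝ} {Kmax : ℝ}
    (hKmax : ∀ u, |K u| ≤ Kmax) {t : Fin m → ℝ} {h lam : ℝ} (hh : 0 < h) (hlam : 0 < lam)
    (hE : EigenvalueCondition ℓ K t lam h) : h ≤ Kmax / lam := by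
  have hK0 : 0 ≤ Kmax := (abs_nonneg _).trans (hKmax 0)
  have hl := hE 0 (by simp)
  have h1 := quadForm_lower_of_le_eigenvalues _ (lambdaMin_le_eigenvalues hl) (Pi.single 0 1)
  simp only [dotProduct_single, Pi.single_eq_same, mul_one, Matrix.mulVec_single, single_dotProduct,
    one_mul, MulOpposite.op_one, one_smul, Matrix.col_apply] at h1
  have h2 : designMatrix ℓ K t h 0 0 0 = (1 / ((m : ℝ) * h)) * ∑ k, K ((t k - 0) / h) := by
    simp [designMatrix, Matrix.sum_apply, Matrix.vecMulVec_apply, polyVec]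
  rw [h2] at h1
  have h3 : ∑ k, K ((t k - 0) / h) ≤ m * Kmax := by
    calc _ ≤ ∑ _k : Fin m, Kmax := Finset.sum_le_sum fun k _ => (le_abs_self _).trans (hKmax _)
      _ = _ := by simp
  rcases Nat.eq_zero_or_pos m with hm | hm
  · subst hm; simp at h1; linarith
  have hm' : (0 : ℝ) < m := by exact_mod_cast hm
  have h4 : lam ≤ (1 / ((m : ℝ) * h)) * (m * Kmax) := h1.trans (by gcongr)
  rw [le_div_iff₀ hlam]
  calc h * lam ≤ h * ((1 / ((m : ℝ) * h)) * (m * Kmax)) := by gcongr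
    _ = Kmax := by field_simp

theorem card_design_near_le {m : ℕ} {t : Fin m → ℝ} (ht : ∀ k, t k ∈ Icc (0 : ℝ) 1) {a₀ : ℝ}
    (ha₀ : 0 < a₀) (hD : DesignCondition t a₀) {h s : ℝ} (hs : s ∈ Icc (0 : ℝ) 1) (hh : 0 < h)
    (hmh : 1 ≤ 2 * ((m : ℝ) * h)) :
    ((Finset.univ.filter fun k => |t k - s| ≤ h).card : ℝ) ≤ 2 * a₀ * (m * h) := by
  have hm' : (0 : ℝ) < m := by
    by_contra hcon
    have := mul_nonneg_of_nonpos_of_nonpos (not_lt.1 hcon) (neg_nonpos.2 hh.le)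
    linarith
  have h1 := hD (max 0 (s - h)) (min 1 (s + h)) (le_max_left _ _)
    (by simp only [max_le_iff, le_min_iff]
        refine ⟨⟨by norm_num, ?_⟩, ?_, ?_⟩ <;> linarith [hs.1, hs.2]) (min_le_left _ _)
  have hset : ({k | t k ∈ Icc (max 0 (s - h)) (min 1 (s + h))} : Set (Fin m))
      = ↑(Finset.univ.filter fun k => |t k - s| ≤ h) := by
    ext k
    simp only [mem_Icc, max_le_iff, le_min_iff, Finset.coe_filter, Finset.mem_univ, true_and,
      mem_ofPred_eq, abs_le]
    constructor
    · rintro ⟨⟨_, _⟩, _, _⟩; constructor <;> linarith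
    · rintro ⟨_, _⟩; exact ⟨⟨(ht k).1, by linarith⟩, (ht k).2, by linarith⟩
  rw [hset, Set.ncard_coe_finset] at h1
  have h2 : max (min 1 (s + h) - max 0 (s - h)) (1 / (m : ℝ)) ≤ 2 * h := by
    refine max_le ?_ ?_
    · linarith [min_le_right 1 (s + h), le_max_right 0 (s - h)]
    · rw [div_le_iff₀ hm']; linarith
  have h3 := h1.trans (mul_le_mul_of_nonneg_left h2 ha₀.le)
  rw [one_div, inv_mul_le_iff₀ hm'] at h3
  linarith

/-! ### Taylor expansion with a Hölder remainder -/

/-- Induction on `n`: the remainder of `G 0` has the remainder of `G 1`, of one order less, as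
derivative, and the mean value inequality contributes one factor |x - s|. The factorial gain is not
kept. -/
theorem abs_sub_taylor_le_of_hasDerivWithinAt (n : ℕ) (G : ℕ → ℝ → ℝ) (L α s : ℝ) (hL : 0 ≤ L)
    (hα : 0 ≤ α) (hs : s ∈ Icc (0 : ℝ) 1)
    (hG : ∀ p < n, ∀ x ∈ Icc (0 : ℝ) 1, HasDerivWithinAt (G p) (G (p + 1) x) (Icc 0 1) x)
    (hH : ∀ x ∈ Icc (0 : ℝ) 1, |G n x - G n s| ≤ L * |x - s| ^ α) :
    ∀ x ∈ Icc (0 : ℝ) 1,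
      |G 0 x - ∑ q ∈ Finset.range (n + 1), G q s * (x - s) ^ q / (q.factorial : ℝ)|
        ≤ L * |x - s| ^ (n + α) := by
  induction n generalizing G with
  | zero =>
    intro x hx
    simpa using hH x hx
  | succ n ih =>
    intro x hx
    have ih' := ih (fun p => G (p + 1)) (fun p hp => hG (p + 1) (by omega)) hH
    set R : ℝ → ℝ := fun y => G 0 y - ∑ q ∈ Finset.range (n + 1 + 1),
      G q s * (y - s) ^ q / (q.factorial : ℝ) with hR
    have hsub : uIcc s x ⊆ Icc (0 : ℝ) 1 := by
      exact uIcc_subset_Icc hs hx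
    have hder : ∀ y ∈ uIcc s x, HasDerivWithinAt R (G 1 y - ∑ q ∈ Finset.range (n + 1),
        G (q + 1) s * (y - s) ^ q / (q.factorial : ℝ)) (uIcc s x) y := by
      intro y hy
      have h1 := (hG 0 (by omega) y (hsub hy)).mono hsub
      refine h1.sub ?_
      have h2 : HasDerivWithinAt (fun y => ∑ q ∈ Finset.range (n + 1 + 1),
          G q s * (y - s) ^ q / (q.factorial : ℝ)) (∑ q ∈ Finset.range (n + 1 + 1),
          G q s * (q * (y - s) ^ (q - 1)) / (q.factorial : ℝ)) (uIcc s x) y := by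
        refine HasDerivWithinAt.fun_sum fun q _ => ?_
        have := (((hasDerivAt_id y).sub_const s).pow q).const_mul (G q s)
        have := (this.div_const (q.factorial : ℝ)).hasDerivWithinAt (s := uIcc s x)
        simpa using this
      refine h2.congr_deriv ?_
      rw [Finset.sum_range_succ']
      simp only [Nat.cast_zero, zero_mul, mul_zero, zero_div, add_zero]
      refine Finset.sum_congr rfl fun q _ => ?_
      rw [Nat.factorial_succ, Nat.add_sub_cancel]
      push_cast
      have : (q.factorial : ℝ) ≠ 0 := by positivity
      field_simp
    have hbound : ∀ y ∈ uIcc s x, ‖G 1 y - ∑ q ∈ Finset.range (n + 1),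
        G (q + 1) s * (y - s) ^ q / (q.factorial : ℝ)‖ ≤ L * |x - s| ^ (n + α) := by
      intro y hy
      refine (ih' y (hsub hy)).trans ?_
      exact mul_le_mul_of_nonneg_left (Real.rpow_le_rpow (abs_nonneg _)
        (abs_sub_left_of_mem_uIcc hy) (by positivity)) hL
    have hmv := (convex_uIcc s x).norm_image_sub_le_of_norm_hasDerivWithin_le hder hbound
      left_mem_uIcc right_mem_uIcc
    have hRs : R s = 0 := by
      simp only [hR, sub_self]
      rw [Finset.sum_range_succ']
      simp
    rw [hRs, sub_zero, Real.norm_eq_abs, Real.norm_eq_abs] at hmv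
    refine hmv.trans (le_of_eq ?_)
    rw [mul_assoc]
    congr 1
    have : ((n + 1 : ℕ) : ℝ) + α = (n + α) + 1 := by push_cast; ring
    rw [this, Real.rpow_add_one' (abs_nonneg _) (by positivity)]

theorem HolderClass.abs_sub_taylor_le {β L : ℝ} (hβ : 0 ≤ β) (hL : 0 ≤ L) {g : ℝ → ℝ}
    (hg : HolderClass β L g) {s : ℝ} (hs : s ∈ Icc (0 : ℝ) 1) : ∀ x ∈ Icc (0 : ℝ) 1,
      |g x - ∑ q ∈ Finset.range (⌊β⌋₊ + 1),
        iteratedDerivWithin q g (Icc 0 1) s * (x - s) ^ q / (q.factorial : ℝ)|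
        ≤ L * |x - s| ^ β := by
  have := abs_sub_taylor_le_of_hasDerivWithinAt ⌊β⌋₊
    (fun q => iteratedDerivWithin q g (Icc 0 1)) L (β - ⌊β⌋₊) s hL
    (sub_nonneg.2 (Nat.floor_le hβ)) hs
    (fun p hp x hx => by
      have := (hg.1 p hp x hx).hasDerivWithinAt
      rwa [← iteratedDerivWithin_succ] at this)
    (fun x hx => hg.2 x hx s hs)
  simpa using this

/-- The constants controlling the local polynomial weights `w` at `s` with bandwidth `h`, for
regression functions in the Hölder class. -/
structure WeightBounds {m : ℕ} (β L W : ℝ) (t w : Fin m → ℝ) (h s : ℝ) : Prop where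
  sum_abs : ∑ k, |w k| ≤ W
  abs_le : ∀ k, |w k| ≤ W / (m * h)
  sum_sq : ∑ k, w k ^ 2 ≤ W / (m * h)
  bias : ∀ g, HolderClass β L g → |∑ k, w k * g (t k) - g s| ≤ W * h ^ β

/-- At most 2a₀mh weights are non-zero and each is at most c/(mh), which gives the ℓ¹ and ℓ² bounds.
The bias bound combines reproduction of polynomials with the Hölder Taylor remainder. -/
theorem exists_weightBounds {β L : ℝ} (hβ : 0 < β) (hL : 0 < L) {K : ℝ → ℝ}
    (hK : KernelCondition K) {lam a₀ : ℝ} (hlam : 0 < lam) (ha₀ : 0 < a₀) :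
    ∃ W : ℝ, 1 ≤ W ∧ ∀ (m : ℕ) (t : Fin m → ℝ), (∀ k, t k ∈ Icc (0 : ℝ) 1) →
      DesignCondition t a₀ → ∀ h, 0 < h → EigenvalueCondition ⌊β⌋₊ K t lam h →
      1 ≤ 2 * ((m : ℝ) * h) ∧ h ≤ W ∧
      ∀ s ∈ Icc (0 : ℝ) 1, WeightBounds β L W t (weight ⌊β⌋₊ K t h s) h s := by
  obtain ⟨hK1, Kmax, hKmax⟩ := hK
  have hK0 : 0 ≤ Kmax := (abs_nonneg _).trans (hKmax 0)
  set ℓ := ⌊β⌋₊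
  set c : ℝ := (ℓ + 1) / lam * Kmax with hc
  have hc0 : 0 ≤ c := by positivity
  set S : ℝ := 2 * a₀ * c with hS
  have hS0 : 0 ≤ S := by positivity
  -- One constant for every field: `c` bounds single weights, `S` the ℓ¹ norm, `S * c` the squared
  -- ℓ² norm, `Kmax / lam` the bandwidth and `S * L` the bias.
  refine ⟨1 + c + S + S * c + Kmax / lam + S * L, by
    have : 0 ≤ Kmax / lam := by positivity
    have := mul_nonneg hS0 hc0
    have := mul_nonneg hS0 hL.le
    linarith, ?_⟩
  have hq : 0 ≤ Kmax / lam := by positivity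
  have hSc := mul_nonneg hS0 hc0
  have hSL := mul_nonneg hS0 hL.le
  intro m t ht hD h hh hE
  have hmh := one_le_two_mul_bandwidth hK1 hh hlam hE
  refine ⟨hmh, (bandwidth_le hKmax hh hlam hE).trans (by linarith), fun s hs => ?_⟩
  have hmh0 : 0 < (m : ℝ) * h := by linarith
  have habs := abs_weight_le hK1 hKmax hh hlam (hE s hs) (t := t)
  have hcard := card_design_near_le ht ha₀ hD hs hh hmh
  have hsum : ∑ k, |weight ℓ K t h s k| ≤ S := by
    calc ∑ k, |weight ℓ K t h s k|
        = ∑ k ∈ Finset.univ.filter (fun k => |t k - s| ≤ h), |weight ℓ K t h s k| := by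
          symm
          refine Finset.sum_filter_of_ne fun k _ hk => ?_
          by_contra hcon
          exact hk (by rw [weight_eq_zero hK1 hh (not_le.1 hcon), abs_zero])
      _ ≤ ∑ _k ∈ Finset.univ.filter (fun k => |t k - s| ≤ h), c / (m * h) :=
          Finset.sum_le_sum fun k _ => habs k
      _ = ((Finset.univ.filter fun k => |t k - s| ≤ h).card : ℝ) * (c / (m * h)) := by
          rw [Finset.sum_const, nsmul_eq_mul]
      _ ≤ (2 * a₀ * (m * h)) * (c / (m * h)) := by gcongr
      _ = S := by rw [hS, mul_div_assoc', mul_assoc _ _ c, mul_comm _ c, ← mul_assoc,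
            mul_div_cancel_right₀ _ hmh0.ne']
  refine ⟨hsum.trans (by linarith), fun k => (habs k).trans ?_, ?_, ?_⟩
  · gcongr; linarith
  · calc ∑ k, weight ℓ K t h s k ^ 2 ≤ ∑ k, |weight ℓ K t h s k| * (c / (m * h)) := by
          refine Finset.sum_le_sum fun k _ => ?_
          rw [← sq_abs, sq]
          gcongr
          exact habs k
      _ = (∑ k, |weight ℓ K t h s k|) * (c / (m * h)) := by rw [Finset.sum_mul]
      _ ≤ S * (c / (m * h)) := by gcongr
      _ = (S * c) / (m * h) := by ring
      _ ≤ _ := by gcongr; linarith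
  · intro g hg
    have hT := hg.abs_sub_taylor_le hβ.le hL.le hs
    set T : ℝ → ℝ := fun x => ∑ q ∈ Finset.range (ℓ + 1),
        iteratedDerivWithin q g (Icc 0 1) s * (x - s) ^ q / (q.factorial : ℝ) with hTdef
    -- Only the constant term of the Taylor polynomial survives the smoothing.
    have hrep : ∑ k, weight ℓ K t h s k * T (t k) = g s := by
      simp only [hTdef, Finset.mul_sum]
      rw [Finset.sum_comm, Finset.sum_range_succ', Finset.sum_eq_zero]
      · have h0 := sum_weight_mul_pow (K := K) (t := t) hlam (hE s hs) (Nat.zero_le ℓ)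
        simp only [pow_zero, mul_one, if_true] at h0
        simp [← Finset.sum_mul, h0]
      · intro q hq
        have hq' := Finset.mem_range.1 hq
        have h0 := sum_weight_mul_pow (K := K) (t := t) hlam (hE s hs)
          (p := q + 1) (by omega)
        rw [if_neg (by omega)] at h0
        have : ∀ k, weight ℓ K t h s k * (iteratedDerivWithin (q + 1) g (Icc 0 1) s
            * (t k - s) ^ (q + 1) / ((q + 1).factorial : ℝ))
            = (iteratedDerivWithin (q + 1) g (Icc 0 1) s * h ^ (q + 1)
              / ((q + 1).factorial : ℝ))
              * (weight ℓ K t h s k * ((t k - s) / h) ^ (q + 1)) := by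
          intro k
          rw [div_pow]
          field_simp
        simp only [this, ← Finset.mul_sum, h0, mul_zero]
    calc |∑ k, weight ℓ K t h s k * g (t k) - g s|
        = |∑ k, weight ℓ K t h s k * (g (t k) - T (t k))| := by
          rw [← hrep, ← Finset.sum_sub_distrib]
          congr 1
          exact Finset.sum_congr rfl fun k _ => by ring
      _ ≤ ∑ k, |weight ℓ K t h s k * (g (t k) - T (t k))| := Finset.abs_sum_le_sum_abs _ _
      _ ≤ ∑ k, |weight ℓ K t h s k| * (L * h ^ β) := by
          refine Finset.sum_le_sum fun k _ => ?_
          rw [abs_mul]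
          by_cases hk : h < |t k - s|
          · rw [weight_eq_zero hK1 hh hk]; simp
          · gcongr
            refine (hT (t k) (ht k)).trans ?_
            gcongr
            exact not_lt.1 hk
      _ = (∑ k, |weight ℓ K t h s k|) * (L * h ^ β) := by rw [Finset.sum_mul]
      _ ≤ S * (L * h ^ β) := by gcongr
      _ = S * L * h ^ β := by ring
      _ ≤ _ := by gcongr; linarith

/-! ### Exponential inequalities for bounded variables -/

theorem exp_le_one_add_add_sq {x : ℝ} (hx : |x| ≤ 1) : Real.exp x ≤ 1 + x + x ^ 2 := by
  have := (abs_le.1 (Real.abs_exp_sub_one_sub_id_le hx)).2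
  linarith

section Bernstein

variable {Ω ι κ : Type*} [MeasurableSpace Ω] {μ : Measure Ω} [IsProbabilityMeasure μ]

theorem integrable_of_abs_le {X : Ω → ℝ} (hX : Measurable X) {W : ℝ} (hW : ∀ ω, |X ω| ≤ W) :
    Integrable X μ :=
  Integrable.of_bound hX.aestronglyMeasurable W (Filter.Eventually.of_forall hW)

theorem integral_exp_le {X : Ω → ℝ} (hX : Measurable X) (hb : ∀ ω, |X ω| ≤ 1) :
    ∫ ω, Real.exp (X ω) ∂μ ≤ Real.exp (∫ ω, X ω ∂μ + ∫ ω, X ω ^ 2 ∂μ) := by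
  have hi := integrable_of_abs_le (μ := μ) hX hb
  have hi2 : Integrable (fun ω => X ω ^ 2) μ :=
    integrable_of_abs_le (hX.pow_const 2) (W := 1) fun ω => by
      rw [abs_pow]; exact pow_le_one₀ (abs_nonneg _) (hb ω)
  have hie : Integrable (fun ω => Real.exp (X ω)) μ :=
    integrable_of_abs_le hX.exp (W := Real.exp 1) fun ω => by
      rw [abs_of_pos (Real.exp_pos _)]
      exact Real.exp_le_exp.2 ((le_abs_self _).trans (hb ω))
  calc ∫ ω, Real.exp (X ω) ∂μ ≤ ∫ ω, (1 + X ω + X ω ^ 2) ∂μ :=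
        integral_mono hie (((integrable_const 1).add hi).add hi2)
          fun ω => exp_le_one_add_add_sq (hb ω)
    _ = (∫ ω, X ω ∂μ + ∫ ω, X ω ^ 2 ∂μ) + 1 := by
        have h1 : Integrable (fun ω => 1 + X ω) μ := (integrable_const 1).add hi
        rw [integral_add h1 hi2, integral_add (integrable_const 1) hi]
        simp; ring
    _ ≤ _ := Real.add_one_le_exp _

/-- Chernoff's bound at exponent 1. Factorisation of the exponential moment is assumed instead of
independence, so that sums of products over disjoint pairs are covered; `V` contains the means, so
the variables need not be centred. -/
theorem measureReal_sum_ge_le_of_integral_exp {X : ι → Ω → ℝ} {s : Finset ι}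
    (hX : ∀ i ∈ s, Measurable (X i)) (hb : ∀ i ∈ s, ∀ ω, |X i ω| ≤ 1)
    (hprod : ∫ ω, Real.exp (∑ i ∈ s, X i ω) ∂μ = ∏ i ∈ s, ∫ ω, Real.exp (X i ω) ∂μ)
    {V : ℝ} (hV : ∑ i ∈ s, (∫ ω, X i ω ∂μ + ∫ ω, X i ω ^ 2 ∂μ) ≤ V) (T : ℝ) :
    μ.real {ω | V + T ≤ ∑ i ∈ s, X i ω} ≤ Real.exp (-T) := by
  have hm : Measurable fun ω => ∑ i ∈ s, X i ω := Finset.measurable_fun_sum s hX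
  have hint : Integrable (fun ω => Real.exp (1 * ∑ i ∈ s, X i ω)) μ :=
    integrable_of_abs_le (hm.const_mul 1).exp (W := Real.exp s.card) fun ω => by
      rw [abs_of_pos (Real.exp_pos _), one_mul]
      refine Real.exp_le_exp.2 ?_
      calc ∑ i ∈ s, X i ω ≤ ∑ _i ∈ s, (1 : ℝ) :=
            Finset.sum_le_sum fun i hi => (le_abs_self _).trans (hb i hi ω)
        _ = s.card := by simp
  have h1 := measure_ge_le_exp_mul_mgf (V + T) zero_le_one hint
  refine h1.trans ?_
  have h2 : mgf (fun ω => ∑ i ∈ s, X i ω) μ 1 ≤ Real.exp V := by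
    simp only [mgf, one_mul]
    rw [hprod]
    calc ∏ i ∈ s, ∫ ω, Real.exp (X i ω) ∂μ
        ≤ ∏ i ∈ s, Real.exp (∫ ω, X i ω ∂μ + ∫ ω, X i ω ^ 2 ∂μ) :=
          Finset.prod_le_prod (fun i _ => integral_nonneg fun ω => (Real.exp_pos _).le)
            fun i hi => integral_exp_le (hX i hi) (hb i hi)
      _ = Real.exp (∑ i ∈ s, (∫ ω, X i ω ∂μ + ∫ ω, X i ω ^ 2 ∂μ)) := (Real.exp_sum _ _).symm
      _ ≤ Real.exp V := Real.exp_le_exp.2 hV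
  calc Real.exp (-1 * (V + T)) * mgf (fun ω => ∑ i ∈ s, X i ω) μ 1
      ≤ Real.exp (-1 * (V + T)) * Real.exp V := by gcongr
    _ = Real.exp (-T) := by rw [← Real.exp_add]; congr 1; ring

theorem integral_exp_sum_of_iIndepFun {μ : Measure Ω} {X : ι → Ω → ℝ} (hI : iIndepFun X μ)
    (hX : ∀ i, Measurable (X i)) (s : Finset ι) :
    ∫ ω, Real.exp (∑ i ∈ s, X i ω) ∂μ = ∏ i ∈ s, ∫ ω, Real.exp (X i ω) ∂μ := by
  have := hI.mgf_sum hX s (t := 1)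
  simpa [mgf] using this

/-- Functions of disjoint blocks of an independent family have independent exponentials. -/
theorem integral_exp_sum_blocks [DecidableEq κ] {Y : κ → Ω → ℝ} (hI : iIndepFun Y μ)
    (hY : ∀ i, Measurable (Y i)) (S : ι → Finset κ) (φ : ∀ j, (S j → ℝ) → ℝ)
    (hφ : ∀ j, Measurable (φ j)) (s : Finset ι)
    (hS : (s : Set ι).PairwiseDisjoint S) :
    ∫ ω, Real.exp (∑ j ∈ s, φ j fun e => Y e ω) ∂μ
      = ∏ j ∈ s, ∫ ω, Real.exp (φ j fun e => Y e ω) ∂μ := by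
  classical
  induction s using Finset.induction_on with
  | empty => simp
  | insert j s hj ih =>
    rw [Finset.prod_insert hj, ← ih (hS.subset (by simp))]
    have hdis : Disjoint (S j) (s.biUnion S) := by
      rw [Finset.disjoint_biUnion_right]
      intro i hi
      exact hS (by simp) (by simp [hi]) (by rintro rfl; exact hj hi)
    have hind := hI.indepFun_finset _ _ hdis hY
    let g : (s.biUnion S → ℝ) → ℝ := fun v => Real.exp (∑ i ∈ s.attach,
      φ i fun e => v ⟨e, Finset.mem_biUnion.2 ⟨i, i.2, e.2⟩⟩)
    have hg : Measurable g := by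
      refine Measurable.exp (Finset.measurable_fun_sum _ fun i _ => (hφ i).comp ?_)
      exact measurable_pi_lambda _ fun e => measurable_pi_apply _
    have h2 := hind.comp (φ := fun v => Real.exp (φ j v)) (hφ j).exp hg
    have h3 := h2.integral_mul_eq_mul_integral
      (((hφ j).exp.comp (measurable_pi_lambda _ fun e => hY e)).aestronglyMeasurable)
      ((hg.comp (measurable_pi_lambda _ fun e => hY e)).aestronglyMeasurable)
    have hgs : ∀ ω, g (fun e => Y e ω) = Real.exp (∑ i ∈ s, φ i fun e => Y e ω) := by
      intro ω
      simp only [g]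
      rw [Finset.sum_attach s (fun i => φ i fun e => Y e ω)]
    simp only [Function.comp_def, hgs, Pi.mul_apply] at h3
    rw [← h3]
    refine integral_congr_ae (Filter.Eventually.of_forall fun ω => ?_)
    simp only [Finset.sum_insert hj, Real.exp_add]

/-- Two-sided tail bound for a sum of centred variables rescaled by `θ`. -/
theorem measureReal_abs_sum_ge_le {X : ι → Ω → ℝ} {s : Finset ι}
    (hX : ∀ i ∈ s, Measurable (X i)) {θ : ℝ} (hθ : 0 < θ)
    (hb : ∀ i ∈ s, ∀ ω, θ * |X i ω| ≤ 1) (h0 : ∀ i ∈ s, ∫ ω, X i ω ∂μ = 0)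
    (hprod : ∀ τ : ℝ, ∫ ω, Real.exp (∑ i ∈ s, τ * X i ω) ∂μ
      = ∏ i ∈ s, ∫ ω, Real.exp (τ * X i ω) ∂μ)
    {v : ℝ} (hv : ∑ i ∈ s, ∫ ω, X i ω ^ 2 ∂μ ≤ v) (T : ℝ) :
    μ.real {ω | θ * v + T / θ ≤ |∑ i ∈ s, X i ω|} ≤ 2 * Real.exp (-T) := by
  have key : ∀ τ : ℝ, |τ| = θ → μ.real {ω | θ ^ 2 * v + T ≤ ∑ i ∈ s, τ * X i ω}
      ≤ Real.exp (-T) := by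
    intro τ hτ
    refine measureReal_sum_ge_le_of_integral_exp (fun i hi => (hX i hi).const_mul τ)
      (fun i hi ω => by rw [abs_mul, hτ]; exact hb i hi ω) (hprod τ) ?_ T
    calc ∑ i ∈ s, (∫ ω, τ * X i ω ∂μ + ∫ ω, (τ * X i ω) ^ 2 ∂μ)
        = θ ^ 2 * ∑ i ∈ s, ∫ ω, X i ω ^ 2 ∂μ := by
          rw [Finset.mul_sum]
          refine Finset.sum_congr rfl fun i hi => ?_
          simp only [mul_pow, integral_const_mul, h0 i hi, ← hτ, sq_abs]
          ring
      _ ≤ θ ^ 2 * v := by gcongr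
  have hsub : {ω | θ * v + T / θ ≤ |∑ i ∈ s, X i ω|}
      ⊆ {ω | θ ^ 2 * v + T ≤ ∑ i ∈ s, θ * X i ω} ∪ {ω | θ ^ 2 * v + T ≤ ∑ i ∈ s, (-θ) * X i ω} := by
    intro ω hω
    simp only [mem_ofPred_eq, mem_union, ← Finset.mul_sum] at hω ⊢
    have h1 : θ ^ 2 * v + T = θ * (θ * v + T / θ) := by field_simp
    rw [h1]
    rcases le_abs.1 hω with h | h
    · left; gcongr
    · right
      rw [neg_mul, ← mul_neg]; gcongr
  calc _ ≤ _ := measureReal_mono hsub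
    _ ≤ _ := measureReal_union_le _ _
    _ ≤ Real.exp (-T) + Real.exp (-T) :=
        add_le_add (key θ (abs_of_pos hθ)) (key (-θ) (by rw [abs_neg, abs_of_pos hθ]))
    _ = _ := by ring

/-- An independent family of centred variables bounded by `W` with variances at most `v`. -/
structure CentredFamily (μ : Measure Ω) (Y : κ → Ω → ℝ) (W v : ℝ) : Prop where
  indep : iIndepFun Y μ
  measurable : ∀ i, Measurable (Y i)
  abs_le : ∀ i ω, |Y i ω| ≤ W
  integral_eq_zero : ∀ i, ∫ ω, Y i ω ∂μ = 0
  integral_sq_le : ∀ i, ∫ ω, Y i ω ^ 2 ∂μ ≤ v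

namespace CentredFamily

variable {Y : κ → Ω → ℝ} {W v : ℝ}

/-- Y²/W² lies in [0,1], so its second moment is at most its mean; together they are at most 2v/W².
-/
theorem measureReal_sum_sq_ge_le (hF : CentredFamily μ Y W v) (hW0 : 0 < W) (s : Finset κ) (T : ℝ) :
    μ.real {ω | 2 * s.card * v + W ^ 2 * T ≤ ∑ i ∈ s, Y i ω ^ 2} ≤ Real.exp (-T) := by
  obtain ⟨hI, hY, hW, -, hv⟩ := hF
  have hW2 : 0 < W ^ 2 := by positivity
  have hb : ∀ i ω, Y i ω ^ 2 / W ^ 2 ≤ 1 := fun i ω => by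
    rw [div_le_one hW2, ← sq_abs]
    exact pow_le_pow_left₀ (abs_nonneg _) (hW i ω) 2
  have hm : ∀ i, Measurable fun ω => Y i ω ^ 2 / W ^ 2 := fun i => ((hY i).pow_const 2).div_const _
  have hb' : ∀ i ω, |Y i ω ^ 2 / W ^ 2| ≤ 1 := fun i ω => by
    rw [abs_of_nonneg (by positivity)]; exact hb i ω
  have hIn : iIndepFun (fun i ω => Y i ω ^ 2 / W ^ 2) μ :=
    hI.comp (fun _ y => y ^ 2 / W ^ 2) fun _ => by fun_prop
  have := measureReal_sum_ge_le_of_integral_exp (X := fun i ω => Y i ω ^ 2 / W ^ 2) (s := s)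
    (fun i _ => hm i) (fun i _ => hb' i) (integral_exp_sum_of_iIndepFun hIn hm s)
    (V := 2 * s.card * v / W ^ 2) (by
      calc _ ≤ ∑ _i ∈ s, 2 * v / W ^ 2 := by
            refine Finset.sum_le_sum fun i _ => ?_
            have h1 : ∫ ω, (Y i ω ^ 2 / W ^ 2) ^ 2 ∂μ ≤ ∫ ω, Y i ω ^ 2 / W ^ 2 ∂μ := by
              refine integral_mono (integrable_of_abs_le ((hm i).pow_const 2) (W := 1) ?_)
                (integrable_of_abs_le (hm i) (hb' i)) fun ω => ?_
              · intro ω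
                rw [abs_pow]; exact pow_le_one₀ (abs_nonneg _) (hb' i ω)
              · have h2 : 0 ≤ Y i ω ^ 2 / W ^ 2 := by positivity
                nlinarith [hb i ω]
            have h2 : ∫ ω, Y i ω ^ 2 / W ^ 2 ∂μ ≤ v / W ^ 2 := by
              rw [integral_div]
              gcongr
              exact hv i
            calc _ ≤ v / W ^ 2 + v / W ^ 2 := add_le_add h2 (h1.trans h2)
              _ = _ := by ring
        _ = _ := by rw [Finset.sum_const, nsmul_eq_mul]; ring) T
  convert this using 4 with ω
  rw [← Finset.sum_div, le_div_iff₀ hW2, add_mul, div_mul_cancel₀ _ hW2.ne', mul_comm T]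

theorem measureReal_abs_sum_mul_ge_le (hF : CentredFamily μ Y W v) (s : Finset κ) {c : κ → ℝ} {b θ : ℝ} (hθ : 0 < θ)
    (hc : ∀ i, |c i| ≤ b) (hθb : θ * (b * W) ≤ 1) (T : ℝ) :
    μ.real {ω | θ * (s.card * (b ^ 2 * v)) + T / θ ≤ |∑ i ∈ s, c i * Y i ω|}
      ≤ 2 * Real.exp (-T) := by
  obtain ⟨hI, hY, hW, h0, hv⟩ := hF
  refine measureReal_abs_sum_ge_le (X := fun i ω => c i * Y i ω) (fun i _ => (hY i).const_mul _)
    hθ (fun i _ ω => ?_) (fun i _ => ?_) (fun τ => ?_) ?_ T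
  · refine le_trans ?_ hθb
    rw [abs_mul]
    have hb0 : 0 ≤ b := (abs_nonneg _).trans (hc i)
    gcongr
    · exact hc i
    · exact hW i ω
  · rw [integral_const_mul, h0, mul_zero]
  · have hIn : iIndepFun (fun i ω => τ * (c i * Y i ω)) μ :=
      hI.comp (fun i y => τ * (c i * y)) fun _ => by fun_prop
    exact integral_exp_sum_of_iIndepFun hIn (fun i => ((hY i).const_mul _).const_mul _) s
  · calc _ ≤ ∑ _i ∈ s, b ^ 2 * v := by
          refine Finset.sum_le_sum fun i _ => ?_
          simp only [mul_pow, integral_const_mul]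
          have h1 : 0 ≤ ∫ ω, Y i ω ^ 2 ∂μ := integral_nonneg fun ω => sq_nonneg _
          have h2 : c i ^ 2 ≤ b ^ 2 := by
            rw [← sq_abs]; exact pow_le_pow_left₀ (abs_nonneg _) (hc i) 2
          exact mul_le_mul h2 (hv i) h1 (sq_nonneg _)
      _ = _ := by rw [Finset.sum_const, nsmul_eq_mul]

/-- Each product is centred with variance at most v² by independence of its two factors, and
disjointness of the pairs makes the exponentials factor. -/
theorem measureReal_abs_sum_mul_mul_ge_le [DecidableEq κ] (hF : CentredFamily μ Y W v)
    (s : Finset ι) (a b : ι → κ)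
    (hab : ∀ j ∈ s, a j ≠ b j)
    (hdis : ∀ j ∈ s, ∀ j' ∈ s, j ≠ j' → a j ≠ a j' ∧ a j ≠ b j' ∧ b j ≠ a j' ∧ b j ≠ b j')
    {θ : ℝ} (hθ : 0 < θ) (hW0 : 0 ≤ W) (hθW : θ * W ^ 2 ≤ 1) (T : ℝ) :
    μ.real {ω | θ * (s.card * v ^ 2) + T / θ ≤ |∑ j ∈ s, Y (a j) ω * Y (b j) ω|}
      ≤ 2 * Real.exp (-T) := by
  obtain ⟨hI, hY, hW, h0, hv⟩ := hF
  refine measureReal_abs_sum_ge_le (X := fun j ω => Y (a j) ω * Y (b j) ω)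
    (fun j _ => (hY _).mul (hY _)) hθ (fun j _ ω => ?_) (fun j hj => ?_) (fun τ => ?_) ?_ T
  · refine le_trans ?_ hθW
    rw [abs_mul, sq]
    gcongr
    · exact hW _ ω
    · exact hW _ ω
  · have := (hI.indepFun (hab j hj)).integral_mul_eq_mul_integral
      (hY _).aestronglyMeasurable (hY _).aestronglyMeasurable
    simp only [Pi.mul_apply] at this
    rw [this, h0, zero_mul]
  · have h := integral_exp_sum_blocks hI hY (fun j => {a j, b j})
      (fun j u => τ * (u ⟨a j, by simp⟩ * u ⟨b j, by simp⟩)) (fun j => by fun_prop) s ?_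
    · exact h
    · intro j hj j' hj' hne
      obtain ⟨h1, h2, h3, h4⟩ := hdis j hj j' hj' hne
      simp [Function.onFun, h3.symm, h4.symm, h1.symm, h2.symm]
  · calc _ ≤ ∑ _j ∈ s, v ^ 2 := by
          refine Finset.sum_le_sum fun j hj => ?_
          have hin := (hI.indepFun (hab j hj)).comp (φ := fun x : ℝ => x ^ 2)
            (ψ := fun x : ℝ => x ^ 2) (by fun_prop) (by fun_prop)
          have := hin.integral_mul_eq_mul_integral
            ((hY _).pow_const 2).aestronglyMeasurable ((hY _).pow_const 2).aestronglyMeasurable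
          simp only [Pi.mul_apply, Function.comp_apply] at this
          simp only [mul_pow]
          rw [this, sq]
          have h1 : ∀ i, 0 ≤ ∫ ω, Y i ω ^ 2 ∂μ := fun i => integral_nonneg fun ω => sq_nonneg _
          exact mul_le_mul (hv _) (hv _) (h1 _) ((h1 (a j)).trans (hv _))
      _ = _ := by rw [Finset.sum_const, nsmul_eq_mul]

end CentredFamily

end Bernstein

/-! ### Independent Bernoulli edge arrays -/

/-- The Bernoulli law with parameter `p` on `Bool`. -/
noncomputable def coinLaw (p : I) : Measure Bool :=
  ENNReal.ofReal p • Measure.dirac true + ENNReal.ofReal (1 - p) • Measure.dirac false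

instance (p : I) : IsProbabilityMeasure (coinLaw p) where
  measure_univ := by
    simp only [coinLaw, Measure.coe_add, Measure.coe_smul, Pi.add_apply, Pi.smul_apply,
      measure_univ, smul_eq_mul, mul_one]
    rw [← ENNReal.ofReal_add p.2.1 (by linarith [p.2.2])]
    simp

theorem integral_coinLaw (p : I) (g : Bool → ℝ) :
    ∫ b, g b ∂coinLaw p = p * g true + (1 - p) * g false := by
  have h (b : Bool) (r : ℝ) : Integrable g (ENNReal.ofReal r • Measure.dirac b) :=
    Integrable.smul_measure Integrable.of_finite ENNReal.ofReal_ne_top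
  rw [coinLaw, integral_add_measure (h _ _) (h _ _),
    integral_smul_measure, integral_smul_measure, integral_dirac, integral_dirac,
    ENNReal.toReal_ofReal p.2.1, ENNReal.toReal_ofReal (by linarith [p.2.2])]
  simp

theorem coinLaw_real_singleton (p : I) (b : Bool) :
    (coinLaw p).real {b} = if b then (p : ℝ) else 1 - p := by
  rw [← integral_indicator_one (measurableSet_singleton b), integral_coinLaw]
  cases b <;> simp

/-- Unordered pairs of nodes, loops included. -/
abbrev Pairs (n : ℕ) : Type := {p : Fin n × Fin n // p.1 ≤ p.2}

/-- The unordered pair `{i, j}`. -/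
def pair {n : ℕ} (i j : Fin n) : Pairs n := ⟨(min i j, max i j), min_le_max⟩

theorem pair_eq_pair_iff {n : ℕ} {i j k l : Fin n} :
    pair i j = pair k l ↔ (i = k ∧ j = l) ∨ (i = l ∧ j = k) := by
  simp only [pair, Subtype.mk.injEq, Prod.mk.injEq]
  rcases le_total i j with h | h <;> rcases le_total k l with h' | h' <;> simp only [h, h',
    min_eq_left, min_eq_right, max_eq_left, max_eq_right] <;> constructor <;> intro H <;>
    grind

theorem pair_injective {n : ℕ} (i : Fin n) : Function.Injective (pair i) := by
  intro j k h
  rw [pair_eq_pair_iff] at h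
  grind

/-- The law of a time-indexed array of independent edges. -/
noncomputable def edgeLaw {n m : ℕ} (p : Pairs n → Fin m → I) : Measure (Pairs n → Fin m → Bool) :=
  Measure.pi fun e => Measure.pi fun k => coinLaw (p e k)

instance {n m : ℕ} (p : Pairs n → Fin m → I) : IsProbabilityMeasure (edgeLaw p) := by
  unfold edgeLaw; infer_instance

/-- The real number `1` or `0` coded by a Boolean. -/
def bit (b : Bool) : ℝ := if b then 1 else 0

/-- The centred weighted sum of the observations of one edge. -/
def centredSum {m : ℕ} (w : Fin m → ℝ) (p : Fin m → I) (a : Fin m → Bool) : ℝ :=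
  ∑ k, w k * (bit (a k) - p k)

theorem abs_bit_sub_le (b : Bool) (p : I) : |bit b - p| ≤ 1 := by
  rw [abs_le]
  cases b <;> simp only [bit] <;> constructor <;> norm_num <;> linarith [p.2.1, p.2.2]

theorem abs_centredSum_le {m : ℕ} (w : Fin m → ℝ) (p : Fin m → I) (a : Fin m → Bool) :
    |centredSum w p a| ≤ ∑ k, |w k| := by
  refine (Finset.abs_sum_le_sum_abs _ _).trans (Finset.sum_le_sum fun k _ => ?_)
  rw [abs_mul]
  exact mul_le_of_le_one_right (abs_nonneg _) (abs_bit_sub_le _ _)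

section OneEdge

variable {m : ℕ} (w : Fin m → ℝ) (p : Fin m → I)

theorem integral_pi_coin (k : Fin m) (g : Bool → ℝ) :
    ∫ a, g (a k) ∂(Measure.pi fun k => coinLaw (p k)) = p k * g true + (1 - p k) * g false := by
  rw [integral_comp_eval (μ := fun k => coinLaw (p k)) (i := k) (f := g)
    (Measurable.of_discrete).aestronglyMeasurable, integral_coinLaw]

theorem integral_coin_centred (k : Fin m) :
    ∫ a, w k * (bit (a k) - p k) ∂(Measure.pi fun k => coinLaw (p k)) = 0 := by
  rw [integral_pi_coin p k fun b => w k * (bit b - p k)]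
  simp [bit]; ring

theorem integral_coin_centred_sq (k : Fin m) :
    ∫ a, (w k * (bit (a k) - p k)) ^ 2 ∂(Measure.pi fun k => coinLaw (p k))
      = w k ^ 2 * (p k * (1 - p k)) := by
  rw [integral_pi_coin p k fun b => (w k * (bit b - p k)) ^ 2]
  simp [bit]; ring

theorem iIndepFun_coin (g : Fin m → Bool → ℝ) :
    iIndepFun (fun k (a : Fin m → Bool) => g k (a k)) (Measure.pi fun k => coinLaw (p k)) :=
  iIndepFun_pi fun _ => (Measurable.of_discrete).aemeasurable

theorem integral_centredSum :
    ∫ a, centredSum w p a ∂(Measure.pi fun k => coinLaw (p k)) = 0 := by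
  simp only [centredSum]
  rw [integral_finsetSum _ fun k _ => Integrable.of_finite]
  exact Finset.sum_eq_zero fun k _ => integral_coin_centred w p k

theorem integral_centredSum_sq :
    ∫ a, centredSum w p a ^ 2 ∂(Measure.pi fun k => coinLaw (p k))
      = ∑ k, w k ^ 2 * (p k * (1 - p k)) := by
  set ν := Measure.pi fun k => coinLaw (p k)
  set X : Fin m → (Fin m → Bool) → ℝ := fun k a => w k * (bit (a k) - p k) with hX
  have hI : iIndepFun X ν := iIndepFun_coin p fun k b => w k * (bit b - p k)
  have h1 := IndepFun.variance_sum (μ := ν) (X := X) (s := Finset.univ)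
    (fun k _ => MemLp.of_discrete)
    (fun i _ j _ hij => hI.indepFun hij)
  have h2 : (∑ k, X k) = fun a => centredSum w p a := by
    ext a; simp [hX, centredSum]
  rw [h2, variance_of_integral_eq_zero (Measurable.of_discrete).aemeasurable
    (integral_centredSum w p)] at h1
  rw [h1]
  refine Finset.sum_congr rfl fun k _ => ?_
  rw [variance_of_integral_eq_zero (Measurable.of_discrete).aemeasurable
    (integral_coin_centred w p k)]
  exact integral_coin_centred_sq w p k

theorem sum_sq_mul_var_le {ρ : ℝ} (hp : ∀ k, (p k : ℝ) ≤ ρ) :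
    ∑ k, w k ^ 2 * ((p k : ℝ) * (1 - p k)) ≤ ρ * ∑ k, w k ^ 2 := by
  rw [Finset.mul_sum]
  refine Finset.sum_le_sum fun k _ => ?_
  rw [mul_comm ρ]
  gcongr
  nlinarith [(p k).2.1, (p k).2.2, hp k]

theorem measureReal_abs_centredSum_ge_le {ρ : ℝ} (hp : ∀ k, (p k : ℝ) ≤ ρ) {θ : ℝ} (hθ : 0 < θ)
    (hw : ∀ k, θ * |w k| ≤ 1) (T : ℝ) :
    (Measure.pi fun k => coinLaw (p k)).real
      {a | θ * (ρ * ∑ k, w k ^ 2) + T / θ ≤ |centredSum w p a|} ≤ 2 * Real.exp (-T) := by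
  refine measureReal_abs_sum_ge_le (s := Finset.univ)
    (X := fun k (a : Fin m → Bool) => w k * (bit (a k) - p k)) (fun k _ => Measurable.of_discrete)
    hθ (fun k _ a => ?_) (fun k _ => integral_coin_centred w p k) (fun τ => ?_) ?_ T
  · rw [abs_mul, ← mul_assoc]
    exact mul_le_one₀ (hw k) (abs_nonneg _) (abs_bit_sub_le _ _)
  · exact integral_exp_sum_of_iIndepFun
      (iIndepFun_coin p fun k b => τ * (w k * (bit b - p k))) (fun _ => Measurable.of_discrete) _
  · rw [Finset.sum_congr rfl fun k _ => integral_coin_centred_sq w p k]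
    exact sum_sq_mul_var_le w p hp

end OneEdge

section Edges

variable {n m : ℕ} (w : Fin m → ℝ) (p : Pairs n → Fin m → I)

/-- The centred weighted sum of the observations of the edge `e`. -/
def edgeNoise (e : Pairs n) (a : Pairs n → Fin m → Bool) : ℝ := centredSum w (p e) (a e)

theorem centredFamily_edgeNoise {ρ W v : ℝ} (hp : ∀ e k, (p e k : ℝ) ≤ ρ)
    (hW : ∑ k, |w k| ≤ W) (hv : ρ * ∑ k, w k ^ 2 ≤ v) :
    CentredFamily (edgeLaw p) (edgeNoise w p) W v where
  indep := iIndepFun_pi (X := fun e a => centredSum w (p e) a)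
    fun _ => (Measurable.of_discrete).aemeasurable
  measurable _ := Measurable.of_discrete
  abs_le e a := (abs_centredSum_le _ _ _).trans hW
  integral_eq_zero e := by
    have := integral_comp_eval (μ := fun e => Measure.pi fun k => coinLaw (p e k)) (i := e)
      (f := centredSum w (p e)) (Measurable.of_discrete).aestronglyMeasurable
    exact this.trans (integral_centredSum w (p e))
  integral_sq_le e := by
    have := integral_comp_eval (μ := fun e => Measure.pi fun k => coinLaw (p e k)) (i := e)
      (f := fun a => centredSum w (p e) a ^ 2) (Measurable.of_discrete).aestronglyMeasurable
    exact (this.trans (integral_centredSum_sq w (p e))).le.trans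
      ((sum_sq_mul_var_le w (p e) (hp e)).trans hv)

theorem measureReal_abs_edgeNoise_ge_le {ρ : ℝ} (hp : ∀ e k, (p e k : ℝ) ≤ ρ) {θ : ℝ}
    (hθ : 0 < θ) (hw : ∀ k, θ * |w k| ≤ 1) (T : ℝ) (e : Pairs n) :
    (edgeLaw p).real {a | θ * (ρ * ∑ k, w k ^ 2) + T / θ ≤ |edgeNoise w p e a|}
      ≤ 2 * Real.exp (-T) := by
  have h := (measurePreserving_eval
    (fun e => Measure.pi fun k => coinLaw (p e k)) e).measureReal_preimage
    (s := {a | θ * (ρ * ∑ k, w k ^ 2) + T / θ ≤ |centredSum w (p e) a|})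
    (MeasurableSet.of_discrete).nullMeasurableSet
  exact h.le.trans (measureReal_abs_centredSum_ge_le w (p e) (hp e) hθ hw T)

/-- The explicit product weights are those appearing in `IsGraphonSample.cond_law`. -/
theorem edgeLaw_real_eq_sum [DecidableEq (Pairs n → Fin m → Bool)]
    (S : Set (Pairs n → Fin m → Bool)) :
    (edgeLaw p).real S = ∑ a, S.indicator (fun _ => (1 : ℝ)) a *
      ∏ e, ∏ k, if a e k then (p e k : ℝ) else 1 - p e k := by
  have h1 : (edgeLaw p).real S = ∫ a, S.indicator (fun _ => (1 : ℝ)) a ∂edgeLaw p :=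
    (integral_indicator_one MeasurableSet.of_discrete).symm
  rw [h1, integral_fintype Integrable.of_finite]
  refine Finset.sum_congr rfl fun a _ => ?_
  rw [smul_eq_mul, mul_comm]
  congr 1
  simp only [Measure.real, edgeLaw, Measure.pi_singleton, ENNReal.toReal_prod]
  exact Finset.prod_congr rfl fun e _ => Finset.prod_congr rfl fun k _ =>
    coinLaw_real_singleton _ _

end Edges

/-! ### From the conditional law to independent edges -/

/-- The probability of the edge `e` at time `t k`, as an element of the unit interval. -/
noncomputable def edgeProb {n m : ℕ} (f : ℝ → ℝ → ℝ → ℝ) (ρ : ℝ) (t : Fin m → ℝ) (x : Fin n → I)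
    (e : Pairs n) (k : Fin m) : I :=
  projIcc 0 1 zero_le_one (probMatrix f ρ x (t k) e.1.1 e.1.2)

open scoped Classical in
/-- The edge array of a sample of adjacency matrices. -/
noncomputable def edgeArray {n m : ℕ} (A : Fin m → Matrix (Fin n) (Fin n) ℝ) (e : Pairs n)
    (k : Fin m) : Bool := decide (A k e.1.1 e.1.2 = 1)

section Model

variable {n m : ℕ} {f : ℝ → ℝ → ℝ → ℝ} {ρ : ℝ} {t : Fin m → ℝ}

theorem probMatrix_mem (hf : IsGraphon f) (hρ : 0 ≤ ρ) (x : Fin n → I) {s : ℝ}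
    (hs : s ∈ Icc (0 : ℝ) 1) (i j : Fin n) :
    0 ≤ probMatrix f ρ x s i j ∧ probMatrix f ρ x s i j ≤ ρ := by
  obtain ⟨h1, h2⟩ := hf.mem_unit _ (x i).2 _ (x j).2 s hs
  exact ⟨mul_nonneg hρ h1, mul_le_of_le_one_right hρ h2⟩

theorem probMatrix_symm (hf : IsGraphon f) (x : Fin n → I) {s : ℝ}
    (hs : s ∈ Icc (0 : ℝ) 1) (i j : Fin n) :
    probMatrix f ρ x s i j = probMatrix f ρ x s j i := by
  simp only [probMatrix, Matrix.of_apply]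
  rw [hf.symm _ (x i).2 _ (x j).2 s hs]

theorem edgeProb_coe (hf : IsGraphon f) (hρ : 0 ≤ ρ) (hρ1 : ρ ≤ 1)
    (ht : ∀ k, t k ∈ Icc (0 : ℝ) 1) (x : Fin n → I) (e : Pairs n) (k : Fin m) :
    (edgeProb f ρ t x e k : ℝ) = probMatrix f ρ x (t k) e.1.1 e.1.2 := by
  obtain ⟨h1, h2⟩ := probMatrix_mem hf hρ x (ht k) e.1.1 e.1.2
  rw [edgeProb, coe_projIcc, min_eq_right (h2.trans hρ1), max_eq_right h1]

theorem edgeProb_pair (hf : IsGraphon f) (hρ : 0 ≤ ρ) (hρ1 : ρ ≤ 1)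
    (ht : ∀ k, t k ∈ Icc (0 : ℝ) 1) (x : Fin n → I) (i j : Fin n) (k : Fin m) :
    (edgeProb f ρ t x (pair i j) k : ℝ) = probMatrix f ρ x (t k) i j := by
  rw [edgeProb_coe hf hρ hρ1 ht]
  rcases le_total i j with h | h
  · simp [pair, h]
  · simp only [pair, min_eq_right h, max_eq_left h]
    exact probMatrix_symm hf x (ht k) j i

theorem measurable_probMatrix (hf : IsGraphon f) {s : ℝ} (hs : s ∈ Icc (0 : ℝ) 1) (i j : Fin n) :
    Measurable fun x : Fin n → I => probMatrix f ρ x s i j := by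
  have h : Measurable fun x : Fin n → I => (x i, x j, (⟨s, hs⟩ : I)) := by fun_prop
  exact (hf.measurable.comp h).const_mul ρ

theorem measurable_edgeProb (hf : IsGraphon f) (ht : ∀ k, t k ∈ Icc (0 : ℝ) 1) (e : Pairs n)
    (k : Fin m) : Measurable fun x : Fin n → I => (edgeProb f ρ t x e k : ℝ) := by
  simp only [edgeProb, coe_projIcc]
  exact measurable_const.max (measurable_const.min (measurable_probMatrix hf (ht k) _ _))

theorem prod_pairs {M : Type*} [CommMonoid M] (F : Fin n → Fin n → M) :
    ∏ e : Pairs n, F e.1.1 e.1.2 = ∏ i, ∏ j ∈ Finset.Ici i, F i j := by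
  rw [← Finset.prod_subtype (Finset.univ.filter fun p : Fin n × Fin n => p.1 ≤ p.2)
    (by simp) (fun p => F p.1 p.2), Finset.prod_filter, Fintype.prod_prod_type]
  refine Finset.prod_congr rfl fun i _ => ?_
  rw [← Finset.prod_filter]
  congr 1
  ext j; simp

variable {Ω : Type*} [MeasurableSpace Ω] {μ : Measure Ω}
  {ξ : Fin n → Ω → I} {A : Fin m → Ω → Matrix (Fin n) (Fin n) ℝ}

theorem IsGraphonSample.apply_eq (hS : IsGraphonSample μ f ρ t ξ A) (ω : Ω) (k : Fin m)
    (i j : Fin n) : A k ω i j = bit (edgeArray (fun k => A k ω) (pair i j) k) := by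
  have h1 : A k ω (min i j) (max i j) = A k ω i j := by
    rcases le_total i j with h | h
    · simp [h]
    · simp [h, hS.symm k ω j i]
  simp only [bit, edgeArray, pair, h1, decide_eq_true_eq]
  rcases hS.zero_one k ω i j with h | h <;> simp [h]

variable [IsProbabilityMeasure μ]

/-- This is the defining property of the conditional expectation given the latent positions,
integrated over the event that they lie in `S`. -/
theorem IsGraphonSample.measureReal_inter (hf : IsGraphon f) (hρ : 0 ≤ ρ) (hρ1 : ρ ≤ 1)
    (ht : ∀ k, t k ∈ Icc (0 : ℝ) 1) (hS : IsGraphonSample μ f ρ t ξ A)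
    (S : Set (Fin n → I)) (hSm : MeasurableSet S) (a : Pairs n → Fin m → Bool) :
    μ.real ({ω | (fun i => ξ i ω) ∈ S} ∩ {ω | edgeArray (fun k => A k ω) = a})
      = ∫ ω, {ω | (fun i => ξ i ω) ∈ S}.indicator (fun _ => (1 : ℝ)) ω *
        ∏ e, ∏ k, (if a e k then (edgeProb f ρ t (fun i => ξ i ω) e k : ℝ)
          else 1 - edgeProb f ρ t (fun i => ξ i ω) e k) ∂μ := by
  have hξ : Measurable fun ω i => ξ i ω := measurable_pi_lambda _ hS.measurable_latent
  set S' := {ω | (fun i => ξ i ω) ∈ S} with hS'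
  have hS'm : MeasurableSet S' := hξ hSm
  -- Only entries with i ≤ j are ever read; the default `false` is arbitrary.
  set b : Fin m → Fin n → Fin n → Bool := fun k i j => if h : i ≤ j then a ⟨(i, j), h⟩ k else false
  have hev : {ω | edgeArray (fun k => A k ω) = a}
      = {ω | ∀ k i j, i ≤ j → A k ω i j = if b k i j then 1 else 0} := by
    ext ω
    simp only [mem_ofPred_eq]
    constructor
    · rintro rfl k i j hij
      rw [hS.apply_eq ω k i j]
      simp [b, hij, bit, pair]
    · intro h
      ext e k
      have := h k e.1.1 e.1.2 e.2
      simp only [b, e.2, dif_pos] at this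
      simp only [edgeArray, this]
      cases a e k <;> simp
  have hEm : MeasurableSet {ω | ∀ k i j, i ≤ j → A k ω i j = if b k i j then 1 else 0} := by
    simp only [ofPred_forall]
    refine MeasurableSet.iInter fun k => MeasurableSet.iInter fun i => MeasurableSet.iInter fun j =>
      MeasurableSet.iInter fun _ => ?_
    exact measurableSet_eq_fun (hS.measurable_adj k i j) measurable_const
  rw [hev]
  set E := {ω | ∀ k i j, i ≤ j → A k ω i j = if b k i j then 1 else 0}
  have hle : MeasurableSpace.comap (fun ω i => ξ i ω) inferInstance ≤ ‹MeasurableSpace Ω› :=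
    hξ.comap_le
  have h1 := setIntegral_condExp (μ := μ) hle (f := E.indicator fun _ => (1 : ℝ))
    ((integrable_const 1).indicator hEm) (s := S') ⟨S, hSm, rfl⟩
  rw [integral_congr_ae (ae_restrict_of_ae (hS.cond_law b)), setIntegral_indicator hEm,
    setIntegral_const, smul_eq_mul, mul_one] at h1
  rw [← h1, ← integral_indicator hS'm]
  refine integral_congr_ae (Filter.Eventually.of_forall fun ω => ?_)
  have hpr : ∏ e : Pairs n, ∏ k, (if a e k then (edgeProb f ρ t (fun i => ξ i ω) e k : ℝ)
      else 1 - edgeProb f ρ t (fun i => ξ i ω) e k)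
      = ∏ k, ∏ i, ∏ j ∈ Finset.Ici i, if b k i j then probMatrix f ρ (fun i => ξ i ω) (t k) i j
        else 1 - probMatrix f ρ (fun i => ξ i ω) (t k) i j := by
    rw [Finset.prod_comm]
    refine Finset.prod_congr rfl fun k _ => ?_
    rw [← prod_pairs fun i j => if b k i j then probMatrix f ρ (fun i => ξ i ω) (t k) i j
        else 1 - probMatrix f ρ (fun i => ξ i ω) (t k) i j]
    refine Finset.prod_congr rfl fun e _ => ?_
    have hbe : b k e.1.1 e.1.2 = a e k := by simp only [b, e.2, dif_pos]
    rw [hbe, edgeProb_coe hf hρ hρ1 ht]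
  by_cases hω : ω ∈ S'
  · simp only [indicator_of_mem hω, one_mul, hpr]
  · simp only [indicator_of_notMem hω, zero_mul]

/-- An event that is unlikely for independent edges, whatever the latent positions, is unlikely
in the graphon model. -/
theorem IsGraphonSample.measureReal_le (hf : IsGraphon f) (hρ : 0 ≤ ρ) (hρ1 : ρ ≤ 1)
    (ht : ∀ k, t k ∈ Icc (0 : ℝ) 1) (hS : IsGraphonSample μ f ρ t ξ A)
    (bad : (Fin n → I) → (Pairs n → Fin m → Bool) → Prop)
    (hm : ∀ a, MeasurableSet {x | bad x a}) {ε : ℝ}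
    (hε : ∀ x, (edgeLaw (edgeProb f ρ t x)).real {a | bad x a} ≤ ε) :
    μ.real {ω | bad (fun i => ξ i ω) (edgeArray fun k => A k ω)} ≤ ε := by
  classical
  have hξ : Measurable fun ω i => ξ i ω := measurable_pi_lambda _ hS.measurable_latent
  -- The array takes finitely many values. After splitting by value, the weights sum pointwise to
  -- the `edgeLaw` probability at the current positions, which is at most `ε`.
  have hsub : {ω | bad (fun i => ξ i ω) (edgeArray fun k => A k ω)}
      ⊆ ⋃ a, ({ω | (fun i => ξ i ω) ∈ {x | bad x a}} ∩ {ω | edgeArray (fun k => A k ω) = a}) := by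
    intro ω hω
    exact mem_iUnion.2 ⟨_, hω, rfl⟩
  refine (measureReal_mono hsub).trans ((measureReal_iUnion_fintype_le _).trans ?_)
  simp only [hS.measureReal_inter hf hρ hρ1 ht _ (hm _)]
  rw [← integral_finsetSum]
  · calc _ ≤ ∫ _ω, ε ∂μ := by
          refine integral_mono_of_nonneg (Filter.Eventually.of_forall fun ω => ?_)
            (integrable_const _) (Filter.Eventually.of_forall fun ω => ?_)
          · refine Finset.sum_nonneg fun a _ => mul_nonneg
              (indicator_nonneg (fun _ _ => zero_le_one) _)
              (Finset.prod_nonneg fun e _ => Finset.prod_nonneg fun k _ => ?_)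
            have h := (edgeProb f ρ t (fun i => ξ i ω) e k).2
            split_ifs
            · exact h.1
            · linarith [h.2]
          · have := hε fun i => ξ i ω
            rw [edgeLaw_real_eq_sum] at this
            exact this
      _ = ε := by simp
  · intro a _
    refine integrable_of_abs_le (W := 1) ?_ fun ω => ?_
    · refine (measurable_const.indicator (hξ (hm a))).mul (Finset.measurable_fun_prod _ fun e _ =>
        Finset.measurable_fun_prod _ fun k _ => ?_)
      have := (measurable_edgeProb (ρ := ρ) hf ht e k).comp hξ
      split_ifs
      · exact this
      · exact measurable_const.sub this
    · have hp : ∀ e k, 0 ≤ (if a e k then (edgeProb f ρ t (fun i => ξ i ω) e k : ℝ)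
          else 1 - edgeProb f ρ t (fun i => ξ i ω) e k) ∧
          (if a e k then (edgeProb f ρ t (fun i => ξ i ω) e k : ℝ)
          else 1 - edgeProb f ρ t (fun i => ξ i ω) e k) ≤ 1 := by
        intro e k
        have h := (edgeProb f ρ t (fun i => ξ i ω) e k).2
        split_ifs
        · exact h
        · exact ⟨by linarith [h.2], by linarith [h.1]⟩
      rw [abs_mul]
      refine mul_le_one₀ ?_ (abs_nonneg _) ?_
      · by_cases h : ω ∈ {ω | (fun i => ξ i ω) ∈ {x | bad x a}}
        · rw [indicator_of_mem h, abs_one]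
        · rw [indicator_of_notMem h, abs_zero]; exact zero_le_one
      · rw [abs_of_nonneg (Finset.prod_nonneg fun e _ => Finset.prod_nonneg fun k _ => (hp e k).1)]
        exact Finset.prod_le_one (fun e _ => Finset.prod_nonneg fun k _ => (hp e k).1) fun e _ =>
          Finset.prod_le_one (fun k _ => (hp e k).1) fun k _ => (hp e k).2

end Model

/-! ### A fine grid adapted to the blocks, and the number of latent positions in its cells -/

theorem exists_block_of_lt_one {x : ℕ → ℝ} {J : ℕ} (h0 : x 0 = 0) {u : ℝ} (hu0 : 0 ≤ u)
    (hu : u < x J) : ∃ k < J, u ∈ Ico (x k) (x (k + 1)) := by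
  induction J with
  | zero => linarith
  | succ J ih =>
    by_cases h : u < x J
    · obtain ⟨k, hk, hk'⟩ := ih h
      exact ⟨k, by omega, hk'⟩
    · exact ⟨J, by omega, not_lt.1 h, hu⟩

theorem exists_subinterval {a b u : ℝ} (hab : a < b) (hu : u ∈ Ico a b) {q : ℕ} (hq : 0 < q) :
    ∃ c < q, u ∈ Ico (a + c * ((b - a) / q)) (a + (c + 1) * ((b - a) / q)) := by
  have hq' : (0 : ℝ) < q := by exact_mod_cast hq
  have hd : 0 < (b - a) / q := by have := sub_pos.2 hab; positivity
  have h1 : 0 ≤ (u - a) / ((b - a) / q) := div_nonneg (sub_nonneg.2 hu.1) hd.le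
  refine ⟨⌊(u - a) / ((b - a) / q)⌋₊, ?_, ?_, ?_⟩
  · rw [Nat.floor_lt h1, div_lt_iff₀ hd]
    have : (q : ℝ) * ((b - a) / q) = b - a := by field_simp
    rw [this]; linarith [hu.2]
  · have := Nat.floor_le h1
    rw [le_div_iff₀ hd] at this
    linarith
  · have := Nat.lt_floor_add_one ((u - a) / ((b - a) / q))
    rw [div_lt_iff₀ hd] at this
    linarith

/-- Cut each block into q equal pieces: their lengths lie between δ/q and 1/q. The blocks are
half-open, so the point 1 is excluded throughout. -/
theorem PiecewiseLipschitz.exists_grid {L : ℝ} {f : ℝ → ℝ → ℝ → ℝ}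
    (h : PiecewiseLipschitz L f) : ∃ δ : ℝ, 0 < δ ∧ ∃ J : ℕ, ∀ q : ℕ, 0 < q →
      ∃ u v : Fin J × Fin q → ℝ, (∀ g, 0 ≤ u g ∧ v g ≤ 1 ∧ δ / q ≤ v g - u g) ∧
        (∀ y, 0 ≤ y → y < 1 → ∃ g, y ∈ Ico (u g) (v g)) ∧
        ∀ g, ∀ y ∈ Ico (u g) (v g), ∀ y' ∈ Ico (u g) (v g), ∀ z, 0 ≤ z → z < 1 →
          ∀ s ∈ Icc (0 : ℝ) 1, |f y z s - f y' z s| ≤ |L| / q := by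
  obtain ⟨δ, hδ, J, -, x, hx0, hxJ, hgap, hlip⟩ := h
  refine ⟨δ, hδ, J, fun q hq => ?_⟩
  have hq' : (0 : ℝ) < q := by exact_mod_cast hq
  have hmono : ∀ k ≤ J, ∀ l ≤ k, x l ≤ x k := by
    intro k
    induction k with
    | zero => intro _ l hl; rw [Nat.le_zero.1 hl]
    | succ k ih =>
      intro hk l hl
      rcases Nat.le_succ_iff.1 hl with h' | h'
      · have := ih (by omega) l h'
        have := hgap k (by omega)
        linarith
      · rw [h']
  have hblock : ∀ k < J, 0 ≤ x k ∧ x (k + 1) ≤ 1 ∧ x (k + 1) - x k ≤ 1 := by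
    intro k hk
    have h1 := hmono k hk.le 0 (Nat.zero_le _)
    have h2 := hmono J le_rfl (k + 1) hk
    rw [hx0] at h1
    rw [hxJ] at h2
    exact ⟨h1, h2, by linarith⟩
  refine ⟨fun g => x g.1 + g.2 * ((x (g.1 + 1) - x g.1) / q),
    fun g => x g.1 + (g.2 + 1) * ((x (g.1 + 1) - x g.1) / q), ?_, ?_, ?_⟩
  · rintro ⟨k, c⟩
    obtain ⟨h1, h2, h3⟩ := hblock k k.2
    have h4 := hgap k k.2
    have hd : 0 < (x (k + 1) - x k) / q := div_pos (by linarith) hq'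
    have hc : ((c : ℕ) : ℝ) + 1 ≤ q := by exact_mod_cast c.2
    refine ⟨by positivity, ?_, ?_⟩
    · have : ((c : ℕ) + 1 : ℝ) * ((x (k + 1) - x k) / q) ≤ q * ((x (k + 1) - x k) / q) := by gcongr
      rw [mul_div_cancel₀ _ hq'.ne'] at this
      dsimp only
      linarith
    · have : δ / q ≤ (x (k + 1) - x k) / q := by gcongr
      dsimp only
      linarith
  · intro y hy0 hy1
    obtain ⟨k, hk, hyk⟩ := exists_block_of_lt_one hx0 hy0 (hxJ ▸ hy1)
    obtain ⟨c, hc, hyc⟩ := exists_subinterval (by linarith [hgap k hk]) hyk hq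
    exact ⟨(⟨k, hk⟩, ⟨c, hc⟩), hyc⟩
  · rintro ⟨k, c⟩ y hy y' hy' z hz0 hz1 s hs
    obtain ⟨h1, h2, h3⟩ := hblock k k.2
    obtain ⟨l, hl, hzl⟩ := exists_block_of_lt_one hx0 hz0 (hxJ ▸ hz1)
    have hd : 0 < (x (k + 1) - x k) / q := div_pos (by linarith [hgap k k.2]) hq'
    have hc : ((c : ℕ) : ℝ) + 1 ≤ q := by exact_mod_cast c.2
    have hc2 : ((c : ℕ) + 1 : ℝ) * ((x (k + 1) - x k) / q) ≤ x (k + 1) - x k := by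
      have : ((c : ℕ) + 1 : ℝ) * ((x (k + 1) - x k) / q) ≤ q * ((x (k + 1) - x k) / q) := by gcongr
      rwa [mul_div_cancel₀ _ hq'.ne'] at this
    have hc0 : 0 ≤ ((c : ℕ) : ℝ) * ((x (k + 1) - x k) / q) := by positivity
    simp only [mem_Ico] at hy hy'
    have hyb : y ∈ Ico (x k) (x (k + 1)) := ⟨by linarith, by linarith⟩
    have hyb' : y' ∈ Ico (x k) (x (k + 1)) := ⟨by linarith, by linarith⟩
    refine (hlip k k.2 l hl s hs y hyb y hyb y' hyb' z hzl z hzl z hzl).1.trans ?_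
    have hdist : |y - y'| ≤ 1 / q := by
      have : (x (k + 1) - x k) / q ≤ 1 / q := by gcongr
      rw [abs_le]; constructor <;> linarith
    calc L * |y - y'| ≤ |L| * (1 / q) := by
          gcongr
          exact le_abs_self L
      _ = |L| / q := by ring

section Latent

variable {n : ℕ} {Ω : Type*} [MeasurableSpace Ω] {μ : Measure Ω}
  {ξ : Fin n → Ω → I}

theorem measureReal_uniform_Ico {X : Ω → I} (hX : Measurable X) (hμ : μ.map X = volume)
    {u v : ℝ} (hu : 0 ≤ u) (huv : u ≤ v) (hv : v ≤ 1) :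
    μ.real {ω | u ≤ X ω ∧ (X ω : ℝ) < v} = v - u := by
  have hm : MeasurableSet {y : I | u ≤ y ∧ (y : ℝ) < v} :=
    (measurableSet_Ico (a := u) (b := v)).preimage measurable_subtype_coe
  have h1 : μ {ω | u ≤ X ω ∧ (X ω : ℝ) < v} = volume {y : I | u ≤ y ∧ (y : ℝ) < v} := by
    rw [← hμ, Measure.map_apply hX hm]; rfl
  have h2 : (volume : Measure I) {y : I | u ≤ y ∧ (y : ℝ) < v} = ENNReal.ofReal (v - u) := by
    rw [unitInterval.volume_apply, ← Real.volume_Ico]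
    congr 1
    ext y
    simp only [mem_image, mem_ofPred_eq, mem_Ico]
    constructor
    · rintro ⟨z, ⟨h1, h2⟩, rfl⟩; exact ⟨h1, h2⟩
    · rintro ⟨h1, h2⟩; exact ⟨⟨y, by linarith, by linarith⟩, ⟨h1, h2⟩, rfl⟩
  rw [Measure.real, h1, h2, ENNReal.toReal_ofReal (by linarith)]

variable [IsProbabilityMeasure μ]

/-- Chernoff for the indicators scaled by -1/2: mean plus second moment is (-1/2 + 1/4)(v - u). A
count below n(v - u)/4 puts the scaled sum above -n(v - u)/8, which leaves room n(v - u)/8 for `T`.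
-/
theorem measureReal_card_Ico_lt_le (hξ : ∀ i, Measurable (ξ i)) (hI : iIndepFun ξ μ)
    (hμ : ∀ i, μ.map (ξ i) = volume) {u v : ℝ} (hu : 0 ≤ u) (huv : u ≤ v) (hv : v ≤ 1) {T : ℝ}
    (hT : 8 * T ≤ n * (v - u)) :
    μ.real {ω | ((Finset.univ.filter fun i => u ≤ ξ i ω ∧ (ξ i ω : ℝ) < v).card : ℝ)
      < n * (v - u) / 4} ≤ Real.exp (-T) := by
  set g : I → ℝ := fun y => if u ≤ (y : ℝ) ∧ (y : ℝ) < v then -(1 / 2) else 0 with hg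
  have hgm : Measurable g := by
    refine Measurable.ite ?_ measurable_const measurable_const
    exact (measurableSet_Ico (a := u) (b := v)).preimage measurable_subtype_coe
  have hset : ∀ i, MeasurableSet {ω | u ≤ ξ i ω ∧ (ξ i ω : ℝ) < v} := fun i =>
    (measurableSet_Ico (a := u) (b := v)).preimage (measurable_subtype_coe.comp (hξ i))
  have hint : ∀ (i : Fin n) (c : ℝ),
      ∫ ω, (if u ≤ (ξ i ω : ℝ) ∧ (ξ i ω : ℝ) < v then c else 0) ∂μ = c * (v - u) := by
    intro i c
    rw [← measureReal_uniform_Ico (hξ i) (hμ i) hu huv hv, mul_comm, ← smul_eq_mul,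
      ← integral_indicator_const c (hset i)]
    refine integral_congr_ae (Filter.Eventually.of_forall fun ω => ?_)
    simp [indicator_apply]
  have hgi : iIndepFun (fun i ω => g (ξ i ω)) μ := hI.comp (fun _ => g) fun _ => hgm
  have h1 := measureReal_sum_ge_le_of_integral_exp (μ := μ) (X := fun i ω => g (ξ i ω))
    (s := Finset.univ) (fun i _ => hgm.comp (hξ i)) (fun i _ ω => by
      simp only [hg]; split_ifs <;> norm_num [abs_of_pos])
    (integral_exp_sum_of_iIndepFun hgi (fun i => hgm.comp (hξ i)) _)
    (V := -(n * (v - u) / 4)) (by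
      have hsq : ∀ i ω, g (ξ i ω) ^ 2
          = if u ≤ (ξ i ω : ℝ) ∧ (ξ i ω : ℝ) < v then 1 / 4 else 0 := fun i ω => by
        simp only [hg]; split_ifs <;> norm_num
      simp only [hsq]
      simp only [hg, hint]
      rw [Finset.sum_const, Finset.card_univ, Fintype.card_fin, nsmul_eq_mul]
      linarith) T
  refine (measureReal_mono fun ω hω => ?_).trans h1
  simp only [mem_ofPred_eq] at hω ⊢
  have hs : ∑ i, g (ξ i ω)
      = -(1 / 2) * ((Finset.univ.filter fun i => u ≤ ξ i ω ∧ (ξ i ω : ℝ) < v).card : ℝ) := by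
    simp only [hg]
    rw [← Finset.sum_filter, Finset.sum_const, nsmul_eq_mul, mul_comm]
  rw [hs]
  linarith

/-- Needed because no half-open cell contains the point 1. -/
theorem measureReal_latent_eq_one (hξ : ∀ i, Measurable (ξ i)) (hμ : ∀ i, μ.map (ξ i) = volume) :
    μ.real {ω | ∃ i, ¬ ((ξ i ω : ℝ) < 1)} = 0 := by
  have hle : ∀ i, μ.real {ω | ¬ ((ξ i ω : ℝ) < 1)} = 0 := by
    intro i
    have hc : {ω | ¬ ((ξ i ω : ℝ) < 1)} = {ω | (0 : ℝ) ≤ ξ i ω ∧ (ξ i ω : ℝ) < 1}ᶜ := by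
      ext ω; simp [(ξ i ω).2.1]
    have hset : MeasurableSet {ω | (0 : ℝ) ≤ ξ i ω ∧ (ξ i ω : ℝ) < 1} :=
      (measurableSet_Ico (a := (0 : ℝ)) (b := 1)).preimage (measurable_subtype_coe.comp (hξ i))
    rw [hc, probReal_compl_eq_one_sub hset,
      measureReal_uniform_Ico (hξ i) (hμ i) le_rfl zero_le_one le_rfl]
    norm_num
  have hu : {ω | ∃ i, ¬ ((ξ i ω : ℝ) < 1)} = ⋃ i, {ω | ¬ ((ξ i ω : ℝ) < 1)} := by
    ext ω; simp
  rw [hu]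
  refine le_antisymm ((measureReal_iUnion_fintype_le _).trans ?_) measureReal_nonneg
  rw [Finset.sum_eq_zero fun i _ => hle i]

theorem measureReal_not_grid_le (hξ : ∀ i, Measurable (ξ i)) (hI : iIndepFun ξ μ)
    (hμ : ∀ i, μ.map (ξ i) = volume) {ι : Type*} [Fintype ι] {u v : ι → ℝ} {d : ℝ} (hd : 0 ≤ d)
    (huv : ∀ g, 0 ≤ u g ∧ v g ≤ 1 ∧ d ≤ v g - u g) {T : ℝ} (hT : 8 * T ≤ n * d) :
    μ.real {ω | ¬ ((∀ i, (ξ i ω : ℝ) < 1) ∧ ∀ g, n * d / 4 ≤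
      ((Finset.univ.filter fun i => u g ≤ ξ i ω ∧ (ξ i ω : ℝ) < v g).card : ℝ))}
      ≤ Fintype.card ι * Real.exp (-T) := by
  have hsub : {ω | ¬ ((∀ i, (ξ i ω : ℝ) < 1) ∧ ∀ g, n * d / 4 ≤
      ((Finset.univ.filter fun i => u g ≤ ξ i ω ∧ (ξ i ω : ℝ) < v g).card : ℝ))}
      ⊆ {ω | ∃ i, ¬ ((ξ i ω : ℝ) < 1)} ∪ ⋃ g,
        {ω | ((Finset.univ.filter fun i => u g ≤ ξ i ω ∧ (ξ i ω : ℝ) < v g).card : ℝ)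
          < n * (v g - u g) / 4} := by
    intro ω hω
    simp only [mem_ofPred_eq, not_and_or, not_forall, mem_union, mem_iUnion] at hω ⊢
    refine hω.imp id fun ⟨g, hg⟩ => ⟨g, (not_le.1 hg).trans_le ?_⟩
    have := (huv g).2.2
    gcongr
  refine (measureReal_mono hsub).trans ((measureReal_union_le _ _).trans ?_)
  rw [measureReal_latent_eq_one hξ hμ, zero_add]
  refine (measureReal_iUnion_fintype_le _).trans ?_
  calc _ ≤ ∑ _g : ι, Real.exp (-T) := by
        refine Finset.sum_le_sum fun g _ => ?_
        obtain ⟨h1, h2, h3⟩ := huv g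
        refine measureReal_card_Ico_lt_le hξ hI hμ h1 (by linarith) h2 (hT.trans ?_)
        gcongr
    _ = _ := by simp

end Latent

/-! ### Neighbourhoods determined by inner products of rows -/

section Neighbourhood

variable {n : ℕ} {Q : Matrix (Fin n) (Fin n) ℝ} {h : ℝ} {i : Fin n}

theorem nodeDist_nonneg (i j : Fin n) : 0 ≤ nodeDist Q i j := Real.sqrt_nonneg _

theorem nodeDist_le {i j : Fin n} {X : ℝ} (hX : 0 ≤ X)
    (hl : ∀ l, l ≠ i → l ≠ j → |(Q i - Q j) ⬝ᵥ Q l| ≤ X) : nodeDist Q i j ≤ Real.sqrt (X / n) := by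
  refine Real.sqrt_le_sqrt ?_
  gcongr
  -- If there is no third node the supremum over the empty type is 0, whence the need for `hX`.
  exact Real.iSup_le (fun l => hl l l.2.1 l.2.2) hX

theorem abs_dotProduct_le_of_nodeDist_le {i j : Fin n} {X : ℝ} (hX : 0 ≤ X)
    (hd : nodeDist Q i j ≤ Real.sqrt (X / n)) {l : Fin n} (hli : l ≠ i) (hlj : l ≠ j) :
    |(Q i - Q j) ⬝ᵥ Q l| ≤ X := by
  have hn : (0 : ℝ) < n := by exact_mod_cast i.pos
  rw [nodeDist, Real.sqrt_le_sqrt_iff (by positivity), div_le_div_iff_of_pos_right hn] at hd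
  exact (le_ciSup (f := fun l : {l : Fin n // l ≠ i ∧ l ≠ j} => |(Q i - Q j) ⬝ᵥ Q l|)
    (Finite.bddAbove_range _) ⟨l, hli, hlj⟩).trans hd

theorem bddBelow_quantileSet (hh : 0 < h * n) :
    BddBelow {q : ℝ | h * n ≤ (({k | nodeDist Q i k ≤ q} : Set (Fin n)).ncard : ℝ)} := by
  refine ⟨0, fun q hq => ?_⟩
  by_contra hcon
  have : ({k | nodeDist Q i k ≤ q} : Set (Fin n)) = ∅ := by
    ext k
    simp only [mem_ofPred_eq, mem_empty_iff_false, iff_false, not_le]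
    exact (not_le.1 hcon).trans_le (nodeDist_nonneg _ _)
  simp only [mem_ofPred_eq, this, ncard_empty, Nat.cast_zero] at hq
  linarith

theorem distQuantile_le (hh : 0 < h * n) {q : ℝ}
    (hq : h * n ≤ (({k | nodeDist Q i k ≤ q} : Set (Fin n)).ncard : ℝ)) :
    distQuantile Q h i ≤ q :=
  csInf_le (bddBelow_quantileSet hh) hq

/-- The infimum is attained: the defining set is a finite union of intersections of closed
half-lines, and `q` shows that it is non-empty. -/
theorem le_ncard_distQuantile (hh : 0 < h * n) {q : ℝ}
    (hq : h * n ≤ (({k | nodeDist Q i k ≤ q} : Set (Fin n)).ncard : ℝ)) :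
    h * n ≤ (({k | nodeDist Q i k ≤ distQuantile Q h i} : Set (Fin n)).ncard : ℝ) := by
  have hclosed : IsClosed {q : ℝ | h * n ≤ (({k | nodeDist Q i k ≤ q} : Set (Fin n)).ncard : ℝ)} := by
    have heq : {q : ℝ | h * n ≤ (({k | nodeDist Q i k ≤ q} : Set (Fin n)).ncard : ℝ)}
        = ⋃ S ∈ {S : Set (Fin n) | h * n ≤ (S.ncard : ℝ)}, ⋂ k ∈ S, Ici (nodeDist Q i k) := by
      ext q
      simp only [mem_ofPred_eq, mem_iUnion, mem_iInter, mem_Ici, exists_prop]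
      constructor
      · intro hq
        exact ⟨_, hq, fun k hk => hk⟩
      · rintro ⟨S, hS, hk⟩
        refine hS.trans ?_
        exact_mod_cast ncard_le_ncard (fun k hkS => hk k hkS) (toFinite _)
    rw [heq]
    exact (toFinite _).isClosed_biUnion fun S _ =>
      isClosed_biInter fun k _ => isClosed_Ici
  exact hclosed.csInf_mem ⟨q, hq⟩ (bddBelow_quantileSet hh)

theorem self_or_le_of_mem_nbhd {j : Fin n} (hj : j ∈ nbhd Q h i) :
    j = i ∨ nodeDist Q i j ≤ distQuantile Q h i := by
  unfold nbhd at hj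
  split_ifs at hj with hs
  · left; simpa using hj
  · right; simpa using hj

theorem le_card_nbhd (hh : 0 < h * n) {q : ℝ}
    (hq : h * n ≤ (({k | nodeDist Q i k ≤ q} : Set (Fin n)).ncard : ℝ)) :
    h * n ≤ (nbhd Q h i).card := by
  classical
  unfold nbhd
  split_ifs with hs
  · simpa using hs
  · have := le_ncard_distQuantile hh hq
    rw [← Set.ncard_coe_finset]
    convert this using 3
    ext k; simp

theorem nbhd_of_le_one (hs : h * n ≤ 1) : nbhdSmooth Q h = Q := by
  ext i j
  simp [nbhdSmooth, nbhd, hs]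

end Neighbourhood

/-! ### Averages over rows -/

section Average

variable {n : ℕ}

theorem sum_sq_average_le (N : Finset (Fin n)) (hN : N.Nonempty) (D : Fin n → Fin n → ℝ) {X : ℝ}
    (hD : ∀ i ∈ N, ∑ j, D i j ^ 2 ≤ X) :
    ∑ j, ((1 / (N.card : ℝ)) * ∑ i ∈ N, D i j) ^ 2 ≤ X := by
  have hc : (0 : ℝ) < N.card := by exact_mod_cast hN.card_pos
  calc ∑ j, ((1 / (N.card : ℝ)) * ∑ i ∈ N, D i j) ^ 2
      ≤ ∑ j, (1 / (N.card : ℝ)) * ∑ i ∈ N, D i j ^ 2 := by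
        refine Finset.sum_le_sum fun j _ => ?_
        have := sq_sum_le_card_mul_sum_sq (s := N) (f := fun i => D i j)
        calc ((1 / (N.card : ℝ)) * ∑ i ∈ N, D i j) ^ 2
            = (1 / (N.card : ℝ)) ^ 2 * (∑ i ∈ N, D i j) ^ 2 := by ring
          _ ≤ (1 / (N.card : ℝ)) ^ 2 * (N.card * ∑ i ∈ N, D i j ^ 2) := by gcongr
          _ = _ := by field_simp
    _ = (1 / (N.card : ℝ)) * ∑ i ∈ N, ∑ j, D i j ^ 2 := by
        rw [← Finset.mul_sum, Finset.sum_comm]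
    _ ≤ (1 / (N.card : ℝ)) * ∑ _i ∈ N, X := by
        gcongr with i hi
        exact hD i hi
    _ = X := by rw [Finset.sum_const, nsmul_eq_mul]; field_simp

/-- Expand the square: the |N| diagonal terms give A/|N|, the others at most X. Since `N` is
arbitrary, it may depend on the noise. -/
theorem sum_sq_average_le_of_cross (N : Finset (Fin n)) (hN : N.Nonempty)
    (Z : Fin n → Fin n → ℝ) {A X : ℝ} (hX : 0 ≤ X) (hA : ∀ i, ∑ j, Z i j ^ 2 ≤ A)
    (hcross : ∀ i l, i ≠ l → |∑ j, Z i j * Z l j| ≤ X) :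
    ∑ j, ((1 / (N.card : ℝ)) * ∑ i ∈ N, Z i j) ^ 2 ≤ A / N.card + X := by
  have hc : (0 : ℝ) < N.card := by exact_mod_cast hN.card_pos
  have hexp : ∑ j, (∑ i ∈ N, Z i j) ^ 2 = ∑ i ∈ N, ∑ l ∈ N, ∑ j, Z i j * Z l j := by
    simp only [sq, Finset.sum_mul_sum]
    rw [Finset.sum_comm]
    exact Finset.sum_congr rfl fun i _ => Finset.sum_comm
  have hbound : ∑ i ∈ N, ∑ l ∈ N, ∑ j, Z i j * Z l j ≤ N.card * A + N.card ^ 2 * X := by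
    calc _ ≤ ∑ i ∈ N, ∑ l ∈ N, ((if i = l then A else 0) + X) := by
          refine Finset.sum_le_sum fun i _ => Finset.sum_le_sum fun l _ => ?_
          split_ifs with hil
          · subst hil
            have := hA i
            simp only [sq] at this
            linarith
          · rw [zero_add]
            exact (le_abs_self _).trans (hcross i l hil)
      _ = _ := by
          simp only [Finset.sum_add_distrib, Finset.sum_ite_eq, Finset.sum_const, nsmul_eq_mul,
            Finset.sum_ite_mem, Finset.inter_self]
          ring
  calc ∑ j, ((1 / (N.card : ℝ)) * ∑ i ∈ N, Z i j) ^ 2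
      = (1 / (N.card : ℝ)) ^ 2 * ∑ j, (∑ i ∈ N, Z i j) ^ 2 := by
        rw [Finset.mul_sum]
        exact Finset.sum_congr rfl fun j _ => by ring
    _ ≤ (1 / (N.card : ℝ)) ^ 2 * (N.card * A + N.card ^ 2 * X) := by
        rw [hexp]; gcongr
    _ = A / N.card + X := by field_simp

theorem abs_dotProduct_le_card_mul {u v : Fin n → ℝ} {a b : ℝ} (ha : ∀ j, |u j| ≤ a)
    (hb : ∀ j, |v j| ≤ b) : |u ⬝ᵥ v| ≤ n * (a * b) := by
  calc |u ⬝ᵥ v| ≤ ∑ j, |u j * v j| := Finset.abs_sum_le_sum_abs _ _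
    _ ≤ ∑ _j : Fin n, a * b := Finset.sum_le_sum fun j _ => by
        rw [abs_mul]
        exact mul_le_mul (ha j) (hb j) (abs_nonneg _) ((abs_nonneg _).trans (ha j))
    _ = _ := by simp

/-- Deterministic error bound for neighbourhood smoothing of `M + Z`, where `M` is close to `P` and
the rows of the noise `Z` are nearly orthogonal to those of `M` and to one another. -/
theorem sum_sq_nbhdSmooth_sub_le {P M Z : Matrix (Fin n) (Fin n) ℝ} {ρ X A τ h : ℝ} (hX : 0 ≤ X)
    (hP : ∀ i j, 0 ≤ P i j ∧ P i j ≤ ρ)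
    (hMP : ∀ i, ∑ j, (M i j - P i j) ^ 2 ≤ X)
    (hMM : ∀ i l, |M i ⬝ᵥ M l - P i ⬝ᵥ P l| ≤ X)
    (hMZ : ∀ i l, |M i ⬝ᵥ Z l| ≤ X) (hZZ : ∀ i l, i ≠ l → |Z i ⬝ᵥ Z l| ≤ X)
    (hA : ∀ i, ∑ j, Z i j ^ 2 ≤ A) (hAX : A ≤ X * (h * n)) (hh : 0 < h * n)
    (hτ : n * (τ * ρ) ≤ X)
    (hS : ∀ i, ∃ S : Finset (Fin n), h * n ≤ S.card ∧ 3 ≤ S.card ∧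
      ∀ i' ∈ S, ∀ j, |P i j - P i' j| ≤ τ) (i : Fin n) :
    ∑ j, (nbhdSmooth (M + Z) h i j - P i j) ^ 2 ≤ 117 * X := by
  set Q := M + Z with hQ
  have hQQ : ∀ i l, i ≠ l → |Q i ⬝ᵥ Q l - P i ⬝ᵥ P l| ≤ 4 * X := by
    intro i l hil
    have h1 : Q i ⬝ᵥ Q l = M i ⬝ᵥ M l + M i ⬝ᵥ Z l + M l ⬝ᵥ Z i + Z i ⬝ᵥ Z l := by
      have : ∀ i, Q i = M i + Z i := fun i => rfl
      rw [this, this, add_dotProduct, dotProduct_add, dotProduct_add, dotProduct_comm (Z i) (M l)]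
      ring
    have a1 := abs_le.1 (hMM i l)
    have a2 := abs_le.1 (hMZ i l)
    have a3 := abs_le.1 (hMZ l i)
    have a4 := abs_le.1 (hZZ i l hil)
    rw [h1, abs_le]
    constructor <;> linarith [a1.1, a1.2, a2.1, a2.2, a3.1, a3.2, a4.1, a4.2]
  have hdiff : ∀ i i' l, l ≠ i → l ≠ i' →
      |(Q i - Q i') ⬝ᵥ Q l - (P i - P i') ⬝ᵥ P l| ≤ 8 * X := by
    intro i i' l h1 h2
    have a1 := abs_le.1 (hQQ i l h1.symm)
    have a2 := abs_le.1 (hQQ i' l h2.symm)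
    rw [sub_dotProduct, sub_dotProduct, abs_le]
    constructor <;> linarith [a1.1, a1.2, a2.1, a2.2]
  have hPabs : ∀ i j, |P i j| ≤ ρ := fun i j => by
    rw [abs_of_nonneg (hP i j).1]; exact (hP i j).2
  have hPsub : ∀ i i' j, |(P i - P i') j| ≤ ρ := fun i i' j => by
    rw [Pi.sub_apply, abs_le]
    constructor <;> linarith [(hP i j).1, (hP i j).2, (hP i' j).1, (hP i' j).2]
  -- 9 = 8 from `hdiff` plus 1 from `hτ`: cell mates are within this distance, so the quantile is
  -- too.
  have hdist : ∀ i, ∃ S : Finset (Fin n), h * n ≤ S.card ∧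
      ∀ i' ∈ S, nodeDist Q i i' ≤ Real.sqrt (9 * X / n) := by
    intro i
    obtain ⟨S, hS1, -, hS3⟩ := hS i
    refine ⟨S, hS1, fun i' hi' => nodeDist_le (by positivity) fun l h1 h2 => ?_⟩
    have a1 := abs_le.1 (hdiff i i' l h1 h2)
    have a2 := abs_le.1 ((abs_dotProduct_le_card_mul (u := P i - P i') (hS3 i' hi')
      (hPabs l)).trans hτ)
    rw [abs_le]
    constructor <;> linarith [a1.1, a1.2, a2.1, a2.2]
  have hncard : ∀ i, h * n ≤
      (({k | nodeDist Q i k ≤ Real.sqrt (9 * X / n)} : Set (Fin n)).ncard : ℝ) := by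
    intro i
    obtain ⟨S, hS1, hS2⟩ := hdist i
    refine hS1.trans ?_
    rw [← Set.ncard_coe_finset]
    exact_mod_cast ncard_le_ncard (fun k hk => hS2 k hk) (toFinite _)
  have hclose : ∀ i i', i' ∈ nbhd Q h i → ∑ j, (P i' j - P i j) ^ 2 ≤ 36 * X := by
    intro i i' hi'
    rcases self_or_le_of_mem_nbhd hi' with rfl | hd
    · simp only [sub_self]
      norm_num
      positivity
    have hd' := hd.trans (distQuantile_le hh (hncard i))
    -- `nodeDist` tests only rows other than i and i', but k = i and k = i' are needed below. A node
    -- l close to k replaces k; three elements in S leave one that is allowed. The constant is 18 =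
    -- 9 + 8 + 1.
    have hrow : ∀ k, |(P i - P i') ⬝ᵥ P k| ≤ 18 * X := by
      intro k
      obtain ⟨S, -, hS2, hS3⟩ := hS k
      obtain ⟨l, hl, hli, hli'⟩ : ∃ l ∈ S, l ≠ i ∧ l ≠ i' := by
        have h1 : 1 ≤ ((S.erase i).erase i').card := by
          have h2 := Finset.pred_card_le_card_erase (s := S) (a := i)
          have h3 := Finset.pred_card_le_card_erase (s := S.erase i) (a := i')
          omega
        obtain ⟨l, hl⟩ := Finset.card_pos.1 (by omega : 0 < ((S.erase i).erase i').card)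
        simp only [Finset.mem_erase] at hl
        exact ⟨l, hl.2.2, hl.2.1, hl.1⟩
      have a1 := abs_le.1 (abs_dotProduct_le_of_nodeDist_le (by positivity) hd' hli hli')
      have a2 := abs_le.1 (hdiff i i' l hli hli')
      have a3 := abs_le.1 ((abs_dotProduct_le_card_mul (v := P k - P l) (hPsub i i')
        (hS3 l hl)).trans ((by rw [mul_comm ρ τ]) : (n : ℝ) * (ρ * τ) ≤ n * (τ * ρ)) |>.trans hτ)
      rw [dotProduct_sub] at a3
      rw [abs_le]
      constructor <;> linarith [a1.1, a1.2, a2.1, a2.2, a3.1, a3.2]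
    -- The squared distance is a difference of two tested inner products, hence 36 = 18 + 18.
    have hexp : ∑ j, (P i' j - P i j) ^ 2 = (P i - P i') ⬝ᵥ P i - (P i - P i') ⬝ᵥ P i' := by
      rw [← dotProduct_sub, dotProduct]
      exact Finset.sum_congr rfl fun j _ => by simp only [Pi.sub_apply]; ring
    have b1 := abs_le.1 (hrow i)
    have b2 := abs_le.1 (hrow i')
    rw [hexp]
    linarith [b1.1, b1.2, b2.1, b2.2]
  set N := nbhd Q h i with hN
  have hcard : h * n ≤ N.card := le_card_nbhd hh (hncard i)
  have hc : (0 : ℝ) < N.card := hh.trans_le hcard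
  have hNne : N.Nonempty := Finset.card_pos.1 (by exact_mod_cast hc)
  have t1 := sum_sq_average_le_of_cross N hNne Z hX hA hZZ
  have t2 := sum_sq_average_le N hNne (fun i j => M i j - P i j) fun i _ => hMP i
  have t3 := sum_sq_average_le N hNne (fun i' j => P i' j - P i j) fun i' hi' => hclose i i' hi'
  have hAN : A / N.card ≤ X := by
    rw [div_le_iff₀ hc]
    exact hAX.trans (by gcongr)
  have hsplit : ∀ j, nbhdSmooth Q h i j - P i j = (1 / (N.card : ℝ)) * ∑ i' ∈ N, Z i' j
      + (1 / (N.card : ℝ)) * ∑ i' ∈ N, (M i' j - P i' j)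
      + (1 / (N.card : ℝ)) * ∑ i' ∈ N, (P i' j - P i j) := by
    intro j
    have h1 : ∑ i' ∈ N, Q i' j = ∑ i' ∈ N, Z i' j + ∑ i' ∈ N, (M i' j - P i' j)
        + ∑ i' ∈ N, (P i' j - P i j) + N.card * P i j := by
      rw [← Finset.sum_add_distrib, ← Finset.sum_add_distrib, ← nsmul_eq_mul, ← Finset.sum_const,
        ← Finset.sum_add_distrib]
      exact Finset.sum_congr rfl fun i' _ => by rw [hQ, Matrix.add_apply]; ring
    rw [nbhdSmooth, Matrix.of_apply, ← hN, h1]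
    field_simp
    ring
  calc ∑ j, (nbhdSmooth Q h i j - P i j) ^ 2
      ≤ ∑ j, 3 * (((1 / (N.card : ℝ)) * ∑ i' ∈ N, Z i' j) ^ 2
        + ((1 / (N.card : ℝ)) * ∑ i' ∈ N, (M i' j - P i' j)) ^ 2
        + ((1 / (N.card : ℝ)) * ∑ i' ∈ N, (P i' j - P i j)) ^ 2) := by
        refine Finset.sum_le_sum fun j _ => ?_
        rw [hsplit]
        generalize (1 / (N.card : ℝ)) * ∑ i' ∈ N, Z i' j = a
        generalize (1 / (N.card : ℝ)) * ∑ i' ∈ N, (M i' j - P i' j) = b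
        generalize (1 / (N.card : ℝ)) * ∑ i' ∈ N, (P i' j - P i j) = c
        nlinarith [sq_nonneg (a - b), sq_nonneg (a - c), sq_nonneg (b - c)]
    _ = 3 * (∑ j, ((1 / (N.card : ℝ)) * ∑ i' ∈ N, Z i' j) ^ 2
        + ∑ j, ((1 / (N.card : ℝ)) * ∑ i' ∈ N, (M i' j - P i' j)) ^ 2
        + ∑ j, ((1 / (N.card : ℝ)) * ∑ i' ∈ N, (P i' j - P i j)) ^ 2) := by
        rw [← Finset.mul_sum, Finset.sum_add_distrib, Finset.sum_add_distrib]
    -- 117 = 3(2 + 1 + 36): noise (diagonal and cross terms), bias, and spread of P over the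
    -- neighbourhood.
    _ ≤ 117 * X := by linarith

theorem twoInftyNorm_sq_le {B : Matrix (Fin n) (Fin n) ℝ} {r : ℝ} (hr : 0 ≤ r)
    (hB : ∀ i, ∑ j, B i j ^ 2 ≤ n * r) : (1 / (n : ℝ)) * twoInftyNorm B ^ 2 ≤ r := by
  rcases Nat.eq_zero_or_pos n with hn | hn
  · subst hn; simpa using hr
  have hn' : (0 : ℝ) < n := by exact_mod_cast hn
  have h1 : twoInftyNorm B ≤ Real.sqrt (n * r) :=
    Real.iSup_le (fun i => Real.sqrt_le_sqrt (hB i)) (Real.sqrt_nonneg _)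
  have h0 : 0 ≤ twoInftyNorm B := Real.iSup_nonneg fun i => Real.sqrt_nonneg _
  have h2 := pow_le_pow_left₀ h0 h1 2
  rw [Real.sq_sqrt (by positivity)] at h2
  rw [one_div, inv_mul_le_iff₀ hn']
  exact h2

/-- Smoothing in time preserves row-wise error bounds up to the bias. -/
theorem sum_sq_weighted_sub_le {m : ℕ} (w : Fin m → ℝ) {W : ℝ} (hw : ∑ k, |w k| ≤ W)
    (D : Fin m → Fin n → ℝ) (b : Fin n → ℝ) {X Y : ℝ} (hX : 0 ≤ X)
    (hD : ∀ k, ∑ j, D k j ^ 2 ≤ X) (hb : ∀ j, |b j| ≤ Y) :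
    ∑ j, (∑ k, w k * D k j + b j) ^ 2 ≤ 2 * (W ^ 2 * X) + 2 * (n * Y ^ 2) := by
  have hW : 0 ≤ W := (Finset.sum_nonneg fun k _ => abs_nonneg _).trans hw
  have h1 : ∑ j, (∑ k, w k * D k j) ^ 2 ≤ W ^ 2 * X := by
    calc ∑ j, (∑ k, w k * D k j) ^ 2 ≤ ∑ j, (∑ k, |w k|) * ∑ k, |w k| * D k j ^ 2 := by
          refine Finset.sum_le_sum fun j _ => ?_
          refine Finset.sum_sq_le_sum_mul_sum_of_sq_le_mul _ (fun k _ => abs_nonneg _)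
            (fun k _ => by positivity) fun k _ => ?_
          rw [mul_pow, ← mul_assoc, ← sq, sq_abs]
      _ = (∑ k, |w k|) * ∑ k, |w k| * ∑ j, D k j ^ 2 := by
          rw [← Finset.mul_sum, Finset.sum_comm]
          simp only [Finset.mul_sum]
      _ ≤ (∑ k, |w k|) * ∑ k, |w k| * X := by
          gcongr with k
          exact hD k
      _ = (∑ k, |w k|) * (∑ k, |w k|) * X := by rw [← Finset.sum_mul, mul_assoc]
      _ ≤ W ^ 2 * X := by
          rw [sq]
          gcongr
  calc ∑ j, (∑ k, w k * D k j + b j) ^ 2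
      ≤ ∑ j, (2 * (∑ k, w k * D k j) ^ 2 + 2 * Y ^ 2) := by
        refine Finset.sum_le_sum fun j _ => ?_
        have := pow_le_pow_left₀ (abs_nonneg _) (hb j) 2
        rw [sq_abs] at this
        nlinarith [sq_nonneg (∑ k, w k * D k j - b j)]
    _ = 2 * ∑ j, (∑ k, w k * D k j) ^ 2 + 2 * (n * Y ^ 2) := by
        rw [Finset.sum_add_distrib, ← Finset.mul_sum]
        simp only [Finset.sum_const, Finset.card_univ, Fintype.card_fin, nsmul_eq_mul]
        ring
    _ ≤ _ := by linarith

end Average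

/-! ### Algebra of bandwidths and rates -/

section Rates

variable {β ρ : ℝ} {n m : ℕ}

theorem h1Dense_pos (hρ : 0 < ρ) (hn : 0 < n) (hm : 0 < m) (hL : 0 < logNM n m) :
    0 < h1Dense β ρ n m := by
  unfold h1Dense; positivity

/-- With y = h^β this reads log(nm) = ρ²nm·y²h. Together with h₃ = h, the scale ρy for h₂ and the
rate ρ²y, it replaces all explicit powers later on. -/
theorem h1Dense_rpow (hβ : 0 < β) (hρ : 0 < ρ) (hn : 0 < n) (hm : 0 < m) (hL : 0 < logNM n m) :
    ρ ^ 2 * n * m * h1Dense β ρ n m ^ (2 * β + 1) = logNM n m := by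
  have h1 : (1 / (2 * β + 1)) * (2 * β + 1) = 1 := by field_simp
  rw [h1Dense, ← Real.rpow_mul (by positivity), h1, Real.rpow_one]
  field_simp

theorem h1Dense_le_one (hβ : 0 < β) (hρ : 0 < ρ) (hn : 0 < n) (hm : 0 < m) (hL : 0 < logNM n m)
    (h : Real.sqrt (logNM n m / (n * m)) ≤ ρ) : h1Dense β ρ n m ≤ 1 := by
  refine Real.rpow_le_one (by positivity) ?_ (by positivity)
  rw [Real.sqrt_le_left hρ.le, div_le_iff₀ (by positivity)] at h
  rw [div_le_one (by positivity)]
  linarith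

theorem h1Dense_eq_mul (hρ : 0 < ρ) (e : ℝ) :
    (logNM n m / (ρ ^ 2 * n * m)) ^ e = ρ ^ (-2 * e) * (logNM n m / (n * m)) ^ e := by
  have h1 : logNM n m / (ρ ^ 2 * n * m) = ρ ^ (-2 : ℝ) * (logNM n m / (n * m)) := by
    rw [Real.rpow_neg hρ.le, Real.rpow_two]
    field_simp
  have hl : 0 ≤ logNM n m / (n * m) := by
    refine div_nonneg ?_ (by positivity)
    unfold logNM
    rw [← Nat.cast_mul]
    exact Real.log_natCast_nonneg _
  rw [h1, Real.mul_rpow (by positivity) hl, ← Real.rpow_mul hρ.le]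

theorem h3Dense_eq (hρ : 0 < ρ) : h3Dense β ρ n m = h1Dense β ρ n m := by
  rw [h1Dense, h1Dense_eq_mul hρ, h3Dense]
  congr 2
  ring

theorem h1Dense_rpow_beta (hρ : 0 < ρ) (hL : 0 < logNM n m) : h1Dense β ρ n m ^ β
    = ρ ^ (-2 * (β / (2 * β + 1))) * (logNM n m / (n * m)) ^ (β / (2 * β + 1)) := by
  rw [h1Dense, ← Real.rpow_mul (by positivity), ← h1Dense_eq_mul hρ]
  congr 1
  ring

theorem h2Dense_eq (hβ : 0 < β) (hρ : 0 < ρ) (hL : 0 < logNM n m) :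
    h2Dense β ρ n m = ρ * h1Dense β ρ n m ^ β := by
  rw [h1Dense_rpow_beta hρ hL, h2Dense, ← mul_assoc]
  congr 1
  nth_rw 2 [← Real.rpow_one ρ]
  rw [← Real.rpow_add hρ]
  congr 1
  field_simp
  ring

theorem rateDense_eq (hβ : 0 < β) (hρ : 0 < ρ) (hL : 0 < logNM n m) :
    rateDense β ρ n m = ρ ^ 2 * h1Dense β ρ n m ^ β := by
  rw [h1Dense_rpow_beta hρ hL, rateDense, ← mul_assoc]
  congr 1
  rw [← Real.rpow_two, ← Real.rpow_add hρ]
  congr 1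
  field_simp
  ring

/-- Above the regime boundary the bandwidth is small compared with `m ^ (-1 / (β + 1))`. -/
theorem mul_h1Dense_rpow_le (hβ : 0 < β) (hρ : 0 < ρ) (hn : 0 < n) (hm : 0 < m)
    (hL : 0 < logNM n m) {c₁ : ℝ} (hc₁ : 0 < c₁) (hreg : c₁ * boundary β n m ≤ n * ρ) :
    m * h1Dense β ρ n m ^ (β + 1) ≤ (1 / c₁ ^ 2) ^ ((β + 1) / (2 * β + 1)) := by
  have hn' : (0 : ℝ) < n := by exact_mod_cast hn
  have hm' : (0 : ℝ) < m := by exact_mod_cast hm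
  have h1 : c₁ ^ 2 * ((m : ℝ) ^ (β / (β + 1)) * logNM n m) ≤ n * ρ ^ 2 := by
    have h2 := pow_le_pow_left₀ (mul_nonneg hc₁.le (Real.sqrt_nonneg _)) hreg 2
    rw [mul_pow, Real.sq_sqrt (by positivity)] at h2
    refine le_of_mul_le_mul_left ?_ hn'
    calc _ = c₁ ^ 2 * (n * (m : ℝ) ^ (β / (β + 1)) * logNM n m) := by ring
      _ ≤ (n * ρ) ^ 2 := h2
      _ = _ := by ring
  have h3 : logNM n m / (ρ ^ 2 * n * m) ≤ (1 / c₁ ^ 2) * (m : ℝ) ^ (-((2 * β + 1) / (β + 1))) := by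
    have he : (m : ℝ) ^ (-((2 * β + 1) / (β + 1))) = ((m : ℝ) ^ (β / (β + 1)) * m)⁻¹ := by
      rw [Real.rpow_neg hm'.le]
      congr 1
      nth_rw 3 [← Real.rpow_one (m : ℝ)]
      rw [← Real.rpow_add hm']
      congr 1
      field_simp
      ring
    rw [he, div_le_iff₀ (by positivity)]
    have hp : (0 : ℝ) < (m : ℝ) ^ (β / (β + 1)) := by positivity
    calc logNM n m = (1 / c₁ ^ 2) * ((m : ℝ) ^ (β / (β + 1)) * m)⁻¹
          * ((c₁ ^ 2 * ((m : ℝ) ^ (β / (β + 1)) * logNM n m)) * m) := by field_simp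
      _ ≤ (1 / c₁ ^ 2) * ((m : ℝ) ^ (β / (β + 1)) * m)⁻¹ * ((n * ρ ^ 2) * m) := by gcongr
      _ = _ := by ring
  have h4 : h1Dense β ρ n m ^ (β + 1)
      = (logNM n m / (ρ ^ 2 * n * m)) ^ ((β + 1) / (2 * β + 1)) := by
    rw [h1Dense, ← Real.rpow_mul (by positivity)]
    congr 1
    ring
  rw [h4]
  calc m * (logNM n m / (ρ ^ 2 * n * m)) ^ ((β + 1) / (2 * β + 1))
      ≤ m * ((1 / c₁ ^ 2) * (m : ℝ) ^ (-((2 * β + 1) / (β + 1)))) ^ ((β + 1) / (2 * β + 1)) := by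
        gcongr
    _ = m * ((1 / c₁ ^ 2) ^ ((β + 1) / (2 * β + 1)) * (m : ℝ) ^ (-1 : ℝ)) := by
        rw [Real.mul_rpow (by positivity) (by positivity), ← Real.rpow_mul hm'.le]
        congr 3
        field_simp
    _ = (1 / c₁ ^ 2) ^ ((β + 1) / (2 * β + 1)) := by
        rw [Real.rpow_neg_one]
        field_simp

theorem h1Sparse_pos (hρ : 0 < ρ) (hm : 0 < m) (hL : 0 < logNM n m) :
    0 < h1Sparse β ρ n m := by
  unfold h1Sparse; positivity

theorem h1Sparse_rpow (hβ : 0 < β) (hρ : 0 < ρ) (hm : 0 < m) (hL : 0 < logNM n m) :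
    ρ * m * h1Sparse β ρ n m ^ (2 * β + 1) = logNM n m := by
  have h1 : (1 / (2 * β + 1)) * (2 * β + 1) = 1 := by field_simp
  rw [h1Sparse, ← Real.rpow_mul (by positivity), h1, Real.rpow_one]
  field_simp

theorem h1Sparse_eq_mul (hρ : 0 < ρ) (hL : 0 < logNM n m) (e : ℝ) :
    (logNM n m / (ρ * m)) ^ e = ρ ^ (-e) * (logNM n m / m) ^ e := by
  have h1 : logNM n m / (ρ * m) = ρ⁻¹ * (logNM n m / m) := by
    field_simp
  rw [h1, Real.mul_rpow (by positivity) (by positivity), Real.inv_rpow hρ.le, Real.rpow_neg hρ.le]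

/-- Bandwidth h² gives stage three a bias of order ρh^(2β), which is at most of the order ρh^β of
the stage one error while h stays bounded. -/
theorem h3Sparse_eq (hρ : 0 < ρ) (hL : 0 < logNM n m) :
    h3Sparse β ρ n m = h1Sparse β ρ n m ^ 2 := by
  rw [h1Sparse, ← Real.rpow_two, ← Real.rpow_mul (by positivity), h1Sparse_eq_mul hρ hL, h3Sparse]
  congr 2 <;> ring

theorem rateSparse_eq (hβ : 0 < β) (hρ : 0 < ρ) (hL : 0 < logNM n m) :
    rateSparse β ρ n m = ρ ^ 2 * (h1Sparse β ρ n m ^ β) ^ 2 := by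
  have h1 : (h1Sparse β ρ n m ^ β) ^ 2 = (logNM n m / (ρ * m)) ^ (2 * β / (2 * β + 1)) := by
    rw [h1Sparse, ← Real.rpow_two, ← Real.rpow_mul (by positivity),
      ← Real.rpow_mul (by positivity)]
    congr 1
    ring
  rw [h1, h1Sparse_eq_mul hρ hL, rateSparse, ← mul_assoc]
  congr 1
  rw [← Real.rpow_two, ← Real.rpow_add hρ]
  congr 1
  field_simp
  ring

theorem one_le_logNM {n m : ℕ} (hn : 3 ≤ n) (hm : 1 ≤ m) : 1 ≤ logNM n m := by
  have h1 : (3 : ℝ) ≤ n * m := by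
    exact_mod_cast hn.trans (Nat.le_mul_of_pos_right n hm)
  rw [logNM, Real.le_log_iff_exp_le (by linarith)]
  linarith [Real.exp_one_lt_three]

/-- The deviation level 4 log(nm) leaves a multiple of 1/(nm) or less after a union bound over m
times and n² pairs. -/
theorem exp_neg_four_logNM {n m : ℕ} (hn : 0 < n) (hm : 0 < m) :
    Real.exp (-(4 * logNM n m)) = 1 / ((n : ℝ) * m) ^ 4 := by
  have h : (0 : ℝ) < (n : ℝ) * m := by positivity
  rw [Real.exp_neg, one_div, logNM, mul_comm, Real.exp_mul, Real.exp_log h]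
  norm_cast

end Rates

/-! ### Stage one: mean and noise -/

section StageOne

variable {n m : ℕ} {f : ℝ → ℝ → ℝ → ℝ} {ρ : ℝ} {t : Fin m → ℝ}

/-- The mean of the time-smoothed adjacency matrix. -/
def meanMatrix (f : ℝ → ℝ → ℝ → ℝ) (ρ : ℝ) (t : Fin m → ℝ) (w : Fin m → ℝ) (x : Fin n → I) :
    Matrix (Fin n) (Fin n) ℝ :=
  ∑ k, w k • probMatrix f ρ x (t k)

/-- The noise of the time-smoothed adjacency matrix. -/
noncomputable def noiseMatrix (f : ℝ → ℝ → ℝ → ℝ) (ρ : ℝ) (t : Fin m → ℝ) (w : Fin m → ℝ)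
    (x : Fin n → I) (a : Pairs n → Fin m → Bool) : Matrix (Fin n) (Fin n) ℝ :=
  Matrix.of fun i j => edgeNoise w (edgeProb f ρ t x) (pair i j) a

theorem meanMatrix_apply (w : Fin m → ℝ) (x : Fin n → I) (i j : Fin n) :
    meanMatrix f ρ t w x i j = ∑ k, w k * probMatrix f ρ x (t k) i j := by
  simp [meanMatrix, Matrix.sum_apply]

theorem abs_meanMatrix_le (hf : IsGraphon f) (hρ : 0 ≤ ρ) (ht : ∀ k, t k ∈ Icc (0 : ℝ) 1)
    {w : Fin m → ℝ} {W : ℝ} (hw : ∑ k, |w k| ≤ W) (x : Fin n → I) (i j : Fin n) :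
    |meanMatrix f ρ t w x i j| ≤ ρ * W := by
  rw [meanMatrix_apply]
  calc |∑ k, w k * probMatrix f ρ x (t k) i j| ≤ ∑ k, |w k * probMatrix f ρ x (t k) i j| :=
        Finset.abs_sum_le_sum_abs _ _
    _ ≤ ∑ k, |w k| * ρ := by
        refine Finset.sum_le_sum fun k _ => ?_
        obtain ⟨h1, h2⟩ := probMatrix_mem hf hρ x (ht k) i j
        rw [abs_mul, abs_of_nonneg h1]
        gcongr
    _ = ρ * ∑ k, |w k| := by rw [← Finset.sum_mul, mul_comm]
    _ ≤ ρ * W := by gcongr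

theorem abs_smoothed_probMatrix_sub_le {β L₁ W h s : ℝ} (hρ : 0 ≤ ρ)
    (hH : HolderGraphon β L₁ f) {w : Fin m → ℝ} (hw : WeightBounds β L₁ W t w h s)
    (x : Fin n → I) (i j : Fin n) :
    |∑ k, w k * probMatrix f ρ x (t k) i j - probMatrix f ρ x s i j| ≤ ρ * (W * h ^ β) := by
  have h1 := hw.bias _ (hH _ (x i).2 _ (x j).2)
  have h2 : ∑ k, w k * probMatrix f ρ x (t k) i j - probMatrix f ρ x s i j
      = ρ * (∑ k, w k * f (x i) (x j) (t k) - f (x i) (x j) s) := by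
    rw [mul_sub, Finset.mul_sum]
    simp only [probMatrix, Matrix.of_apply]
    congr 1
    exact Finset.sum_congr rfl fun k _ => by ring
  rw [h2, abs_mul, abs_of_nonneg hρ]
  gcongr

theorem IsGraphonSample.stageOne_eq {Ω : Type*} [MeasurableSpace Ω] {μ : Measure Ω}
    {ξ : Fin n → Ω → I} {A : Fin m → Ω → Matrix (Fin n) (Fin n) ℝ} (hf : IsGraphon f)
    (hρ : 0 ≤ ρ) (hρ1 : ρ ≤ 1) (ht : ∀ k, t k ∈ Icc (0 : ℝ) 1)
    (hS : IsGraphonSample μ f ρ t ξ A) (ω : Ω) (ℓ : ℕ) (K : ℝ → ℝ) (h s : ℝ) :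
    stageOne ℓ K t h (fun k => A k ω) s
      = meanMatrix f ρ t (weight ℓ K t h s) (fun i => ξ i ω)
        + noiseMatrix f ρ t (weight ℓ K t h s) (fun i => ξ i ω) (edgeArray fun k => A k ω) := by
  ext i j
  rw [Matrix.add_apply, meanMatrix_apply, stageOne, Matrix.sum_apply, noiseMatrix, Matrix.of_apply,
    edgeNoise, centredSum, ← Finset.sum_add_distrib]
  refine Finset.sum_congr rfl fun k _ => ?_
  rw [Matrix.smul_apply, hS.apply_eq ω k i j, edgeProb_pair hf hρ hρ1 ht, smul_eq_mul]
  ring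

theorem measurable_meanMatrix (hf : IsGraphon f) (ht : ∀ k, t k ∈ Icc (0 : ℝ) 1)
    (w : Fin m → ℝ) (i j : Fin n) :
    Measurable fun x : Fin n → I => meanMatrix f ρ t w x i j := by
  simp only [meanMatrix_apply]
  exact Finset.measurable_fun_sum _ fun k _ => (measurable_probMatrix hf (ht k) i j).const_mul _

theorem measurable_noiseMatrix (hf : IsGraphon f) (ht : ∀ k, t k ∈ Icc (0 : ℝ) 1)
    (w : Fin m → ℝ) (a : Pairs n → Fin m → Bool) (i j : Fin n) :
    Measurable fun x : Fin n → I => noiseMatrix f ρ t w x a i j := by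
  simp only [noiseMatrix, Matrix.of_apply, edgeNoise, centredSum]
  exact Finset.measurable_fun_sum _ fun k _ =>
    (measurable_const.sub (measurable_edgeProb hf ht _ k)).const_mul _

theorem edgeProb_le (hf : IsGraphon f) (hρ : 0 ≤ ρ) (hρ1 : ρ ≤ 1)
    (ht : ∀ k, t k ∈ Icc (0 : ℝ) 1) (x : Fin n → I) (e : Pairs n) (k : Fin m) :
    (edgeProb f ρ t x e k : ℝ) ≤ ρ := by
  rw [edgeProb_coe hf hρ hρ1 ht]
  exact (probMatrix_mem hf hρ x (ht k) _ _).2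

/-- Union bound over a time index and two node indices. -/
theorem measureReal_exists_le {α : Type*} [MeasurableSpace α] {P : Measure α}
    [IsProbabilityMeasure P] (B : Fin m → Fin n → Fin n → α → Prop) {ε : ℝ}
    (hB : ∀ k i l, P.real {a | B k i l a} ≤ ε) :
    P.real {a | ∃ k i l, B k i l a} ≤ m * (n * (n * ε)) := by
  have hu : {a | ∃ k i l, B k i l a} = ⋃ k, ⋃ i, ⋃ l, {a | B k i l a} := by
    ext a; simp
  rw [hu]
  calc _ ≤ ∑ k : Fin m, ∑ i : Fin n, ∑ l : Fin n, P.real {a | B k i l a} :=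
        (measureReal_iUnion_fintype_le _).trans (Finset.sum_le_sum fun k _ =>
          (measureReal_iUnion_fintype_le _).trans (Finset.sum_le_sum fun i _ =>
            measureReal_iUnion_fintype_le _))
    _ ≤ ∑ _k : Fin m, ∑ _i : Fin n, ∑ _l : Fin n, ε :=
        Finset.sum_le_sum fun k _ => Finset.sum_le_sum fun i _ => Finset.sum_le_sum fun l _ =>
          hB k i l
    _ = _ := by simp

variable {Ω : Type*} [MeasurableSpace Ω] {μ : Measure Ω} [IsProbabilityMeasure μ]
  {ξ : Fin n → Ω → I} {A : Fin m → Ω → Matrix (Fin n) (Fin n) ℝ}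

/-- Entrywise control of the noise of stage one. -/
theorem IsGraphonSample.measureReal_abs_noise (hf : IsGraphon f) (hρ : 0 ≤ ρ)
    (hρ1 : ρ ≤ 1) (ht : ∀ k, t k ∈ Icc (0 : ℝ) 1) (hS : IsGraphonSample μ f ρ t ξ A)
    (w : Fin m → Fin m → ℝ) {v θ : ℝ} (hv : ∀ k, ρ * ∑ k', w k k' ^ 2 ≤ v) (hθ : 0 < θ)
    (hw : ∀ k k', θ * |w k k'| ≤ 1) (T : ℝ) :
    μ.real {ω | ∃ k i l, θ * v + T / θ
      ≤ |noiseMatrix f ρ t (w k) (fun i => ξ i ω) (edgeArray fun k => A k ω) i l|}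
      ≤ m * (n * (n * (2 * Real.exp (-T)))) := by
  refine hS.measureReal_le hf hρ hρ1 ht (fun x a => ∃ k i l, θ * v + T / θ
      ≤ |noiseMatrix f ρ t (w k) x a i l|) (fun a => ?_) (fun x => ?_)
  · simp only [ofPred_exists]
    refine MeasurableSet.iUnion fun k => MeasurableSet.iUnion fun i => MeasurableSet.iUnion fun l =>
      measurableSet_le measurable_const ?_
    exact (measurable_noiseMatrix hf ht (w k) a i l).abs
  · refine measureReal_exists_le _ fun k i l => ?_
    refine (measureReal_mono fun a ha => ?_).trans (measureReal_abs_edgeNoise_ge_le (w k)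
      (edgeProb f ρ t x) (edgeProb_le hf hρ hρ1 ht x) hθ (hw k) T (pair i l))
    rw [mem_ofPred_eq] at ha ⊢
    refine le_trans ?_ ha
    have := hv k
    gcongr

/-- Joint control of the squared row norms of the noise of stage one, of its inner products with
the rows of the mean, and of the inner products of distinct noise rows. -/
theorem IsGraphonSample.measureReal_noise_products (hf : IsGraphon f) (hρ : 0 ≤ ρ)
    (hρ1 : ρ ≤ 1) (ht : ∀ k, t k ∈ Icc (0 : ℝ) 1) (hS : IsGraphonSample μ f ρ t ξ A)
    (w : Fin m → Fin m → ℝ) {v θ W : ℝ} (hv : ∀ k, ρ * ∑ k', w k k' ^ 2 ≤ v) (hθ : 0 < θ)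
    (hW0 : 0 < W) (hW : ∀ k, ∑ k', |w k k'| ≤ W) (hθW : θ * W ^ 2 ≤ 1) (T : ℝ) :
    μ.real {ω | ∃ k i l,
      let M := meanMatrix f ρ t (w k) (fun i => ξ i ω)
      let Z := noiseMatrix f ρ t (w k) (fun i => ξ i ω) (edgeArray fun k => A k ω)
      2 * n * v + W ^ 2 * T < ∑ j, Z i j ^ 2 ∨
      θ * (n * ((ρ * W) ^ 2 * v)) + T / θ < |M l ⬝ᵥ Z i| ∨
      (i ≠ l ∧ θ * (n * v ^ 2) + T / θ + 2 * W ^ 2 < |Z i ⬝ᵥ Z l|)}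
      ≤ m * (n * (n * (5 * Real.exp (-T)))) := by
  refine hS.measureReal_le hf hρ hρ1 ht (fun x a => ∃ k i l,
      let M := meanMatrix f ρ t (w k) x
      let Z := noiseMatrix f ρ t (w k) x a
      2 * n * v + W ^ 2 * T < ∑ j, Z i j ^ 2 ∨
      θ * (n * ((ρ * W) ^ 2 * v)) + T / θ < |M l ⬝ᵥ Z i| ∨
      (i ≠ l ∧ θ * (n * v ^ 2) + T / θ + 2 * W ^ 2 < |Z i ⬝ᵥ Z l|)) (fun a => ?_) (fun x => ?_)
  · simp only [ofPred_exists]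
    refine MeasurableSet.iUnion fun k => MeasurableSet.iUnion fun i => 
      MeasurableSet.iUnion fun l => ?_
    have hZ := fun i j => measurable_noiseMatrix (ρ := ρ) hf ht (w k) a i j
    have hM := fun i j => measurable_meanMatrix (ρ := ρ) (n := n) hf ht (w k) i j
    simp only [ofPred_or, ofPred_and]
    refine (measurableSet_lt measurable_const (Finset.measurable_fun_sum _ fun j _ =>
      (hZ i j).pow_const 2)).union ((measurableSet_lt measurable_const ?_).union
      ((MeasurableSet.const _).inter (measurableSet_lt measurable_const ?_)))
    · exact Measurable.abs (Finset.measurable_fun_sum _ fun j _ => (hM l j).mul (hZ i j))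
    · exact Measurable.abs (Finset.measurable_fun_sum _ fun j _ => (hZ i j).mul (hZ l j))
  · refine measureReal_exists_le _ fun k i l => ?_
    have hF := centredFamily_edgeNoise (w k) (edgeProb f ρ t x) (edgeProb_le hf hρ hρ1 ht x)
      (hW k) (hv k)
    set P := edgeLaw (edgeProb f ρ t x)
    have hv0 : 0 ≤ v := (mul_nonneg hρ (Finset.sum_nonneg fun _ _ => sq_nonneg _)).trans (hv k)
    -- The edges from a fixed i to varying j are distinct, so a single noise row is an independent
    -- family.
    have hFi : CentredFamily P (fun j => edgeNoise (w k) (edgeProb f ρ t x) (pair i j)) W v :=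
      ⟨hF.indep.precomp (pair_injective i), fun _ => hF.measurable _, fun _ => hF.abs_le _,
        fun _ => hF.integral_eq_zero _, fun _ => hF.integral_sq_le _⟩
    have e1 := hFi.measureReal_sum_sq_ge_le hW0 Finset.univ T
    have e2 := hFi.measureReal_abs_sum_mul_ge_le Finset.univ
      (c := fun j => meanMatrix f ρ t (w k) x l j) (b := ρ * W) hθ
      (fun j => abs_meanMatrix_le hf hρ ht (hW k) x l j) (by
        calc θ * (ρ * W * W) = ρ * (θ * W ^ 2) := by ring
          _ ≤ 1 * 1 := by gcongr
          _ = 1 := one_mul 1) T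
    rw [Finset.card_univ, Fintype.card_fin] at e1 e2
    set Z := fun a => noiseMatrix f ρ t (w k) x a with hZ
    have e3 : P.real {a | i ≠ l ∧ θ * (n * v ^ 2) + T / θ + 2 * W ^ 2 < |Z a i ⬝ᵥ Z a l|}
        ≤ 2 * Real.exp (-T) := by
      by_cases hil : i = l
      · simp [hil, (Real.exp_pos _).le]
      -- The terms j = i and j = l of Z_i·Z_l both contain the edge {i, l}; the remaining terms use
      -- disjoint pairs of edges. The two exceptions are at most W² each, whence `2 * W ^ 2`.
      set s : Finset (Fin n) := (Finset.univ.erase i).erase l with hs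
      have hmem : ∀ j ∈ s, j ≠ i ∧ j ≠ l := fun j hj => by
        simp only [hs, Finset.mem_erase, Finset.mem_univ, and_true] at hj
        exact ⟨hj.2, hj.1⟩
      have h1 := hF.measureReal_abs_sum_mul_mul_ge_le s (fun j => pair i j) (fun j => pair l j)
        (fun j hj => by
          have := hmem j hj
          rw [Ne, pair_eq_pair_iff]
          grind)
        (fun j hj j' hj' hne => by
          have h1 := hmem j hj
          have h2 := hmem j' hj'
          simp only [Ne, pair_eq_pair_iff]
          grind) hθ hW0.le hθW T
      refine (measureReal_mono fun a ha => ?_).trans h1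
      have ha' := ha.2
      simp only [mem_ofPred_eq]
      have hsplit : Z a i ⬝ᵥ Z a l = ∑ j ∈ s, Z a i j * Z a l j + Z a i l * Z a l l
          + Z a i i * Z a l i := by
        rw [dotProduct, ← Finset.sum_erase_add _ _ (Finset.mem_univ i),
          ← Finset.sum_erase_add (Finset.univ.erase i) _ (a := l) (by simp [Ne.symm hil])]
      have hb : ∀ i j, |Z a i j| ≤ W := fun i j => hF.abs_le _ _
      have hbb : ∀ i j i' j', |Z a i j * Z a i' j'| ≤ W ^ 2 := fun i j i' j' => by
        rw [abs_mul, sq]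
        exact mul_le_mul (hb _ _) (hb _ _) (abs_nonneg _) hW0.le
      have htri := (abs_add_le (∑ j ∈ s, Z a i j * Z a l j + Z a i l * Z a l l)
        (Z a i i * Z a l i)).trans (add_le_add (abs_add_le _ _) le_rfl)
      rw [← hsplit] at htri
      have hcard : (s.card : ℝ) ≤ n := by
        exact_mod_cast (Finset.card_le_univ s).trans_eq (Fintype.card_fin n)
      have hmono : θ * (s.card * v ^ 2) ≤ θ * (n * v ^ 2) := by gcongr
      have := hbb i l l l
      have := hbb i i l i
      have hgoal : θ * (s.card * v ^ 2) + T / θ ≤ |∑ j ∈ s, Z a i j * Z a l j| := by linarith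
      exact hgoal
    have hsub : {a | 2 * n * v + W ^ 2 * T < ∑ j, Z a i j ^ 2 ∨
        θ * (n * ((ρ * W) ^ 2 * v)) + T / θ < |meanMatrix f ρ t (w k) x l ⬝ᵥ Z a i| ∨
        (i ≠ l ∧ θ * (n * v ^ 2) + T / θ + 2 * W ^ 2 < |Z a i ⬝ᵥ Z a l|)}
        ⊆ {a | 2 * n * v + W ^ 2 * T
            ≤ ∑ j, edgeNoise (w k) (edgeProb f ρ t x) (pair i j) a ^ 2} ∪
          ({a | θ * (n * ((ρ * W) ^ 2 * v)) + T / θ ≤ |∑ j, meanMatrix f ρ t (w k) x l j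
              * edgeNoise (w k) (edgeProb f ρ t x) (pair i j) a|} ∪
            {a | i ≠ l ∧ θ * (n * v ^ 2) + T / θ + 2 * W ^ 2 < |Z a i ⬝ᵥ Z a l|}) := by
      intro a ha
      rcases ha with h | h | h
      · exact Or.inl h.le
      · exact Or.inr (Or.inl h.le)
      · exact Or.inr (Or.inr h)
    calc _ ≤ _ := measureReal_mono hsub
      _ ≤ _ := (measureReal_union_le _ _).trans (add_le_add le_rfl (measureReal_union_le _ _))
      _ ≤ Real.exp (-T) + (2 * Real.exp (-T) + 2 * Real.exp (-T)) :=
          add_le_add e1 (add_le_add e2 e3)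
      _ = 5 * Real.exp (-T) := by ring

end StageOne

/-! ### Reduction to the row errors of stage two at the observation times -/

section Reduction

variable {n m : ℕ} {f : ℝ → ℝ → ℝ → ℝ} {ρ : ℝ} {t : Fin m → ℝ} {β L₁ W : ℝ}

/-- The hypothesis `hA` concerns only the observation times while `s` is free: no continuity or net
argument in s is needed. -/
theorem stageThree_error_le (hρ : 0 ≤ ρ) (hH : HolderGraphon β L₁ f) {K : ℝ → ℝ} {ℓ : ℕ}
    {h₁ h₂ h₃ : ℝ} {s : ℝ} (hw : WeightBounds β L₁ W t (weight ℓ K t h₃ s) h₃ s)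
    (A : Fin m → Matrix (Fin n) (Fin n) ℝ) (x : Fin n → I) {X r : ℝ} (hX : 0 ≤ X) (hr : 0 ≤ r)
    (hA : ∀ k i, ∑ j, (stageTwo ℓ K t h₁ h₂ A (t k) i j - probMatrix f ρ x (t k) i j) ^ 2 ≤ X)
    (hXr : 2 * (W ^ 2 * X) + 2 * (n * (ρ * (W * h₃ ^ β)) ^ 2) ≤ n * r) :
    (1 / (n : ℝ)) * twoInftyNorm (stageThree ℓ K t h₁ h₂ h₃ A s - probMatrix f ρ x s) ^ 2 ≤ r := by
  refine twoInftyNorm_sq_le hr fun i => ?_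
  have h1 := sum_sq_weighted_sub_le (weight ℓ K t h₃ s) hw.sum_abs
    (fun k j => stageTwo ℓ K t h₁ h₂ A (t k) i j - probMatrix f ρ x (t k) i j)
    (fun j => ∑ k, weight ℓ K t h₃ s k * probMatrix f ρ x (t k) i j - probMatrix f ρ x s i j)
    hX (fun k => hA k i) (fun j => abs_smoothed_probMatrix_sub_le hρ hH hw x i j)
  refine le_trans (le_of_eq ?_) (h1.trans hXr)
  refine Finset.sum_congr rfl fun j _ => ?_
  congr 1
  rw [Matrix.sub_apply, stageThree, Matrix.sum_apply]
  simp only [Matrix.smul_apply, smul_eq_mul, mul_sub, Finset.sum_sub_distrib]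
  ring

theorem abs_meanMatrix_sub_le (hρ : 0 ≤ ρ) (hH : HolderGraphon β L₁ f) {w : Fin m → ℝ} {h s : ℝ}
    (hw : WeightBounds β L₁ W t w h s) (x : Fin n → I) (i j : Fin n) :
    |meanMatrix f ρ t w x i j - probMatrix f ρ x s i j| ≤ ρ * (W * h ^ β) := by
  rw [meanMatrix_apply]
  exact abs_smoothed_probMatrix_sub_le hρ hH hw x i j

theorem rpow_two_mul_add_one {h : ℝ} (hh : 0 < h) (β : ℝ) :
    h ^ (2 * β + 1) = h ^ β * h ^ β * h := by
  rw [← Real.rpow_add hh, Real.rpow_add_one hh.ne', two_mul]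

/-- Only monotonicity of the outer measure is used, so the uncountable intersection over s needs no
measurability proof. -/
theorem measure_compl_le_of_real {Ω : Type*} [MeasurableSpace Ω] {μ : Measure Ω}
    [IsFiniteMeasure μ] {S B : Set Ω} (hSB : Sᶜ ⊆ B) {ε : ℝ} (hB : μ.real B ≤ ε) :
    μ Sᶜ ≤ ENNReal.ofReal ε := by
  refine (measure_mono hSB).trans ?_
  rw [← ofReal_measureReal (s := B)]
  exact ENNReal.ofReal_le_ofReal hB

end Reduction

/-! ### The sparse regime -/

/-- As h₂n ≤ 1, stage two is the identity, and entrywise bounds on bias and noise of order ρy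
suffice. Allowing every C' ≥ C lets both regimes share one constant. -/
theorem exists_sparse_bound {f : ℝ → ℝ → ℝ → ℝ} (hf : IsGraphon f) {β L₁ : ℝ} (hβ : 0 < β)
    (hL₁ : 0 < L₁) (hH : HolderGraphon β L₁ f) {K : ℝ → ℝ} (hK : KernelCondition K)
    {lam a₀ : ℝ} (hlam : 0 < lam) (ha₀ : 0 < a₀) {b₁ b₂ : ℝ} (hb₁ : 0 < b₁) (hb : b₁ ≤ b₂) :
    ∃ C : ℝ, 0 < C ∧ ∀ n m : ℕ, 3 ≤ n → 1 ≤ m → ∀ ρ : ℝ, 0 < ρ → ρ < 1 →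
      ∀ t : Fin m → ℝ, (∀ k, t k ∈ Icc (0 : ℝ) 1) → DesignCondition t a₀ →
      ∀ h₁ h₂ : ℝ, EigenvalueCondition ⌊β⌋₊ K t lam h₁ →
      ∀ (Ω : Type*) [MeasurableSpace Ω] (μ : Measure Ω) [IsProbabilityMeasure μ]
        (ξ : Fin n → Ω → I) (A : Fin m → Ω → Matrix (Fin n) (Fin n) ℝ),
        IsGraphonSample μ f ρ t ξ A →
        b₁ * h1Sparse β ρ n m ≤ h₁ → h₁ ≤ b₂ * h1Sparse β ρ n m → h₂ ≤ 1 / n →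
        EigenvalueCondition ⌊β⌋₊ K t lam (h3Sparse β ρ n m) →
        ∀ C' : ℝ, C ≤ C' →
        μ ((uniformErrorLE f ρ ⌊β⌋₊ K t h₁ h₂ (h3Sparse β ρ n m) ξ A
            (C' * rateSparse β ρ n m))ᶜ) ≤ ENNReal.ofReal (2 / ((n : ℝ) * m)) := by
  obtain ⟨W, hW1, hW⟩ := exists_weightBounds hβ hL₁ hK hlam ha₀
  have hW0 : 0 < W := by linarith
  have hb₂ : 0 < b₂ := by linarith
  obtain ⟨V, hV⟩ : ∃ V, V = W / b₁ := ⟨_, rfl⟩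
  have hV0 : 0 < V := by rw [hV]; positivity
  obtain ⟨G, hG⟩ : ∃ G, G = V ^ β := ⟨_, rfl⟩
  have hG0 : 0 < G := by rw [hG]; positivity
  obtain ⟨D, hD⟩ : ∃ D, D = 1 / G + 4 * V * G + W * b₂ ^ β := ⟨_, rfl⟩
  have hD0 : 0 < D := by rw [hD]; positivity
  refine ⟨2 * W ^ 2 * D ^ 2 + 2 * W ^ 2 * G ^ 2, by positivity, ?_⟩
  intro n m hn hm ρ hρ hρ1 t ht hDes h₁ h₂ hE₁ Ω _ μ _ ξ A hS hh1 hh1' hh2 hE₃ C' hC'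
  have hn' : (0 : ℝ) < n := by exact_mod_cast (by omega : 0 < n)
  have hm' : (0 : ℝ) < m := by exact_mod_cast hm
  have hL1 := one_le_logNM hn hm
  have hL0 : 0 < logNM n m := by linarith
  have hexp := exp_neg_four_logNM (n := n) (m := m) (by omega) hm
  obtain ⟨L, hL⟩ : ∃ L, L = logNM n m := ⟨_, rfl⟩
  obtain ⟨h, hh⟩ : ∃ h, h = h1Sparse β ρ n m := ⟨_, rfl⟩
  have hh0 : 0 < h := by rw [hh]; exact h1Sparse_pos hρ hm hL0
  obtain ⟨y, hy⟩ : ∃ y, y = h ^ β := ⟨_, rfl⟩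
  have hy0 : 0 < y := by rw [hy]; positivity
  have hLeq : L = ρ * m * (y * y * h) := by
    rw [hL, hy, ← rpow_two_mul_add_one hh0, hh, h1Sparse_rpow hβ hρ hm hL0]
  rw [← hh] at hh1 hh1'
  rw [h3Sparse_eq hρ hL0, ← hh] at hE₃ ⊢
  rw [rateSparse_eq hβ hρ hL0, ← hh, ← hy]
  rw [← hL] at hL1 hL0 hexp
  have hh10 : 0 < h₁ := lt_of_lt_of_le (by positivity) hh1
  obtain ⟨-, hh1W, hw₁⟩ := hW m t ht hDes h₁ hh10 hE₁
  obtain ⟨-, -, hw₃⟩ := hW m t ht hDes (h ^ 2) (by positivity) hE₃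
  -- The bandwidth may exceed 1 here; b₁h ≤ h₁ ≤ W bounds it by V.
  have hyG : y ≤ G := by
    rw [hy, hG, hV]
    gcongr
    rw [le_div_iff₀ hb₁, mul_comm]
    exact hh1.trans hh1W
  have hmh : W / (m * h₁) ≤ V / (m * h) := by
    rw [hV, div_div]
    have : b₁ * ((m : ℝ) * h) ≤ m * h₁ := by
      calc b₁ * ((m : ℝ) * h) = m * (b₁ * h) := by ring
        _ ≤ _ := by gcongr
    gcongr
  set w : Fin m → Fin m → ℝ := fun k => weight ⌊β⌋₊ K t h₁ (t k) with hwdef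
  -- Since L = ρm·y²h, this choice makes both θρV/(mh) and 4L/θ multiples of ρy; the factor G gives
  -- θ|w| ≤ y/G ≤ 1.
  obtain ⟨θ, hθ⟩ : ∃ θ, θ = L / (V * G * ρ * y) := ⟨_, rfl⟩
  have hθ0 : 0 < θ := by rw [hθ]; positivity
  have hbad := hS.measureReal_abs_noise hf hρ.le hρ1.le ht w (v := ρ * (V / (m * h))) (θ := θ)
    (fun k => by
      have := ((hw₁ (t k) (ht k)).sum_sq).trans hmh
      gcongr) hθ0 (fun k k' => by
      have h1 := ((hw₁ (t k) (ht k)).abs_le k').trans hmh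
      calc θ * |w k k'| ≤ θ * (V / (m * h)) := by gcongr
        _ = y / G := by rw [hθ, hLeq]; field_simp
        _ ≤ 1 := by rwa [div_le_one hG0]) (4 * L)
  have hthr : θ * (ρ * (V / (m * h))) + 4 * L / θ = (1 / G + 4 * V * G) * (ρ * y) := by
    have h1 : θ * (ρ * (V / (m * h))) = 1 / G * (ρ * y) := by
      rw [hθ, hLeq]; field_simp
    have h2 : 4 * L / θ = 4 * V * G * (ρ * y) := by
      rw [hθ]; field_simp
    rw [h1, h2]; ring
  rw [hthr] at hbad
  refine measure_compl_le_of_real (B := {ω | ∃ k i l, (1 / G + 4 * V * G) * (ρ * y)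
      ≤ |noiseMatrix f ρ t (w k) (fun i => ξ i ω) (edgeArray fun k => A k ω) i l|}) ?_
    (hbad.trans ?_)
  · intro ω hω
    by_contra hgood
    simp only [mem_ofPred_eq, not_exists, not_le] at hgood
    refine hω fun s hs => ?_
    refine stageThree_error_le hρ.le hH (hw₃ s hs) (fun k => A k ω) (fun i => ξ i ω)
      (X := n * (D * (ρ * y)) ^ 2) (by positivity) (by
        have : 0 ≤ C' := le_trans (by positivity) hC'
        positivity) (fun k i => ?_) ?_
    · have hone : h₂ * n ≤ 1 := by rwa [le_div_iff₀ hn'] at hh2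
      rw [stageTwo, nbhd_of_le_one hone, hS.stageOne_eq hf hρ.le hρ1.le ht]
      calc _ ≤ ∑ _j : Fin n, (D * (ρ * y)) ^ 2 := by
            refine Finset.sum_le_sum fun j _ => ?_
            rw [← sq_abs]
            refine pow_le_pow_left₀ (abs_nonneg _) ?_ 2
            rw [Matrix.add_apply, add_sub_right_comm]
            have h1 := abs_meanMatrix_sub_le hρ.le hH (hw₁ (t k) (ht k)) (fun i => ξ i ω) i j
            have h2 := hgood k i j
            have h3 : ρ * (W * h₁ ^ β) ≤ W * b₂ ^ β * (ρ * y) := by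
              calc ρ * (W * h₁ ^ β) ≤ ρ * (W * (b₂ * h) ^ β) := by gcongr
                _ = W * b₂ ^ β * (ρ * y) := by
                  rw [Real.mul_rpow hb₂.le hh0.le, hy]; ring
            refine (abs_add_le _ _).trans ((add_le_add (h1.trans h3) h2.le).trans_eq ?_)
            rw [hD]; ring
        _ = _ := by simp
    · have h1 : (h ^ 2) ^ β = y * y := by
        rw [hy, ← Real.mul_rpow hh0.le hh0.le, sq]
      rw [h1]
      have h2 : y * y ≤ G * y := by gcongr
      calc 2 * (W ^ 2 * (n * (D * (ρ * y)) ^ 2)) + 2 * (n * (ρ * (W * (y * y))) ^ 2)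
          ≤ 2 * (W ^ 2 * (n * (D * (ρ * y)) ^ 2)) + 2 * (n * (ρ * (W * (G * y))) ^ 2) := by gcongr
        _ = n * ((2 * W ^ 2 * D ^ 2 + 2 * W ^ 2 * G ^ 2) * (ρ ^ 2 * y ^ 2)) := by ring
        _ ≤ _ := by gcongr
  · rw [hexp]
    have hn1 : (1 : ℝ) ≤ n := by exact_mod_cast (by omega : 1 ≤ n)
    have hm1 : (1 : ℝ) ≤ m := by exact_mod_cast hm
    have hcube : (n : ℝ) ≤ (n : ℝ) * (n * (m * m)) :=
      le_mul_of_one_le_right hn'.le (one_le_mul_of_one_le_of_one_le hn1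
        (one_le_mul_of_one_le_of_one_le hm1 hm1))
    rw [le_div_iff₀ (by positivity)]
    have h4 : (m : ℝ) * (n * (n * (2 * (1 / ((n : ℝ) * m) ^ 4)))) * (n * m)
        = 2 * (n / (n * (n * (m * m)))) := by field_simp
    rw [h4]
    have : (n : ℝ) / (n * (n * (m * m))) ≤ 1 := by rwa [div_le_one (by positivity)]
    linarith

/-! ### The dense regime -/

theorem abs_dotProduct_sub_dotProduct_le {n : ℕ} {a b c d : Fin n → ℝ} {ρ e : ℝ}
    (hc : ∀ j, |c j| ≤ ρ) (hd : ∀ j, |d j| ≤ ρ) (hac : ∀ j, |a j - c j| ≤ e)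
    (hbd : ∀ j, |b j - d j| ≤ e) : |a ⬝ᵥ b - c ⬝ᵥ d| ≤ n * (2 * (ρ * e) + e * e) := by
  have h1 : a ⬝ᵥ b - c ⬝ᵥ d = c ⬝ᵥ (b - d) + (a - c) ⬝ᵥ d + (a - c) ⬝ᵥ (b - d) := by
    simp only [dotProduct_sub, sub_dotProduct]; ring
  have e1 := abs_dotProduct_le_card_mul (v := b - d) hc hbd
  have e2 := abs_dotProduct_le_card_mul (u := a - c) hac hd
  have e3 := abs_dotProduct_le_card_mul (u := a - c) (v := b - d) hac hbd
  rw [h1]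
  refine (abs_add_le _ _).trans ((add_le_add (abs_add_le _ _) le_rfl).trans ?_)
  linarith

/-- A mesh size `q` comparable to `1 / z`. -/
theorem exists_nat_inv_comparable {z : ℝ} (hz : 0 < z) (hz1 : z ≤ 1) :
    ∃ q : ℕ, 0 < q ∧ (q : ℝ) * z ≤ 1 ∧ z ≤ 1 / q ∧ 1 / (q : ℝ) ≤ 2 * z := by
  have h1 : 1 ≤ 1 / z := by rwa [le_div_iff₀ hz, one_mul]
  have hq : 0 < ⌊1 / z⌋₊ := Nat.floor_pos.2 h1
  have hq' : (1 : ℝ) ≤ ⌊1 / z⌋₊ := by exact_mod_cast hq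
  have h2 : (⌊1 / z⌋₊ : ℝ) * z ≤ 1 := by
    have := Nat.floor_le (zero_le_one.trans h1)
    rwa [le_div_iff₀ hz] at this
  refine ⟨⌊1 / z⌋₊, hq, h2, ?_, ?_⟩
  · rw [le_div_iff₀ (by linarith), mul_comm]; exact h2
  · have := Nat.lt_floor_add_one (1 / z)
    rw [div_lt_iff₀ hz] at this
    rw [div_le_iff₀ (by linarith)]
    nlinarith

/-- Makes the mesh E y at most 1 once m is large: raise E h^β to the power (β+1)/β and compare with
m h^(β+1) ≤ C₀. -/
theorem mul_rpow_le_one_of_large {β C₀ E h m : ℝ} (hβ : 0 < β) (hE : 0 < E)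
    (hh : 0 < h) (hm : 0 < m) (hmh : m * h ^ (β + 1) ≤ C₀) (hlarge : C₀ * E ^ ((β + 1) / β) ≤ m) :
    E * h ^ β ≤ 1 := by
  by_contra hcon
  rw [not_le] at hcon
  have h1 : 1 < (E * h ^ β) ^ ((β + 1) / β) := Real.one_lt_rpow hcon (by positivity)
  rw [Real.mul_rpow hE.le (by positivity), ← Real.rpow_mul hh.le,
    mul_div_cancel₀ _ hβ.ne'] at h1
  have h2 : 0 < E ^ ((β + 1) / β) := by positivity
  have h3 : m * 1 < m * (E ^ ((β + 1) / β) * h ^ (β + 1)) := by gcongr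
  have h4 : (m * h ^ (β + 1)) * E ^ ((β + 1) / β) ≤ C₀ * E ^ ((β + 1) / β) := by gcongr
  linarith

theorem failure_probability_le {n m a : ℝ} (hn : 3 ≤ n) (hm : 3 ≤ m) (ha : a ≤ m * n) :
    m * (n * (n * (5 * (1 / (n * m) ^ 4)))) + a * (1 / (n * m) ^ 4) ≤ 2 / (n * m) := by
  have hn' : 0 < n := by linarith
  have hm' : 0 < m := by linarith
  obtain ⟨N, hN⟩ : ∃ N : ℝ, N = n * m := ⟨_, rfl⟩
  have hN9 : 9 ≤ N := by rw [hN]; nlinarith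
  have h5 : m * (n * n) ≤ N ^ 2 := by
    rw [hN]; nlinarith [mul_pos hn' hm', mul_pos (mul_pos hn' hm') hn']
  have hN0 : 0 < N := by linarith
  rw [← hN]
  calc m * (n * (n * (5 * (1 / N ^ 4)))) + a * (1 / N ^ 4)
      = (5 * (m * (n * n)) + a) * (1 / N ^ 4) := by ring
    _ ≤ (5 * N ^ 2 + N ^ 2) * (1 / N ^ 4) := by
        gcongr
        calc a ≤ m * n := ha
          _ = N := by rw [hN]; ring
          _ ≤ N ^ 2 := by nlinarith
    _ = 6 / N ^ 2 := by field_simp; ring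
    _ ≤ 2 / N := by
        rw [div_le_div_iff₀ (by positivity) hN0]
        nlinarith

set_option maxHeartbeats 800000 in
-- All inputs of `sum_sq_nbhdSmooth_sub_le` are checked with X = B R, where R = nρ²y. The random
-- events are the noise products and the occupation of the grid cells.
theorem exists_dense_bound {f : ℝ → ℝ → ℝ → ℝ} (hf : IsGraphon f) {β L₁ L₂ : ℝ} (hβ : 0 < β)
    (hL₁ : 0 < L₁) (hH : HolderGraphon β L₁ f) (hLip : PiecewiseLipschitz L₂ f) {K : ℝ → ℝ}
    (hK : KernelCondition K) {lam a₀ : ℝ} (hlam : 0 < lam) (ha₀ : 0 < a₀) {b₁ b₂ c₁ : ℝ}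
    (hb₁ : 0 < b₁) (hb : b₁ ≤ b₂) (hc₁ : 0 < c₁) :
    ∃ C : ℝ, 0 < C ∧ ∃ N₀ : ℕ, ∀ n m : ℕ, N₀ ≤ n → N₀ ≤ m → ∀ ρ : ℝ, 0 < ρ → ρ < 1 →
      Real.sqrt (logNM n m / (n * m)) ≤ ρ →
      ∀ t : Fin m → ℝ, (∀ k, t k ∈ Icc (0 : ℝ) 1) → DesignCondition t a₀ →
      ∀ h₁ h₂ : ℝ, EigenvalueCondition ⌊β⌋₊ K t lam h₁ →
      ∀ (Ω : Type*) [MeasurableSpace Ω] (μ : Measure Ω) [IsProbabilityMeasure μ]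
        (ξ : Fin n → Ω → I) (A : Fin m → Ω → Matrix (Fin n) (Fin n) ℝ),
        IsGraphonSample μ f ρ t ξ A → c₁ * boundary β n m ≤ n * ρ →
        b₁ * h1Dense β ρ n m ≤ h₁ → h₁ ≤ b₂ * h1Dense β ρ n m →
        b₁ * h2Dense β ρ n m ≤ h₂ → h₂ ≤ b₂ * h2Dense β ρ n m →
        EigenvalueCondition ⌊β⌋₊ K t lam (h3Dense β ρ n m) →
        ∀ C' : ℝ, C ≤ C' →
        μ ((uniformErrorLE f ρ ⌊β⌋₊ K t h₁ h₂ (h3Dense β ρ n m) ξ A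
            (C' * rateDense β ρ n m))ᶜ) ≤ ENNReal.ofReal (2 / ((n : ℝ) * m)) := by
  obtain ⟨W, hW1, hW⟩ := exists_weightBounds hβ hL₁ hK hlam ha₀
  obtain ⟨δ, hδ, J, hgrid⟩ := hLip.exists_grid
  have hW0 : 0 < W := by linarith
  have hb₂ : 0 < b₂ := by linarith
  obtain ⟨V, hV⟩ : ∃ V, V = W / b₁ := ⟨_, rfl⟩
  have hV0 : 0 < V := by rw [hV]; positivity
  obtain ⟨C₀, hC₀⟩ : ∃ C₀, C₀ = (1 / c₁ ^ 2) ^ ((β + 1) / (2 * β + 1)) := ⟨_, rfl⟩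
  have hC₀0 : 0 < C₀ := by rw [hC₀]; positivity
  -- Mesh constant: a cell has length at least δE y; the part 32C₀ pays for the Chernoff bound and
  -- 4b₂ for the quantile level.
  obtain ⟨E, hE⟩ : ∃ E, E = (32 * C₀ + 4 * b₂) / δ := ⟨_, rfl⟩
  have hE0 : 0 < E := by rw [hE]; positivity
  have hδE : δ * E = 32 * C₀ + 4 * b₂ := by rw [hE]; field_simp
  obtain ⟨D, hD⟩ : ∃ D, D = W * b₂ ^ β := ⟨_, rfl⟩
  have hD0 : 0 < D := by rw [hD]; positivity
  -- Multiples of R for, in order: bias in inner products, mean-noise products, noise-noise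
  -- products, squared noise norms divided by h₂n, and variation within a cell.
  obtain ⟨B₁, hB₁⟩ : ∃ B₁, B₁ = 2 * D + D ^ 2 := ⟨_, rfl⟩
  obtain ⟨B₂, hB₂⟩ : ∃ B₂, B₂ = V / C₀ + 4 * W ^ 2 * C₀ := ⟨_, rfl⟩
  obtain ⟨B₃, hB₃⟩ : ∃ B₃, B₃ = 2 * b₂ * V ^ 2 / (W ^ 2 * C₀) + 6 * W ^ 2 * C₀ := ⟨_, rfl⟩
  obtain ⟨B₄, hB₄⟩ : ∃ B₄, B₄ = (2 * V + 4 * W ^ 2 * C₀ ^ 2) / b₁ := ⟨_, rfl⟩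
  obtain ⟨B₅, hB₅⟩ : ∃ B₅, B₅ = 2 * E * |L₂| := ⟨_, rfl⟩
  have hB₁0 : 0 < B₁ := by rw [hB₁]; positivity
  have hB₂0 : 0 < B₂ := by rw [hB₂]; positivity
  have hB₃0 : 0 < B₃ := by rw [hB₃]; positivity
  have hB₄0 : 0 < B₄ := by rw [hB₄]; positivity
  have hB₅0 : 0 ≤ B₅ := by rw [hB₅]; positivity
  obtain ⟨B, hB⟩ : ∃ B, B = B₁ + B₂ + B₃ + B₄ + B₅ := ⟨_, rfl⟩
  have hB0 : 0 < B := by rw [hB]; positivity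
  -- The first ceiling yields E y ≤ 1; the second bounds the number J q of cells by mn.
  refine ⟨2 * W ^ 2 * (117 * B) + 2 * W ^ 2, by positivity,
    3 + ⌈C₀ * E ^ ((β + 1) / β)⌉₊ + ⌈J * C₀ / E⌉₊, ?_⟩
  intro n m hn hm ρ hρ hρ1 hρN t ht hDes h₁ h₂ hE₁ Ω _ μ _ ξ A hS hreg hh1 hh1' hh2 hh2' hE₃ C' hC'
  have hn3 : 3 ≤ n := by omega
  have hm3 : 3 ≤ m := by omega
  have hn' : (0 : ℝ) < n := by exact_mod_cast (by omega : 0 < n)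
  have hm' : (0 : ℝ) < m := by exact_mod_cast (by omega : 0 < m)
  have hmlarge : C₀ * E ^ ((β + 1) / β) ≤ m :=
    (Nat.le_ceil _).trans (by exact_mod_cast (by omega : ⌈C₀ * E ^ ((β + 1) / β)⌉₊ ≤ m))
  have hJlarge : J * C₀ / E ≤ m :=
    (Nat.le_ceil _).trans (by exact_mod_cast (by omega : ⌈J * C₀ / E⌉₊ ≤ m))
  have hL1 := one_le_logNM hn3 (by omega : 1 ≤ m)
  have hL0 : 0 < logNM n m := by linarith
  have hexp := exp_neg_four_logNM (n := n) (m := m) (by omega) (by omega)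
  have hmC := mul_h1Dense_rpow_le hβ hρ (by omega) (by omega) hL0 hc₁ hreg
  obtain ⟨L, hL⟩ : ∃ L, L = logNM n m := ⟨_, rfl⟩
  obtain ⟨h, hh⟩ : ∃ h, h = h1Dense β ρ n m := ⟨_, rfl⟩
  have hh0 : 0 < h := by rw [hh]; exact h1Dense_pos hρ (by omega) (by omega) hL0
  have hhle : h ≤ 1 := by
    rw [hh]; exact h1Dense_le_one hβ hρ (by omega) (by omega) hL0 hρN
  obtain ⟨y, hy⟩ : ∃ y, y = h ^ β := ⟨_, rfl⟩
  have hy0 : 0 < y := by rw [hy]; positivity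
  have hy1 : y ≤ 1 := by rw [hy]; exact Real.rpow_le_one hh0.le hhle hβ.le
  have hLeq : L = ρ ^ 2 * n * m * (y * y * h) := by
    rw [hL, hy, ← rpow_two_mul_add_one hh0, hh, h1Dense_rpow hβ hρ (by omega) (by omega) hL0]
  rw [← hh, ← hC₀] at hmC
  have hEy : E * y ≤ 1 := by
    rw [hy]; exact mul_rpow_le_one_of_large hβ hE0 hh0 hm' hmC hmlarge
  have hmyh : m * (y * h) ≤ C₀ := by
    rwa [Real.rpow_add_one hh0.ne', ← hy] at hmC
  rw [← hh] at hh1 hh1'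
  rw [h3Dense_eq hρ, ← hh] at hE₃ ⊢
  rw [h2Dense_eq hβ hρ hL0, ← hh, ← hy] at hh2 hh2'
  rw [rateDense_eq hβ hρ hL0, ← hh, ← hy]
  rw [← hL] at hL1 hL0 hexp
  have hh10 : 0 < h₁ := lt_of_lt_of_le (by positivity) hh1
  obtain ⟨hmh1, -, hw₁⟩ := hW m t ht hDes h₁ hh10 hE₁
  obtain ⟨-, -, hw₃⟩ := hW m t ht hDes h hh0 hE₃
  have hmh : W / (m * h₁) ≤ V / (m * h) := by
    rw [hV, div_div]
    have : b₁ * ((m : ℝ) * h) ≤ m * h₁ := by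
      calc b₁ * ((m : ℝ) * h) = m * (b₁ * h) := by ring
        _ ≤ _ := by gcongr
    gcongr
  have hmh' : 1 / (m * h) ≤ 2 * b₂ := by
    rw [div_le_iff₀ (by positivity)]
    calc 1 ≤ 2 * (m * h₁) := hmh1
      _ ≤ 2 * (m * (b₂ * h)) := by gcongr
      _ = _ := by ring
  obtain ⟨R, hR⟩ : ∃ R, R = n * (ρ ^ 2 * y) := ⟨_, rfl⟩
  have hR0 : 0 < R := by rw [hR]; positivity
  -- The regime boundary enters here, through m·y·h ≤ C₀.
  have hLR : L ≤ C₀ * R := by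
    calc L = (m * (y * h)) * R := by rw [hLeq, hR]; ring
      _ ≤ C₀ * R := by gcongr
  have hR2 : n * ρ ^ 2 * L / (m * h) = R ^ 2 := by
    rw [hLeq, hR]; field_simp
  have hRny : R ≤ n * y := by
    rw [hR]
    have : ρ ^ 2 ≤ 1 := pow_le_one₀ hρ.le hρ1.le
    have : ρ ^ 2 * y ≤ 1 * y := by gcongr
    rw [one_mul] at this
    gcongr
  have hh20 : 0 < h₂ := lt_of_lt_of_le (by positivity) hh2
  obtain ⟨v, hv⟩ : ∃ v, v = ρ * (V / (m * h)) := ⟨_, rfl⟩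
  -- Here L ≤ C₀R gives θW² ≤ 1, while 4L/θ becomes a multiple of R.
  obtain ⟨θ, hθ⟩ : ∃ θ, θ = L / (W ^ 2 * C₀ * R) := ⟨_, rfl⟩
  have hθ0 : 0 < θ := by rw [hθ]; positivity
  have hθW : θ * W ^ 2 ≤ 1 := by
    calc θ * W ^ 2 = L / (C₀ * R) := by rw [hθ]; field_simp
      _ ≤ 1 := by rwa [div_le_one (by positivity)]
  have hLθ : 4 * L / θ = 4 * W ^ 2 * C₀ * R := by rw [hθ]; field_simp
  have hcross : θ * (n * ((ρ * W) ^ 2 * v)) + 4 * L / θ ≤ B₂ * R := by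
    have h1 : θ * (n * ((ρ * W) ^ 2 * v)) = V / C₀ * (ρ * R) := by
      calc θ * (n * ((ρ * W) ^ 2 * v)) = V / C₀ * ρ / R * (n * ρ ^ 2 * L / (m * h)) := by
            rw [hθ, hv]; field_simp
        _ = _ := by rw [hR2]; field_simp
    have h2 : ρ * R ≤ R := mul_le_of_le_one_left hR0.le hρ1.le
    rw [h1, hLθ, hB₂, add_mul]
    gcongr
  -- The surplus factor 1/(mh) is bounded by `hmh'`, and the constant 2W² is absorbed because 1 ≤ L
  -- ≤ C₀R.
  have hnoise : θ * (n * v ^ 2) + 4 * L / θ + 2 * W ^ 2 ≤ B₃ * R := by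
    have h1 : θ * (n * v ^ 2) = V ^ 2 / (W ^ 2 * C₀) * (1 / (m * h)) * R := by
      calc θ * (n * v ^ 2)
          = V ^ 2 / (W ^ 2 * C₀) * (1 / (m * h)) / R * (n * ρ ^ 2 * L / (m * h)) := by
            rw [hθ, hv]; field_simp
        _ = _ := by rw [hR2]; field_simp
    have h2 : V ^ 2 / (W ^ 2 * C₀) * (1 / (m * h)) * R ≤ V ^ 2 / (W ^ 2 * C₀) * (2 * b₂) * R := by
      gcongr
    have h3 : 2 * W ^ 2 * 1 ≤ 2 * W ^ 2 * (C₀ * R) := by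
      gcongr
      exact hL1.trans hLR
    rw [h1, hLθ, hB₃]
    calc _ ≤ V ^ 2 / (W ^ 2 * C₀) * (2 * b₂) * R + 4 * W ^ 2 * C₀ * R + 2 * W ^ 2 * (C₀ * R) := by
          linarith
      _ = _ := by ring
  -- The left side is O(R²/ρ), and R²/ρ = R·nρy with h₂ at least b₁ρy.
  have hdiag : 2 * n * v + W ^ 2 * (4 * L) ≤ B₄ * R * (h₂ * n) := by
    have h1 : 2 * n * v ≤ 2 * V * (R ^ 2 / ρ) := by
      calc 2 * n * v = 2 * V * ((n * ρ ^ 2 * L / (m * h)) / ρ) / L := by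
            rw [hv]; field_simp
        _ = 2 * V * (R ^ 2 / ρ) / L := by rw [hR2]
        _ ≤ 2 * V * (R ^ 2 / ρ) := div_le_self (by positivity) hL1
    have h2 : W ^ 2 * (4 * L) ≤ 4 * W ^ 2 * C₀ ^ 2 * (R ^ 2 / ρ) := by
      have h3 : L ≤ (C₀ * R) ^ 2 := by
        rw [sq]
        calc L ≤ C₀ * R := hLR
          _ ≤ C₀ * R * (C₀ * R) := le_mul_of_one_le_right (by positivity) (hL1.trans hLR)
      have h4 : R ^ 2 ≤ R ^ 2 / ρ := by
        rw [le_div_iff₀ hρ]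
        exact mul_le_of_le_one_right (by positivity) hρ1.le
      calc W ^ 2 * (4 * L) ≤ W ^ 2 * (4 * (C₀ * R) ^ 2) := by gcongr
        _ = 4 * W ^ 2 * C₀ ^ 2 * R ^ 2 := by ring
        _ ≤ _ := by gcongr
    calc 2 * n * v + W ^ 2 * (4 * L) ≤ (2 * V + 4 * W ^ 2 * C₀ ^ 2) * (R ^ 2 / ρ) := by linarith
      _ = B₄ * R * (b₁ * (ρ * y) * n) := by
          rw [hB₄, hR]; field_simp
      _ ≤ _ := by gcongr
  obtain ⟨q, hq0, hq1, hq2, hq3⟩ := exists_nat_inv_comparable (mul_pos hE0 hy0) hEy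
  have hq' : (0 : ℝ) < q := by exact_mod_cast hq0
  obtain ⟨u, z, huz, hcover, hcell⟩ := hgrid q hq0
  -- The first term gives 8·4L ≤ nδ/q. A quarter of the whole bounds the occupation from below,
  -- hence both h₂n and 3.
  have hcell_size : 32 * (C₀ * R) + 4 * (b₂ * (n * y)) ≤ n * (δ / q) := by
    calc 32 * (C₀ * R) + 4 * (b₂ * (n * y)) ≤ 32 * (C₀ * (n * y)) + 4 * (b₂ * (n * y)) := by gcongr
      _ = (δ * E) * (n * y) := by rw [hδE]; ring
      _ = n * (δ * (E * y)) := by ring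
      _ ≤ n * (δ * (1 / q)) := by gcongr
      _ = _ := by ring
  have hb2ny : 0 < b₂ * (n * y) := by positivity
  set w : Fin m → Fin m → ℝ := fun k => weight ⌊β⌋₊ K t h₁ (t k) with hwdef
  have hbad₁ := hS.measureReal_noise_products hf hρ.le hρ1.le ht w (v := v) (θ := θ) (W := W)
    (fun k => by
      have := ((hw₁ (t k) (ht k)).sum_sq).trans hmh
      rw [hv]
      gcongr) hθ0 hW0 (fun k => (hw₁ (t k) (ht k)).sum_abs) hθW (4 * L)
  have hbad₂ := measureReal_not_grid_le hS.measurable_latent hS.indep_latent hS.uniform_latent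
    (d := δ / q) (by positivity) huz (T := 4 * L) (by linarith)
  refine measure_compl_le_of_real (B := _ ∪ _) ?_
    ((measureReal_union_le _ _).trans ((add_le_add hbad₁ hbad₂).trans ?_))
  · intro ω hω
    by_contra hgood
    rw [mem_union, not_or] at hgood
    obtain ⟨hg₁, hg₂⟩ := hgood
    simp only [mem_ofPred_eq, not_exists, not_or, not_lt, not_and] at hg₁
    rw [mem_ofPred_eq, not_not] at hg₂
    obtain ⟨hlt, hcount⟩ := hg₂
    refine hω fun s hs => ?_
    have hC'0 : 0 ≤ C' := le_trans (by positivity) hC'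
    refine stageThree_error_le hρ.le hH (hw₃ s hs) (fun k => A k ω) (fun i => ξ i ω)
      (X := 117 * (B * R)) (by positivity) (by positivity) (fun k i => ?_) ?_
    · rw [stageTwo, hS.stageOne_eq hf hρ.le hρ1.le ht]
      have hbias : ∀ i j, |meanMatrix f ρ t (w k) (fun i => ξ i ω) i j
          - probMatrix f ρ (fun i => ξ i ω) (t k) i j| ≤ ρ * (D * y) := by
        intro i j
        refine (abs_meanMatrix_sub_le hρ.le hH (hw₁ (t k) (ht k)) (fun i => ξ i ω) i j).trans ?_
        calc ρ * (W * h₁ ^ β) ≤ ρ * (W * (b₂ * h) ^ β) := by gcongr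
          _ = ρ * (D * y) := by
            rw [Real.mul_rpow hb₂.le hh0.le, hy, hD]; ring
      have hPm := fun i j => probMatrix_mem hf hρ.le (fun i => ξ i ω) (ht k) i j
      have hPabs : ∀ i j, |probMatrix f ρ (fun i => ξ i ω) (t k) i j| ≤ ρ := fun i j => by
        rw [abs_of_nonneg (hPm i j).1]; exact (hPm i j).2
      have hyy : y * y ≤ y := mul_le_of_le_one_left hy0.le hy1
      have hBle : ∀ B', B' ≤ B → B' * R ≤ B * R := fun B' hB' => by gcongr
      refine sum_sq_nbhdSmooth_sub_le (ρ := ρ) (τ := ρ * (|L₂| / q)) (X := B * R)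
        (A := 2 * n * v + W ^ 2 * (4 * L)) (by positivity) hPm (fun i => ?_) (fun i l => ?_)
        (fun i l => ((hg₁ k l i).2.1.trans hcross).trans (hBle _ (by rw [hB]; linarith)))
        (fun i l hil => ((hg₁ k i l).2.2 hil |>.trans hnoise).trans
          (hBle _ (by rw [hB]; linarith)))
        (fun i => (hg₁ k i i).1) (hdiag.trans ?_) (by positivity) ?_ (fun i => ?_) i
      · calc _ ≤ ∑ _j : Fin n, (ρ * (D * y)) ^ 2 := by
              refine Finset.sum_le_sum fun j _ => ?_
              rw [← sq_abs]
              exact pow_le_pow_left₀ (abs_nonneg _) (hbias i j) 2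
          _ = n * (ρ ^ 2 * (y * y)) * D ^ 2 := by simp; ring
          _ ≤ n * (ρ ^ 2 * y) * D ^ 2 := by gcongr
          _ = D ^ 2 * R := by rw [hR]; ring
          _ ≤ B * R := hBle _ (by rw [hB, hB₁]; linarith)
      · refine (abs_dotProduct_sub_dotProduct_le (hPabs i) (hPabs l) (hbias i) (hbias l)).trans ?_
        calc n * (2 * (ρ * (ρ * (D * y))) + ρ * (D * y) * (ρ * (D * y)))
            = 2 * D * (n * (ρ ^ 2 * y)) + D ^ 2 * (n * (ρ ^ 2 * (y * y))) := by ring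
          _ ≤ 2 * D * (n * (ρ ^ 2 * y)) + D ^ 2 * (n * (ρ ^ 2 * y)) := by gcongr
          _ = B₁ * R := by rw [hR, hB₁]; ring
          _ ≤ B * R := hBle _ (by rw [hB]; linarith)
      · have := hBle B₄ (by rw [hB]; linarith)
        gcongr
      · calc n * (ρ * (|L₂| / q) * ρ) = n * ρ ^ 2 * |L₂| * (1 / q) := by ring
          _ ≤ n * ρ ^ 2 * |L₂| * (2 * (E * y)) := by gcongr
          _ = B₅ * R := by rw [hB₅, hR]; ring
          _ ≤ B * R := hBle _ (by rw [hB]; linarith)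
      · obtain ⟨g, hgi⟩ := hcover (ξ i ω) (ξ i ω).2.1 (hlt i)
        refine ⟨Finset.univ.filter fun i' => u g ≤ ξ i' ω ∧ (ξ i' ω : ℝ) < z g, ?_, ?_, ?_⟩
        · refine le_trans ?_ (hcount g)
          have h5 : h₂ * n ≤ b₂ * (n * y) := by
            calc h₂ * n ≤ b₂ * (ρ * y) * n := by gcongr
              _ ≤ b₂ * (1 * y) * n := by gcongr
              _ = _ := by ring
          have : 0 < C₀ * R := by positivity
          linarith
        · have h6 : (3 : ℝ) ≤ ((Finset.univ.filter fun i' =>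
              u g ≤ ξ i' ω ∧ (ξ i' ω : ℝ) < z g).card : ℝ) := by
            refine le_trans ?_ (hcount g)
            linarith
          exact_mod_cast h6
        · intro i' hi' j
          simp only [Finset.mem_filter, Finset.mem_univ, true_and] at hi'
          have h7 := hcell g _ hgi _ hi' (ξ j ω) (ξ j ω).2.1 (hlt j) (t k) (ht k)
          simp only [probMatrix, Matrix.of_apply]
          rw [← mul_sub, abs_mul, abs_of_pos hρ]
          gcongr
    · have hyy : y ^ 2 ≤ y := by
        rw [sq]; exact mul_le_of_le_one_left hy0.le hy1
      rw [← hy]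
      calc 2 * (W ^ 2 * (117 * (B * R))) + 2 * (n * (ρ * (W * y)) ^ 2)
          = 2 * W ^ 2 * (117 * B) * R + 2 * W ^ 2 * (n * (ρ ^ 2 * y ^ 2)) := by ring
        _ ≤ 2 * W ^ 2 * (117 * B) * R + 2 * W ^ 2 * (n * (ρ ^ 2 * y)) := by gcongr
        _ = n * ((2 * W ^ 2 * (117 * B) + 2 * W ^ 2) * (ρ ^ 2 * y)) := by rw [hR]; ring
        _ ≤ _ := by gcongr
  · rw [hexp, Fintype.card_prod, Fintype.card_fin, Fintype.card_fin]
    push_cast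
    -- From q E y ≤ 1 ≤ L ≤ C₀R ≤ C₀n y one gets q ≤ nC₀/E.
    have hJq : (J : ℝ) * q ≤ m * n := by
      have h1 : (q : ℝ) ≤ n * C₀ / E := by
        rw [le_div_iff₀ hE0]
        have h2 : 1 ≤ C₀ * (n * y) := hL1.trans (hLR.trans (by gcongr))
        have h3 : (q * E) * y ≤ (n * C₀) * y := by linarith
        exact le_of_mul_le_mul_right h3 hy0
      calc (J : ℝ) * q ≤ J * (n * C₀ / E) := by gcongr
        _ = (J * C₀ / E) * n := by ring
        _ ≤ m * n := by gcongr
    exact failure_probability_le (by exact_mod_cast hn3) (by exact_mod_cast hm3) hJq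

end TVGraphon

/-! ### Assembly of the two regimes -/

theorem theorem2
    -- the graphon and its smoothness
    (f : ℝ → ℝ → ℝ → ℝ) (hf : TVGraphon.IsGraphon f)
    (β L₁ L₂ : ℝ) (hβ : 0 < β) (hL₁ : 0 < L₁)
    (hHolder : TVGraphon.HolderGraphon β L₁ f)
    (hLip : TVGraphon.PiecewiseLipschitz L₂ f)
    -- the kernel and the constants of the local polynomial regularity conditions
    (K : ℝ → ℝ) (hK : TVGraphon.KernelCondition K)
    (lam a₀ : ℝ) (hlam : 0 < lam) (ha₀ : 0 < a₀)
    -- the constants implicit in the bandwidth choices and in the definition of the two regimes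
    (b₁ b₂ c₁ c₂ : ℝ) (hb₁ : 0 < b₁) (hb : b₁ ≤ b₂) (hc₁ : 0 < c₁) (hc₂ : 0 < c₂) :
    ∃ C : ℝ, 0 < C ∧ ∃ Ctilde : ℝ, 0 < Ctilde ∧ ∃ γ : ℝ, 0 < γ ∧ ∃ N₀ : ℕ,
      ∀ n m : ℕ, N₀ ≤ n → N₀ ≤ m →
      ∀ ρ : ℝ, 0 < ρ → ρ < 1 → Real.sqrt (TVGraphon.logNM n m / (n * m)) ≤ ρ →
      ∀ t : Fin m → ℝ, (∀ k, t k ∈ Set.Icc (0 : ℝ) 1) → TVGraphon.DesignCondition t a₀ →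
      ∀ h₁ h₂ : ℝ, TVGraphon.EigenvalueCondition ⌊β⌋₊ K t lam h₁ →
      ∀ (Ω : Type*) [MeasurableSpace Ω] (μ : MeasureTheory.Measure Ω)
        [MeasureTheory.IsProbabilityMeasure μ]
        (ξ : Fin n → Ω → unitInterval) (A : Fin m → Ω → Matrix (Fin n) (Fin n) ℝ),
        TVGraphon.IsGraphonSample μ f ρ t ξ A →
        -- first regime
        (c₁ * TVGraphon.boundary β n m ≤ n * ρ →
          b₁ * TVGraphon.h1Dense β ρ n m ≤ h₁ → h₁ ≤ b₂ * TVGraphon.h1Dense β ρ n m →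
          b₁ * TVGraphon.h2Dense β ρ n m ≤ h₂ → h₂ ≤ b₂ * TVGraphon.h2Dense β ρ n m →
          TVGraphon.EigenvalueCondition ⌊β⌋₊ K t lam (TVGraphon.h3Dense β ρ n m) →
          μ ((TVGraphon.uniformErrorLE f ρ ⌊β⌋₊ K t h₁ h₂ (TVGraphon.h3Dense β ρ n m) ξ A
              (C * TVGraphon.rateDense β ρ n m))ᶜ)
            ≤ ENNReal.ofReal (2 * ((n : ℝ) * m) ^ (-(Ctilde + γ)))) ∧
        -- second regime
        (n * ρ ≤ c₂ * TVGraphon.boundary β n m →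
          b₁ * TVGraphon.h1Sparse β ρ n m ≤ h₁ → h₁ ≤ b₂ * TVGraphon.h1Sparse β ρ n m →
          b₁ / n ≤ h₂ → h₂ ≤ 1 / n →
          TVGraphon.EigenvalueCondition ⌊β⌋₊ K t lam (TVGraphon.h3Sparse β ρ n m) →
          μ ((TVGraphon.uniformErrorLE f ρ ⌊β⌋₊ K t h₁ h₂ (TVGraphon.h3Sparse β ρ n m) ξ A
              (C * TVGraphon.rateSparse β ρ n m))ᶜ)
            ≤ ENNReal.ofReal (2 * ((n : ℝ) * m) ^ (-(Ctilde + γ)))) := by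
  obtain ⟨C₁, hC₁, N₁, hdense⟩ := TVGraphon.exists_dense_bound hf hβ hL₁ hHolder hLip hK hlam ha₀
    hb₁ hb hc₁
  obtain ⟨C₂, hC₂, hsparse⟩ := TVGraphon.exists_sparse_bound hf hβ hL₁ hHolder hK hlam ha₀ hb₁ hb
  -- Both regimes fail with probability at most 2/(nm), so `Ctilde` and `γ` need only add up to 1.
  refine ⟨C₁ + C₂, by positivity, 1 / 2, by norm_num, 1 / 2, by norm_num, N₁ + 3, ?_⟩
  intro n m hn hm ρ hρ hρ1 hρN t ht hD h₁ h₂ hE₁ Ω _ μ _ ξ A hS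
  have hpow : 2 * ((n : ℝ) * m) ^ (-((1 : ℝ) / 2 + 1 / 2)) = 2 / ((n : ℝ) * m) := by
    rw [add_halves, Real.rpow_neg_one, div_eq_mul_inv]
  rw [hpow]
  refine ⟨fun hreg hh1 hh1' hh2 hh2' hE₃ => ?_, fun _ hh1 hh1' _ hh2 hE₃ => ?_⟩
  · exact hdense n m (by omega) (by omega) ρ hρ hρ1 hρN t ht hD h₁ h₂ hE₁ Ω μ ξ A hS hreg hh1 hh1'
      hh2 hh2' hE₃ _ (by linarith)
  · exact hsparse n m (by omega) (by omega) ρ hρ hρ1 t ht hD h₁ h₂ hE₁ Ω μ ξ A hS hh1 hh1' hh2 hE₃ _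
      (by linarith)
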